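/- **Setting.** Let $\Pi$ be a finite nonempty set of decisions, $O$ a measurable space of observations with a base measure $\nu$, and $R:O\to\mathbb R$ a known measurable reward. An instance $f$ assigns to each $\pi\in\Pi$ a probability density $f[\pi]$ on $O$ with respect to $\nu$. Let $\mathcal F$ be a (possibly infinite) class of instances such that, for all $f\in\mathcal F$, $\pi\in\Pi$: $\sup_o f[\pi](o)<\infty$; $0\le R(o)\le R_{\max}$ for $f[\pi]$-almost every $o$; and $R_f(\pi)=\mathbb E_{o\sim f[\pi]}[R(o)]$ has a unique maximizer $\pi^\star(f)$. Put $\Delta(f,\pi)=R_f(\pi^\star(f))-R_f(\pi)$. In round $t$ a learner picks $\pi_t$ from the past observations and sees $o_t\sim f^\star[\pi_t]$; $\mathrm{Reg}_{f^\star,n}=\mathbb E_{f^\star}\big[\sum_{t=1}^n\Delta(f^\star,\pi_t)\big]$. For $B\ge 0$ let $$\mathcal C(f,B)=\inf\Big\{\sum_\pi w_\pi\Delta(f,\pi)\;:\;0\le w_\pi\le B,\ \sum_\pi w_\pi D_{\rm KL}(f[\pi]\|g[\pi])\ge 1\ \ \forall g\in\mathcal F,\ \pi^\star(g)\ne\pi^\star(f)\Big\}$$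 (with $0\cdot\infty=0$ and $\inf\emptyset=\infty$), and $\mathcal C(f)=\lim_{n\to\infty}\mathcal C(f,n)$. For $\zeta\in(0,1)$ let $D_\zeta(p\|q)=\frac1{\zeta-1}\ln\int p^\zeta q^{1-\zeta}\,d\nu$. **Conditions.** 1. There are constants $c_1,c_2,c_3>0$ and a function $\iota:\mathcal F\to(0,\infty)$ such that for all $\alpha>0$, $\epsilon>0$, $f\in\mathcal F$ there is $\lambda_0(\alpha,\epsilon,f)>0$ with $\lambda_0(\alpha,\epsilon,f)\ge\epsilon^{c_1}\min\{1/\alpha,c_2\}^{c_3}\iota(f)$ and, for all $\lambda\in(0,1)$ with $\lambda\le\lambda_0(\alpha,\epsilon,f)$, all $g\in\mathcal F$ and $\pi\in\Pi$: $D_{1-\lambda}(f[\pi]\|g[\pi])\ge\min\{D_{\rm KL}(f[\pi]\|g[\pi])-\epsilon,\alpha\}$. 2. $\nu(O)<\infty$, and, with $\mathcal N(\mathcal F,\epsilon)$ the proper covering number of $\mathcal F$ for the distance $d(f,g)=\sup_{\pi,o}|f[\pi](o)-g[\pi](o)|$, $\mathcal N(\mathcal F,\epsilon)$ is finite and $\ln\mathcal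 N(\mathcal F,\epsilon)=O(\ln(1/\epsilon))$ as $\epsilon\downarrow0$. 3. (For the true instance $f^\star\in\mathcal F$.) There is $c_{\min}>0$ such that $f^\star[\pi](o)>c_{\min}$ whenever $f^\star[\pi](o)\neq0$; and there are $\iota',c_5>0$ such that for all $f\in\mathcal F$, $\pi\in\Pi$ with $D_{\rm KL}(f^\star[\pi]\|f[\pi])\le1$ one has $\sup_o|f^\star[\pi](o)-f[\pi](o)|\le\iota' D_{\rm KL}(f^\star[\pi]\|f[\pi])^{c_5}$. **Algorithm Test-to-Commit (horizon $n$).** Let $b_n=(\ln\ln n)^{1/4}$. *Step 1:* play every decision $\lceil\ln n/\ln\ln n\rceil$ times and let $\hat f\in\mathcal F$ maximize the log-likelihood of the observations over $\mathcal F$. *Step 2:* let $\hat w$ be a solution of the program defining $\mathcal C(\hat f,b_n)$ and play every $\pi$ exactly $\lceil((1+1/b_n)\hat w_\pi+1/b_n)\ln n\rceil$ times. Accept $\hat f$ if the decisions and observations $(\pi_i,o_i)$ of this step satisfy $\sum_i\ln\frac{\hat f[\pi_i](o_i)}{g[\pi_i](o_i)}\ge\ln n$ for all $g\in\mathcal F$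 with $\pi^\star(g)\ne\pi^\star(\hat f)$. *Step 3:* in the remaining rounds play $\pi^\star(\hat f)$ if $\hat f$ was accepted; otherwise run UCB from scratch, always playing a decision $\pi$ with maximal index $\hat\mu_\pi+R_{\max}\sqrt{2\ln(n^2)/T_\pi}$, where $T_\pi$ and $\hat\mu_\pi$ are the number of plays and the average reward of $\pi$ in this step (index $\infty$ if $T_\pi=0$). Ties are broken arbitrarily (measurably). Since maximizers and minimizers need not exist, it is only required that $\hat f$ maximizes the log-likelihood up to $\tau_n$, and that $\hat w\in[0,b_n]^\Pi$ is feasible and optimal up to $\tau_n$ whenever the program is feasible, where $\tau_n\ge0$, $\tau_n\to0$ ($\tau_n=0$ being the exact algorithm). **Theorem.** If Conditions 1–3 hold, then for every such implementation of Test-to-Commit $$\limsup_{n\to\infty}\frac{\mathrm{Reg}_{f^\star,n}}{\ln n}\le\mathcal C(f^\star).$$ -/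

import Mathlib

open MeasureTheory Filter Topology InformationTheory
open scoped ENNReal NNReal

noncomputable section

namespace T2C

/-- An instance: it assigns to every decision `π` a density `f π` on the observation space,
with respect to a fixed base measure. -/
abbrev Inst (D O : Type*) := D → O → ℝ≥0

variable {D O : Type*} [Fintype D] [Nonempty D] [MeasurableSpace O]

/-! ### Interactive decision making problems -/

/-- The distribution over observations of decision `π` under instance `f`. -/
def law (ν : Measure O) (f : Inst D O) (π : D) : Measure O :=
  ν.withDensity fun o => (f π o : ℝ≥0∞)

/-- Expected reward of decision `π` under instance `f`. -/
def meanReward (ν : Measure O) (R : O → ℝ) (f : Inst D O) (π : D) : ℝ :=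
  ∫ o, R o ∂(law ν f π)

/-- An optimal decision of instance `f` (the optimal decision, when it is unique). -/
def best (ν : Measure O) (R : O → ℝ) (f : Inst D O) : D :=
  Classical.choose (Finite.exists_max (meanReward ν R f))

/-- The sub-optimality gap `Δ(f, π)`. -/
def gap (ν : Measure O) (R : O → ℝ) (f : Inst D O) (π : D) : ℝ :=
  meanReward ν R f (best ν R f) - meanReward ν R f π

/-- The standing assumptions on the base measure, the reward and the hypothesis class. -/
structure IsDecisionProblem (ν : Measure O) (R : O → ℝ) (Rmax : ℝ) (F : Set (Inst D O)) :
    Prop where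
  measurable_reward : Measurable R
  measurable_density : ∀ f ∈ F, ∀ π, Measurable (f π)
  lintegral_density : ∀ f ∈ F, ∀ π, ∫⁻ o, (f π o : ℝ≥0∞) ∂ν = 1
  bounded_density : ∀ f ∈ F, ∀ π, BddAbove (Set.range (f π))
  bounded_reward : ∀ f ∈ F, ∀ π, ∀ᵐ o ∂(law ν f π), 0 ≤ R o ∧ R o ≤ Rmax
  unique_optimal : ∀ f ∈ F, ∃! π, ∀ π', meanReward ν R f π' ≤ meanReward ν R f π

/-! ### The complexity measure -/

/-- KL divergence between the observation distributions of `π` under `f` and `g`. -/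
def kl (ν : Measure O) (f g : Inst D O) (π : D) : ℝ≥0∞ :=
  klDiv (law ν f π) (law ν g π)

/-- The feasible set of the program defining `C(f, B)`. -/
def Feasible (ν : Measure O) (R : O → ℝ) (F : Set (Inst D O)) (f : Inst D O) (B : ℝ)
    (w : D → ℝ≥0) : Prop :=
  (∀ g ∈ F, best ν R g ≠ best ν R f → 1 ≤ ∑ π, (w π : ℝ≥0∞) * kl ν f g π) ∧
    ∀ π, (w π : ℝ) ≤ B

/-- The objective of the program defining `C(f, B)`. -/
def cost (ν : Measure O) (R : O → ℝ) (f : Inst D O) (w : D → ℝ≥0) : ℝ≥0∞ :=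
  ∑ π, (w π : ℝ≥0∞) * ENNReal.ofReal (gap ν R f π)

/-- The value `C(f, B)`; it is `∞` if the program is infeasible. -/
def complexityAt (ν : Measure O) (R : O → ℝ) (F : Set (Inst D O)) (f : Inst D O) (B : ℝ) :
    ℝ≥0∞ :=
  ⨅ (w : D → ℝ≥0) (_ : Feasible ν R F f B w), cost ν R f w

/-- The asymptotic complexity `C(f) = lim C(f, n)`. -/
def complexity (ν : Measure O) (R : O → ℝ) (F : Set (Inst D O)) (f : Inst D O) : ℝ≥0∞ :=
  limUnder atTop fun k : ℕ => complexityAt ν R F f k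

theorem complexityAt_antitone (ν : Measure O) (R : O → ℝ) (F : Set (Inst D O))
    (f : Inst D O) : Antitone (complexityAt ν R F f) := fun _ _ h =>
  le_iInf₂ fun w hw => iInf₂_le w ⟨hw.1, fun π => (hw.2 π).trans h⟩

/-- The limit defining `C(f)` always exists. -/
theorem tendsto_complexity (ν : Measure O) (R : O → ℝ) (F : Set (Inst D O))
    (f : Inst D O) :
    Tendsto (fun k : ℕ => complexityAt ν R F f k) atTop (𝓝 (complexity ν R F f)) := by
  have h : Tendsto (fun k : ℕ => complexityAt ν R F f k) atTop
      (𝓝 (⨅ k : ℕ, complexityAt ν R F f k)) :=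
    tendsto_atTop_iInf fun _ _ hab =>
      complexityAt_antitone ν R F f (Nat.cast_le.mpr hab)
  exact tendsto_nhds_limUnder ⟨_, h⟩

/-! ### The three conditions -/

/-- The Rényi divergence of order `ζ ∈ (0, 1)` between two densities; it is `⊤` when the
densities are mutually singular. -/
def renyi (ν : Measure O) (ζ : ℝ) (p q : O → ℝ≥0) : EReal :=
  ((1 / (ζ - 1) : ℝ) : EReal) *
    ENNReal.log (∫⁻ x, (p x : ℝ≥0∞) ^ ζ * (q x : ℝ≥0∞) ^ (1 - ζ) ∂ν)

/-- Uniform convergence of the Rényi divergences to the KL divergence. -/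
def RenyiUniformConvergence (ν : Measure O) (F : Set (Inst D O)) : Prop :=
  ∃ (c₁ c₂ c₃ : ℝ) (ι : Inst D O → ℝ) (lam₀ : ℝ → ℝ → Inst D O → ℝ),
    0 < c₁ ∧ 0 < c₂ ∧ 0 < c₃ ∧ (∀ f ∈ F, 0 < ι f) ∧
    ∀ α > 0, ∀ ε > 0, ∀ f ∈ F,
      0 < lam₀ α ε f ∧
      ε ^ c₁ * min (1 / α) c₂ ^ c₃ * ι f ≤ lam₀ α ε f ∧
      ∀ lam : ℝ, 0 < lam → lam < 1 → lam ≤ lam₀ α ε f → ∀ g ∈ F, ∀ π,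
        min ((kl ν f g π : EReal) - (ε : EReal)) (α : EReal) ≤
          renyi ν (1 - lam) (f π) (g π)

/-- The sup-distance `sup_o |p(o) - q(o)|` of two densities. -/
def densityDist (p q : O → ℝ≥0) : ℝ≥0∞ := ⨆ o, edist (p o) (q o)

/-- The distance `d(f, g) = sup_{π, o} |f[π](o) - g[π](o)|` of two instances. -/
def instDist (f g : Inst D O) : ℝ≥0∞ := ⨆ π, densityDist (f π) (g π)

/-- The proper covering number of `F` at scale `ε` for the distance `d`. -/
def coveringNumber (F : Set (Inst D O)) (ε : ℝ) : ℕ∞ :=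
  ⨅ (C : Set (Inst D O))
    (_ : C ⊆ F ∧ ∀ g ∈ F, ∃ g' ∈ C, instDist g g' ≤ ENNReal.ofReal ε), C.encard

/-- Logarithmic growth of the log-covering number, and finite volume of the base measure. -/
def LogCovering (ν : Measure O) (F : Set (Inst D O)) : Prop :=
  (∃ c : ℝ, ∀ᶠ ε in 𝓝[>] (0 : ℝ), coveringNumber F ε ≠ ⊤ ∧
    Real.log (coveringNumber F ε).toNat ≤ c * Real.log (1 / ε)) ∧
  ν Set.univ < ⊤

/-- The density of `fstar` is bounded below on its support, and the sup-distance to `fstar`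
is controlled by a power of the KL divergence. -/
def DensityControl (ν : Measure O) (F : Set (Inst D O)) (fstar : Inst D O) : Prop :=
  (∃ cmin : ℝ, 0 < cmin ∧ ∀ π o, fstar π o ≠ 0 → cmin < fstar π o) ∧
  ∃ ι c₅ : ℝ, 0 < ι ∧ 0 < c₅ ∧ ∀ f ∈ F, ∀ π, kl ν fstar f π ≤ 1 →
    densityDist (fstar π) (f π) ≤ ENNReal.ofReal ι * kl ν fstar f π ^ c₅

/-! ### The interaction and the regret

A (deterministic, non-anticipating) learner maps the list of past observations to the next
decision. -/

/-- The joint distribution of the first `t` observations when the learner `alg` interacts with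
instance `f`: given the past `h`, the next observation is drawn from `f[alg h]`. -/
def obsLaw (ν : Measure O) (f : Inst D O) (alg : List O → D) :
    (t : ℕ) → Measure (Fin t → O)
  | 0 => Measure.dirac Fin.elim0
  | t + 1 => (obsLaw ν f alg t).bind fun h =>
      (law ν f (alg (List.ofFn h))).map fun o =>
        (Fin.snoc (α := fun _ => O) h o : Fin (t + 1) → O)

/-- Expected regret over `n` rounds. -/
def regret (ν : Measure O) (R : O → ℝ) (f : Inst D O) (alg : List O → D) (n : ℕ) : ℝ :=
  ∫ h, ∑ t ∈ Finset.range n, gap ν R f (alg ((List.ofFn h).take t)) ∂(obsLaw ν f alg n)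

/-! ### Test-to-Commit -/

/-- The list of decisions in which every `π` occurs `k π` times. -/
def playList (k : D → ℕ) : List D :=
  (Finset.univ : Finset D).toList.flatMap fun π => List.replicate (k π) π

/-- Step 1: every decision is played `⌈ln n / ln ln n⌉` times. -/
def initPlays (D : Type*) [Fintype D] (n : ℕ) : List D :=
  playList fun _ => ⌈Real.log n / Real.log (Real.log n)⌉₊

/-- The quantity `(ln ln n)^{1/4}`. -/
def cap (n : ℕ) : ℝ := Real.log (Real.log n) ^ (1 / 4 : ℝ)

/-- Step 2: every decision is played `⌈((1 + 1/(ln ln n)^{1/4}) w_π + 1/(ln ln n)^{1/4}) ln n⌉`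
times. -/
def identPlays (n : ℕ) (w : D → ℝ≥0) : List D :=
  playList fun π => ⌈((1 + 1 / cap n) * w π + 1 / cap n) * Real.log n⌉₊

/-- The log-likelihood of a list of decisions and observations, with `ln 0 = -∞`. -/
def logLik (f : Inst D O) (l : List (D × O)) : EReal :=
  (l.map fun p => ENNReal.log (f p.1 p.2)).sum

/-- The log-likelihood ratio, with `ln (x / 0) = ∞` for `x > 0` and `ln 0 = -∞`; a sum with a
summand `-∞` is `-∞`. -/
def logLikRatio (f g : Inst D O) (l : List (D × O)) : EReal :=
  (l.map fun p => ENNReal.log ((f p.1 p.2 : ℝ≥0∞) / (g p.1 p.2 : ℝ≥0∞))).sum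

/-- The acceptance event of the log-likelihood ratio test of `fhat`. -/
def Accepts (ν : Measure O) (R : O → ℝ) (F : Set (Inst D O)) (n : ℕ) (fhat : Inst D O)
    (l : List (D × O)) : Prop :=
  ∀ g ∈ F, best ν R g ≠ best ν R fhat → (Real.log n : EReal) ≤ logLikRatio fhat g l

open scoped Classical in
/-- The UCB index of `π` with horizon `n` for rewards in `[0, Rmax]`:
empirical mean plus `Rmax √(2 ln(n²) / T_π)`, and `∞` for a decision that was not played. -/
def ucbIndex (R : O → ℝ) (Rmax : ℝ) (n : ℕ) (hist : List (D × O)) (π : D) : EReal :=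
  let mine := hist.filter fun p => p.1 = π
  if mine.length = 0 then ⊤
  else (((mine.map fun p => R p.2).sum / mine.length +
    Rmax * √(2 * Real.log ((n : ℝ) ^ 2) / mine.length) : ℝ) : EReal)

/-- The decisions and observations of a UCB phase, given the observations of that phase. -/
def ucbHistory (ucb : List (D × O) → D) (obs : List O) : List (D × O) :=
  obs.foldl (fun hist o => hist ++ [(ucb hist, o)]) []

open scoped Classical in
/-- Test-to-Commit with horizon `n`. The parameters are the estimator `est` and the weights `wt`
(functions of the observations of Step 1) and the rule `ucb` for the UCB phase. -/
def t2c (ν : Measure O) (R : O → ℝ) (F : Set (Inst D O)) (n : ℕ)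
    (est : List O → Inst D O) (wt : List O → D → ℝ≥0) (ucb : List (D × O) → D)
    (obs : List O) : D :=
  let init := initPlays D n
  if h₁ : obs.length < init.length then init[obs.length]
  else
    let x := obs.take init.length
    let rest := obs.drop init.length
    let ident := identPlays n (wt x)
    if h₂ : rest.length < ident.length then ident[rest.length]
    else if Accepts ν R F n (est x) (ident.zip rest) then best ν R (est x)
    else ucb (ucbHistory ucb (rest.drop ident.length))

/-- `est` computes a maximum likelihood estimate in `F`, up to `tol` in the log-likelihood,
from the observations of Step 1, and it depends measurably on them. -/
structure IsMLE (F : Set (Inst D O)) (n : ℕ) (tol : ℝ) (est : List O → Inst D O) :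
    Prop where
  mem : ∀ x : List O, x.length = (initPlays D n).length → est x ∈ F
  maximal : ∀ x : List O, x.length = (initPlays D n).length → ∀ g ∈ F,
    logLik g ((initPlays D n).zip x) ≤
      logLik (est x) ((initPlays D n).zip x) + (tol : EReal)
  measurable : ∀ π, Measurable fun p : (Fin (initPlays D n).length → O) × O =>
    est (List.ofFn p.1) π p.2

/-- `wt` computes, from the observations of Step 1, a solution of the program defining
`C(est x, (ln ln n)^{1/4})`, up to `tol` in the objective, and it depends measurably on them.
If the program is infeasible, any weights that obey the cap are allowed. -/
structure SolvesProgram (ν : Measure O) (R : O → ℝ) (F : Set (Inst D O)) (n : ℕ) (tol : ℝ)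
    (est : List O → Inst D O) (wt : List O → D → ℝ≥0) : Prop where
  le_cap : ∀ x : List O, x.length = (initPlays D n).length → ∀ π, (wt x π : ℝ) ≤ cap n
  optimal : ∀ x : List O, x.length = (initPlays D n).length →
    (∃ w, Feasible ν R F (est x) (cap n) w) →
      Feasible ν R F (est x) (cap n) (wt x) ∧
      cost ν R (est x) (wt x) ≤
        complexityAt ν R F (est x) (cap n) + ENNReal.ofReal tol
  measurable : ∀ π, Measurable fun x : Fin (initPlays D n).length → O =>
    wt (List.ofFn x) π

/-- `ucb` always selects a decision of maximal UCB index, with measurable tie-breaking. -/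
structure IsUCB (R : O → ℝ) (Rmax : ℝ) (n : ℕ) (ucb : List (D × O) → D) : Prop where
  maximal : ∀ hist π, ucbIndex R Rmax n hist π ≤ ucbIndex R Rmax n hist (ucb hist)
  measurable : ∀ (t : ℕ) (d : Fin t → D) (π : D),
    MeasurableSet {h : Fin t → O | ucb (List.ofFn fun i => (d i, h i)) = π}

end T2C

end

/-! Write `x = ln n`, `b = cap n = (ln x)^(1/4)` and `K` for the number of decisions. Fix weights
`w` feasible for the true instance `f₀` with some cap. It suffices to bound the normalized regret
asymptotically by every number above the cost of `w`, since such costs approach the complexity.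

The regret has three sources. The first phase has length `O(x / ln x)` and is negligible. If the
estimate is good, the second phase costs about `x` times the cost of `w`, and what follows is nearly
free. If the estimate is bad, the second phase and UCB cost `O(b x)`, but this happens with
probability at most `1 / x`, so the contribution is `O(b) = o(x)`. Committing to a wrong decision
can cost order `n`, but then `f₀` is itself an alternative, and acceptance makes the likelihood
ratio of the estimate against `f₀` at least `n`. That ratio has mean at most one, so Markov's
inequality pays for the commitment.

A good estimate is within `δ` of `f₀` in KL divergence for every decision. Density control turns
this into sup-closeness, and the lower bound on the support together with the Rényi condition turns
that into a relative perturbation of size `η = 1 / (64 K b²)` (`relClose_of_densityDist_le`). Hence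
the best decision is the same, the gaps are close, and KL divergences to any alternative change by a
factor near one plus `O(η)`. So `(1 + 1/b) w` is feasible for the estimate and the computed weights
are almost as cheap as `w` (`sum_weights_gap_le`). Conversely the computed weights are almost
feasible for `f₀`, and the inflated play counts collect information at least `(1 + 1/(4b)) x`
against every alternative (`le_sum_identCount_mul_truncKL`), exceeding the acceptance threshold `x`.

Both error probabilities, of a bad estimate and of rejecting a good one, come from Chernoff bounds
with a small exponent `λ`. The Rényi condition bounds `∫ f₀^(1-λ) g^λ` by `exp (-λ min (KL - ε) α)`.
Infinitely many `g` are handled by a cover at scale `exp (-M)`, `M = √x`: each `g` lies below the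
envelope of a centre, and finite volume controls the moments of envelopes
(`exists_cover_moment_le`). The entropy is `O(√x)`, while the gained exponent is `x` times a factor
decaying more slowly than every power of `x`, so the bounds are eventually at most `1 / x`.

No measurability of the test or of the policy along a history is used. Regret is bounded by iterated
lower integrals (`value`), and a bad event enters only through a measurable supermartingale that is
at least one on it. For UCB this is an exponential potential summed over decisions and play counts;
for the two phases with fixed plays it is a sum of products of likelihood ratios
(`value_fixed_plays_le`). -/

noncomputable section

namespace T2C

set_option linter.unusedSectionVars false

section

variable {D O : Type*} [Fintype D] [Nonempty D] [MeasurableSpace O]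

/-! ### Iterated expectations along the interaction -/

/-- The expectation of `φ` at the history reached from `h` after `t` further rounds, as an iterated
(lower) integral. -/
def value (ν : Measure O) (f : Inst D O) (alg : List O → D) :
    ℕ → (List O → ℝ≥0∞) → List O → ℝ≥0∞
  | 0, φ, h => φ h
  | t + 1, φ, h => ∫⁻ o, value ν f alg t φ (h ++ [o]) ∂(law ν f (alg h))

theorem value_add (ν : Measure O) (f : Inst D O) (alg : List O → D) (s t : ℕ)
    (φ : List O → ℝ≥0∞) (h : List O) :
    value ν f alg (s + t) φ h = value ν f alg s (value ν f alg t φ) h := by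
  induction s generalizing h with
  | zero => simp [value]
  | succ s ih =>
    rw [Nat.succ_add]
    simp only [value]
    exact lintegral_congr fun o => ih _

/-- Supermartingale bound for iterated expectations. -/
theorem value_le_of_supermartingale (ν : Measure O) (f : Inst D O) (alg : List O → D) (t : ℕ)
    (φ W : List O → ℝ≥0∞) (h : List O)
    (hstep : ∀ z : List O, z.length < t →
      ∫⁻ o, W (z ++ [o]) ∂(law ν f (alg (h ++ z))) ≤ W z)
    (hend : ∀ z : List O, z.length = t → φ (h ++ z) ≤ W z) :
    value ν f alg t φ h ≤ W [] := by
  induction t generalizing h W with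
  | zero => simpa [value] using hend [] rfl
  | succ t ih =>
    simp only [value]
    calc ∫⁻ o, value ν f alg t φ (h ++ [o]) ∂(law ν f (alg h))
        ≤ ∫⁻ o, W ([] ++ [o]) ∂(law ν f (alg h)) := by
          refine lintegral_mono fun o => ?_
          -- `W` sees only the rounds played after `h`, so extending the history by `o` replaces `W`
          -- by its shift by `o`.
          refine ih (fun z => W (o :: z)) (h ++ [o]) (fun z hz => ?_) (fun z hz => ?_)
          · have := hstep (o :: z) (by simpa using hz)
            simpa using this
          · have := hend (o :: z) (by simpa using hz)
            simpa using this
      _ ≤ W [] := by simpa using hstep [] (by simp)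

theorem value_succ_last (ν : Measure O) (f : Inst D O) (alg : List O → D) (t : ℕ)
    (φ : List O → ℝ≥0∞) (h : List O) :
    value ν f alg (t + 1) φ h =
      value ν f alg t (fun z => ∫⁻ o, φ (z ++ [o]) ∂(law ν f (alg z))) h := by
  rw [value_add]; rfl

/-- Integrals against the law of the observations are at most the iterated expectation. -/
theorem lintegral_obsLaw_le_value (ν : Measure O) (f : Inst D O) (alg : List O → D) (t : ℕ)
    (φ : List O → ℝ≥0∞) :
    ∫⁻ h, φ (List.ofFn h) ∂(obsLaw ν f alg t) ≤ value ν f alg t φ [] := by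
  induction t generalizing φ with
  | zero =>
    -- A measurable minorant with the same lower integral stands in for `φ`, which is not assumed
    -- measurable.
    obtain ⟨g, hg, hle, heq⟩ := exists_measurable_le_lintegral_eq
      (obsLaw ν f alg 0) (fun h => φ (List.ofFn h))
    rw [heq]
    simp only [obsLaw]
    rw [lintegral_dirac' _ hg]
    simpa [value] using hle Fin.elim0
  | succ t ih =>
    rw [value_succ_last]
    refine le_trans ?_ (ih _)
    obtain ⟨g, hg, hle, heq⟩ := exists_measurable_le_lintegral_eq
      (obsLaw ν f alg (t + 1)) (fun h => φ (List.ofFn h))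
    rw [heq]
    simp only [obsLaw]
    by_cases hk : AEMeasurable (fun h : Fin t → O =>
      (law ν f (alg (List.ofFn h))).map fun o =>
        (Fin.snoc (α := fun _ => O) h o : Fin (t + 1) → O)) (obsLaw ν f alg t)
    · rw [Measure.lintegral_bind hk hg.aemeasurable]
      refine lintegral_mono fun h => ?_
      refine (lintegral_map_le _ _).trans (lintegral_mono fun o => ?_)
      refine (hle _).trans (le_of_eq ?_)
      simp only
      congr 1
      rw [List.ofFn_succ']
      simp [List.concat_eq_append]
    -- Without a.e. measurability of the transition kernel, `bind` is the zero measure by convention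
    -- and the bound is trivial.
    · rw [Measure.bind, Measure.map_of_not_aemeasurable hk]
      simp

/-! ### Regret accumulated along a history -/

theorem gap_nonneg (ν : Measure O) (R : O → ℝ) (f : Inst D O) (π : D) : 0 ≤ gap ν R f π :=
  sub_nonneg.2 (Classical.choose_spec (Finite.exists_max (meanReward ν R f)) π)

theorem gap_best (ν : Measure O) (R : O → ℝ) (f : Inst D O) : gap ν R f (best ν R f) = 0 :=
  sub_self _

/-- The regret incurred along the rounds of a history. -/
def pathRegret (ν : Measure O) (R : O → ℝ) (f : Inst D O) (alg : List O → D) (h : List O) : ℝ≥0∞ :=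
  ∑ t ∈ Finset.range h.length, ENNReal.ofReal (gap ν R f (alg (h.take t)))

theorem pathRegret_append (ν : Measure O) (R : O → ℝ) (f : Inst D O) (alg : List O → D)
    (h z : List O) :
    pathRegret ν R f alg (h ++ z) =
      pathRegret ν R f alg h + pathRegret ν R f (fun y => alg (h ++ y)) z := by
  unfold pathRegret
  rw [List.length_append, Finset.sum_range_add]
  congr 1
  · refine Finset.sum_congr rfl fun t ht => ?_
    rw [List.take_append_of_le_length (Finset.mem_range.1 ht).le]
  · refine Finset.sum_congr rfl fun t _ => ?_
    rw [List.take_length_add_append]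

/-- The norm of a Bochner integral is at most the lower integral of the norm even when the integrand
is not integrable, the integral then being zero by convention. -/
theorem ofReal_regret_le_value (ν : Measure O) (R : O → ℝ) (f : Inst D O) (alg : List O → D)
    (n : ℕ) :
    ENNReal.ofReal (regret ν R f alg n) ≤ value ν f alg n (pathRegret ν R f alg) [] := by
  refine le_trans ?_ (lintegral_obsLaw_le_value ν f alg n _)
  unfold regret
  calc _ ≤ ‖∫ h, ∑ t ∈ Finset.range n, gap ν R f (alg ((List.ofFn h).take t))
          ∂(obsLaw ν f alg n)‖ₑ := by
        rw [← ofReal_norm]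
        exact ENNReal.ofReal_le_ofReal (le_abs_self _)
    _ ≤ _ := enorm_integral_le_lintegral_enorm _
    _ ≤ _ := by
      refine lintegral_mono fun h => ?_
      simp only [pathRegret, List.length_ofFn]
      rw [Real.enorm_of_nonneg (Finset.sum_nonneg fun _ _ => gap_nonneg _ _ _ _),
        ENNReal.ofReal_sum_of_nonneg fun _ _ => gap_nonneg _ _ _ _]

/-! ### Laws and mean rewards of the instances of a decision problem -/

theorem IsDecisionProblem.isProbabilityMeasure {ν : Measure O} {R : O → ℝ} {Rmax : ℝ}
    {F : Set (Inst D O)} (hF : IsDecisionProblem ν R Rmax F) {f : Inst D O} (hf : f ∈ F) (π : D) :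
    IsProbabilityMeasure (law ν f π) :=
  ⟨by simp [law, hF.lintegral_density f hf π]⟩

theorem IsDecisionProblem.meanReward_mem {ν : Measure O} {R : O → ℝ} {Rmax : ℝ}
    {F : Set (Inst D O)} (hF : IsDecisionProblem ν R Rmax F) {f : Inst D O} (hf : f ∈ F) (π : D) :
    meanReward ν R f π ∈ Set.Icc 0 Rmax := by
  have := hF.isProbabilityMeasure hf π
  have hb := hF.bounded_reward f hf π
  have hi : Integrable R (law ν f π) :=
    Integrable.of_mem_Icc 0 Rmax hF.measurable_reward.aemeasurable hb
  refine ⟨integral_nonneg_of_ae (hb.mono fun o ho => ho.1), ?_⟩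
  calc meanReward ν R f π ≤ ∫ _, Rmax ∂(law ν f π) :=
        integral_mono_ae hi (integrable_const _) (hb.mono fun o ho => ho.2)
    _ = Rmax := by simp

theorem IsDecisionProblem.gap_le {ν : Measure O} {R : O → ℝ} {Rmax : ℝ}
    {F : Set (Inst D O)} (hF : IsDecisionProblem ν R Rmax F) {f : Inst D O} (hf : f ∈ F) (π : D) :
    gap ν R f π ≤ Rmax := by
  have h1 := hF.meanReward_mem hf π
  have h2 := hF.meanReward_mem hf (best ν R f)
  unfold gap
  linarith [h1.1, h2.2]

theorem IsDecisionProblem.Rmax_nonneg {ν : Measure O} {R : O → ℝ} {Rmax : ℝ}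
    {F : Set (Inst D O)} (hF : IsDecisionProblem ν R Rmax F) {f : Inst D O} (hf : f ∈ F) :
    0 ≤ Rmax :=
  (gap_nonneg ν R f (Classical.arbitrary D)).trans (hF.gap_le hf _)

theorem pathRegret_le {ν : Measure O} {R : O → ℝ} {Rmax : ℝ}
    {F : Set (Inst D O)} (hF : IsDecisionProblem ν R Rmax F) {f : Inst D O} (hf : f ∈ F)
    (alg : List O → D) (h : List O) :
    pathRegret ν R f alg h ≤ h.length * ENNReal.ofReal Rmax := by
  unfold pathRegret
  calc _ ≤ ∑ t ∈ Finset.range h.length, ENNReal.ofReal Rmax :=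
        Finset.sum_le_sum fun t _ => ENNReal.ofReal_le_ofReal (hF.gap_le hf _)
    _ = _ := by simp

/-! ### The UCB phase -/

/-- The Hoeffding lemma for the rewards. -/
theorem lintegral_exp_reward_le {ν : Measure O} {R : O → ℝ} {Rmax : ℝ}
    {F : Set (Inst D O)} (hF : IsDecisionProblem ν R Rmax F) {f : Inst D O} (hf : f ∈ F) (π : D)
    (θ : ℝ) :
    ∫⁻ o, ENNReal.ofReal (Real.exp (θ * (R o - meanReward ν R f π) - θ ^ 2 * Rmax ^ 2 / 8))
      ∂(law ν f π) ≤ 1 := by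
  have := hF.isProbabilityMeasure hf π
  have hsub := ProbabilityTheory.hasSubgaussianMGF_of_mem_Icc (μ := law ν f π) (X := R)
    (a := 0) (b := Rmax) hF.measurable_reward.aemeasurable (hF.bounded_reward f hf π)
  have hmgf := hsub.mgf_le θ
  have hint := hsub.integrable_exp_mul θ
  have hR : (((‖Rmax - 0‖₊ / 2) ^ 2 : ℝ≥0) : ℝ) = Rmax ^ 2 / 4 := by
    push_cast
    rw [sub_zero, Real.norm_eq_abs, div_pow, sq_abs]; norm_num
  have heq : ∀ o, Real.exp (θ * (R o - meanReward ν R f π) - θ ^ 2 * Rmax ^ 2 / 8) =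
      Real.exp (-(θ ^ 2 * Rmax ^ 2 / 8)) *
        Real.exp (θ * (R o - ∫ x, R x ∂(law ν f π))) := by
    intro o
    rw [← Real.exp_add]; congr 1; unfold meanReward; ring
  simp_rw [heq]
  rw [← ofReal_integral_eq_lintegral_ofReal (hint.const_mul _)
    (Eventually.of_forall fun o => by positivity), integral_const_mul]
  rw [← ENNReal.ofReal_one]
  refine ENNReal.ofReal_le_ofReal ?_
  unfold ProbabilityTheory.mgf at hmgf
  calc _ ≤ Real.exp (-(θ ^ 2 * Rmax ^ 2 / 8)) *
        Real.exp ((((‖Rmax - 0‖₊ / 2) ^ 2 : ℝ≥0) : ℝ) * θ ^ 2 / 2) := by gcongr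
    _ = 1 := by
      rw [← Real.exp_add, hR, Real.exp_eq_one_iff]; ring

open scoped Classical in
/-- The number of plays of `π` in a history. -/
def plays (H : List (D × O)) (π : D) : ℕ := (H.filter fun p => p.1 = π).length

open scoped Classical in
/-- The total reward of the plays of `π` in a history. -/
def rewards (R : O → ℝ) (H : List (D × O)) (π : D) : ℝ :=
  ((H.filter fun p => p.1 = π).map fun p => R p.2).sum

theorem plays_append_self (H : List (D × O)) (π : D) (o : O) :
    plays (H ++ [(π, o)]) π = plays H π + 1 := by
  simp [plays]

theorem plays_append_of_ne (H : List (D × O)) {π π' : D} (h : π' ≠ π) (o : O) :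
    plays (H ++ [(π', o)]) π = plays H π := by
  simp [plays, h]

theorem rewards_append_self (R : O → ℝ) (H : List (D × O)) (π : D) (o : O) :
    rewards R (H ++ [(π, o)]) π = rewards R H π + R o := by
  simp [rewards]

theorem rewards_append_of_ne (R : O → ℝ) (H : List (D × O)) {π π' : D} (h : π' ≠ π) (o : O) :
    rewards R (H ++ [(π', o)]) π = rewards R H π := by
  simp [rewards, h]

theorem plays_le_length (H : List (D × O)) (π : D) : plays H π ≤ H.length :=
  List.length_filter_le _ _

theorem ucbHistory_append (ucb : List (D × O) → D) (z : List O) (o : O) :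
    ucbHistory ucb (z ++ [o]) =
      ucbHistory ucb z ++ [(ucb (ucbHistory ucb z), o)] := by
  simp [ucbHistory]

theorem length_ucbHistory (ucb : List (D × O) → D) (z : List O) :
    (ucbHistory ucb z).length = z.length := by
  induction z using List.reverseRecOn with
  | nil => rfl
  | append_singleton z o ih => simp [ucbHistory_append, ih]

/-- The confidence radius of UCB. -/
def radius (Rmax : ℝ) (n s : ℕ) : ℝ := Rmax * √(2 * Real.log ((n : ℝ) ^ 2) / s)

theorem ucbIndex_of_plays_eq_zero (R : O → ℝ) (Rmax : ℝ) (n : ℕ) (H : List (D × O)) (π : D)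
    (h : plays H π = 0) : ucbIndex R Rmax n H π = ⊤ := by
  unfold plays at h
  simp only [ucbIndex]
  rw [if_pos h]

theorem ucbIndex_of_plays_ne_zero (R : O → ℝ) (Rmax : ℝ) (n : ℕ) (H : List (D × O)) (π : D)
    (h : plays H π ≠ 0) :
    ucbIndex R Rmax n H π =
      ((rewards R H π / plays H π + radius Rmax n (plays H π) : ℝ) : EReal) := by
  unfold plays at h
  simp only [ucbIndex]
  rw [if_neg h]
  rfl

/-- The exponential supermartingale of the rewards of `π`. -/
def expPotential (ν : Measure O) (R : O → ℝ) (Rmax : ℝ) (f : Inst D O) (θ : ℝ) (π : D)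
    (H : List (D × O)) : ℝ≥0∞ :=
  ENNReal.ofReal (Real.exp (θ * (rewards R H π - plays H π * meanReward ν R f π) -
    plays H π * (θ ^ 2 * Rmax ^ 2 / 8)))

theorem measurable_expPotential_append {ν : Measure O} {R : O → ℝ} (hR : Measurable R) (Rmax : ℝ)
    (f : Inst D O) (θ : ℝ) (π π' : D) (H : List (D × O)) :
    Measurable fun o => expPotential ν R Rmax f θ π (H ++ [(π', o)]) := by
  unfold expPotential
  by_cases h : π' = π
  · subst h
    simp only [rewards_append_self, plays_append_self]
    fun_prop
  · simp only [rewards_append_of_ne R H h, plays_append_of_ne H h]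
    fun_prop

/-- Only a play of `π` changes its exponential, and then by a factor whose mean is at most one by
Hoeffding's lemma. The decision played may depend on the past arbitrarily. -/
theorem lintegral_expPotential_append_le {ν : Measure O} {R : O → ℝ} {Rmax : ℝ}
    {F : Set (Inst D O)} (hF : IsDecisionProblem ν R Rmax F) {f : Inst D O} (hf : f ∈ F)
    (θ : ℝ) (π π' : D) (H : List (D × O)) :
    ∫⁻ o, expPotential ν R Rmax f θ π (H ++ [(π', o)]) ∂(law ν f π') ≤
      expPotential ν R Rmax f θ π H := by
  have := hF.isProbabilityMeasure hf π'
  have hR := hF.measurable_reward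
  by_cases h : π' = π
  · subst h
    have heq : ∀ o, expPotential ν R Rmax f θ π' (H ++ [(π', o)]) =
        expPotential ν R Rmax f θ π' H *
        ENNReal.ofReal (Real.exp (θ * (R o - meanReward ν R f π') - θ ^ 2 * Rmax ^ 2 / 8)) := by
      intro o
      unfold expPotential
      rw [rewards_append_self, plays_append_self, ← ENNReal.ofReal_mul (by positivity),
        ← Real.exp_add]
      congr 2
      push_cast; ring
    simp_rw [heq]
    rw [lintegral_const_mul _ (by fun_prop)]
    exact mul_le_of_le_one_right' (lintegral_exp_reward_le hF hf π' θ)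
  · unfold expPotential
    simp only [rewards_append_of_ne R H h, plays_append_of_ne H h]
    simp

/-- A supermartingale that is at least one when a confidence interval of UCB fails. -/
def failPotential (ν : Measure O) (R : O → ℝ) (Rmax : ℝ) (f : Inst D O) (n : ℕ)
    (H : List (D × O)) : ℝ≥0∞ :=
  ∑ π, ∑ s ∈ Finset.Icc 1 n, ((n : ℝ≥0∞) ^ 8)⁻¹ *
    (expPotential ν R Rmax f (4 * radius Rmax n s / Rmax ^ 2) π H +
      expPotential ν R Rmax f (-(4 * radius Rmax n s / Rmax ^ 2)) π H)

theorem lintegral_failPotential_append_le {ν : Measure O} {R : O → ℝ} {Rmax : ℝ}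
    {F : Set (Inst D O)} (hF : IsDecisionProblem ν R Rmax F) {f : Inst D O} (hf : f ∈ F)
    (n : ℕ) (π' : D) (H : List (D × O)) :
    ∫⁻ o, failPotential ν R Rmax f n (H ++ [(π', o)]) ∂(law ν f π') ≤
      failPotential ν R Rmax f n H := by
  have hm := fun θ π => measurable_expPotential_append (ν := ν) hF.measurable_reward Rmax f θ π π' H
  unfold failPotential
  rw [lintegral_finsetSum _ fun π _ => by fun_prop]
  refine Finset.sum_le_sum fun π _ => ?_
  rw [lintegral_finsetSum _ fun s _ => by fun_prop]
  refine Finset.sum_le_sum fun s _ => ?_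
  rw [lintegral_const_mul _ (by fun_prop), lintegral_add_left (hm _ _)]
  gcongr <;> exact lintegral_expPotential_append_le hF hf _ _ _ _

theorem measurable_failPotential_append {ν : Measure O} {R : O → ℝ} (hR : Measurable R) (Rmax : ℝ)
    (f : Inst D O) (n : ℕ) (π' : D) (H : List (D × O)) :
    Measurable fun o => failPotential ν R Rmax f n (H ++ [(π', o)]) := by
  have hm := fun θ π => measurable_expPotential_append (ν := ν) hR Rmax f θ π π' H
  unfold failPotential
  fun_prop

/-- Every exponential starts at one, so the potential starts at `2 K n · n⁻⁸`. The extra factor `n`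
pays for charging it once in each round. -/
theorem failPotential_nil_le (ν : Measure O) (R : O → ℝ) (Rmax : ℝ) (f : Inst D O) {n : ℕ}
    (hn : 1 ≤ n) :
    n * failPotential ν R Rmax f n [] ≤ 2 * Fintype.card D := by
  have hexp : ∀ θ π, expPotential ν R Rmax f θ π [] = 1 := by
    intro θ π
    simp [expPotential, rewards, plays]
  have hn0 : (n : ℝ≥0∞) ≠ 0 := by simp; omega
  have hnt : (n : ℝ≥0∞) ≠ ⊤ := by simp
  have hn1 : (1 : ℝ≥0∞) ≤ n := by exact_mod_cast hn
  unfold failPotential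
  simp only [hexp, Finset.sum_const, Nat.card_Icc, Finset.card_univ, nsmul_eq_mul,
    Nat.add_sub_cancel]
  have key : (n : ℝ≥0∞) * (n * ((n : ℝ≥0∞) ^ 8)⁻¹) ≤ 1 := by
    calc (n : ℝ≥0∞) * (n * ((n : ℝ≥0∞) ^ 8)⁻¹) = n ^ 2 * ((n : ℝ≥0∞) ^ 8)⁻¹ := by ring
      _ ≤ n ^ 8 * ((n : ℝ≥0∞) ^ 8)⁻¹ := by gcongr; norm_num
      _ = 1 := ENNReal.mul_inv_cancel (by positivity) (by finiteness)
  calc _ = ((n : ℝ≥0∞) * (n * ((n : ℝ≥0∞) ^ 8)⁻¹)) * (2 * Fintype.card D) := by ring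
    _ ≤ 1 * (2 * Fintype.card D) := by gcongr
    _ = _ := one_mul _

theorem sq_radius_eq {n s : ℕ} (hs : 1 ≤ s) (Rmax : ℝ) :
    s * radius Rmax n s ^ 2 = 4 * Rmax ^ 2 * Real.log n := by
  have hL : 0 ≤ Real.log n := Real.log_natCast_nonneg n
  have hs' : (0 : ℝ) < s := by exact_mod_cast hs
  unfold radius
  rw [mul_pow, Real.sq_sqrt (by rw [Real.log_pow]; positivity), Real.log_pow]
  push_cast
  field_simp
  ring

/-- If the empirical mean of `π` leaves the confidence interval, the failure potential is at least
one. -/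
theorem one_le_failPotential {ν : Measure O} {R : O → ℝ} {Rmax : ℝ} (hRmax : 0 < Rmax)
    (f : Inst D O) {n : ℕ} (hn : 1 ≤ n) (H : List (D × O)) (hH : H.length ≤ n) (π : D)
    (hπ : plays H π ≠ 0)
    (hfail : radius Rmax n (plays H π) ≤
      |rewards R H π / plays H π - meanReward ν R f π|) :
    1 ≤ failPotential ν R Rmax f n H := by
  set s := plays H π with hs
  have hs1 : 1 ≤ s := Nat.one_le_iff_ne_zero.2 hπ
  have hs' : (0 : ℝ) < s := by exact_mod_cast hs1
  have hsn : s ≤ n := (plays_le_length H π).trans hH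
  have hn' : (0 : ℝ) < n := by exact_mod_cast hn
  have hr0 : 0 ≤ radius Rmax n s := by unfold radius; positivity
  -- This `θ` maximizes `θ s r - s θ² Rmax² / 8` for `r` the radius. Since `s r² = 4 Rmax² ln n`,
  -- the two terms are `16 ln n` and `8 ln n`; the difference cancels the weight `n⁻⁸`.
  set θ := 4 * radius Rmax n s / Rmax ^ 2 with hθ
  have hθ0 : 0 ≤ θ := by positivity
  have hsq := sq_radius_eq (n := n) hs1 Rmax
  have hkey : ∀ x : ℝ, s * radius Rmax n s * θ ≤ x →
      (n : ℝ≥0∞) ^ 8 ≤ ENNReal.ofReal (Real.exp (x - s * (θ ^ 2 * Rmax ^ 2 / 8))) := by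
    intro x hx
    have h8 : 8 * Real.log n ≤ x - s * (θ ^ 2 * Rmax ^ 2 / 8) := by
      have h1 : s * radius Rmax n s * θ = 16 * Real.log n := by
        rw [hθ]
        calc s * radius Rmax n s * (4 * radius Rmax n s / Rmax ^ 2)
            = 4 * (s * radius Rmax n s ^ 2) / Rmax ^ 2 := by ring
          _ = _ := by rw [hsq]; field_simp; ring
      have h2 : s * (θ ^ 2 * Rmax ^ 2 / 8) = 8 * Real.log n := by
        rw [hθ]
        calc s * ((4 * radius Rmax n s / Rmax ^ 2) ^ 2 * Rmax ^ 2 / 8)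
            = 2 * (s * radius Rmax n s ^ 2) / Rmax ^ 2 := by field_simp; ring
          _ = _ := by rw [hsq]; field_simp; ring
      linarith
    calc (n : ℝ≥0∞) ^ 8 = ENNReal.ofReal (Real.exp (8 * Real.log n)) := by
          have : Real.exp (8 * Real.log n) = (n : ℝ) ^ 8 := by
            rw [show (8 : ℝ) * Real.log n = Real.log ((n : ℝ) ^ 8) by rw [Real.log_pow]; norm_num,
              Real.exp_log (by positivity)]
          rw [this, ENNReal.ofReal_pow hn'.le, ENNReal.ofReal_natCast]
      _ ≤ _ := ENNReal.ofReal_le_ofReal (Real.exp_le_exp.2 h8)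
  have hn8 : ((n : ℝ≥0∞) ^ 8)⁻¹ * (n : ℝ≥0∞) ^ 8 = 1 :=
    ENNReal.inv_mul_cancel (by simp; omega) (by finiteness)
  have hbig : (n : ℝ≥0∞) ^ 8 ≤ expPotential ν R Rmax f θ π H +
      expPotential ν R Rmax f (-θ) π H := by
    have hdiv : rewards R H π - s * meanReward ν R f π =
        s * (rewards R H π / s - meanReward ν R f π) := by field_simp
    rcases le_abs.1 hfail with h | h
    · refine le_trans (hkey _ ?_) le_self_add
      rw [← hs, hdiv]
      nlinarith [mul_le_mul_of_nonneg_left h (mul_nonneg hs'.le hθ0)]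
    · refine le_trans ?_ le_add_self
      have := hkey (-θ * (rewards R H π - s * meanReward ν R f π)) (by
        rw [hdiv]
        nlinarith [mul_le_mul_of_nonneg_left h (mul_nonneg hs'.le hθ0)])
      unfold expPotential
      rw [← hs, neg_sq]
      exact this
  calc (1 : ℝ≥0∞) = ((n : ℝ≥0∞) ^ 8)⁻¹ * (n : ℝ≥0∞) ^ 8 := hn8.symm
    _ ≤ ((n : ℝ≥0∞) ^ 8)⁻¹ * (expPotential ν R Rmax f θ π H +
      expPotential ν R Rmax f (-θ) π H) := by gcongr
    -- Only the summand of the actual play count is needed; summing over all possible counts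
    -- replaces a stopping-time argument.
    _ ≤ ∑ s ∈ Finset.Icc 1 n, ((n : ℝ≥0∞) ^ 8)⁻¹ *
    (expPotential ν R Rmax f (4 * radius Rmax n s / Rmax ^ 2) π H +
      expPotential ν R Rmax f (-(4 * radius Rmax n s / Rmax ^ 2)) π H) :=
        Finset.single_le_sum (f := fun s : ℕ => ((n : ℝ≥0∞) ^ 8)⁻¹ *
    (expPotential ν R Rmax f (4 * radius Rmax n s / Rmax ^ 2) π H +
      expPotential ν R Rmax f (-(4 * radius Rmax n s / Rmax ^ 2)) π H))
          (fun _ _ => zero_le) (Finset.mem_Icc.2 ⟨hs1, hsn⟩)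
    _ ≤ _ := Finset.single_le_sum (f := fun π => ∑ s ∈ Finset.Icc 1 n, ((n : ℝ≥0∞) ^ 8)⁻¹ *
    (expPotential ν R Rmax f (4 * radius Rmax n s / Rmax ^ 2) π H +
      expPotential ν R Rmax f (-(4 * radius Rmax n s / Rmax ^ 2)) π H))
          (fun _ _ => zero_le) (Finset.mem_univ π)

/-- As long as the confidence intervals hold, a suboptimal decision chosen by UCB has been played
rarely. -/
theorem plays_ucb_le {ν : Measure O} {R : O → ℝ} {Rmax : ℝ} (hRmax : 0 < Rmax)
    (f : Inst D O) {n : ℕ} (hn : 1 ≤ n) {ucb : List (D × O) → D} (hucb : IsUCB R Rmax n ucb)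
    (H : List (D × O)) (hH : H.length ≤ n) (hgood : failPotential ν R Rmax f n H < 1)
    (hgap : 0 < gap ν R f (ucb H)) :
    (plays H (ucb H) : ℝ) ≤ 16 * Rmax ^ 2 * Real.log n / gap ν R f (ucb H) ^ 2 := by
  set π := ucb H with hπ
  have hL : 0 ≤ Real.log n := Real.log_natCast_nonneg n
  by_cases h0 : plays H π = 0
  · rw [h0]; simp; positivity
  have hmax := hucb.maximal H (best ν R f)
  rw [← hπ, ucbIndex_of_plays_ne_zero R Rmax n H π h0] at hmax
  by_cases hb0 : plays H (best ν R f) = 0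
  · rw [ucbIndex_of_plays_eq_zero R Rmax n H _ hb0] at hmax
    exact absurd (top_le_iff.1 hmax) (EReal.coe_ne_top _)
  rw [ucbIndex_of_plays_ne_zero R Rmax n H _ hb0, EReal.coe_le_coe_iff] at hmax
  have hin : ∀ π', plays H π' ≠ 0 →
      |rewards R H π' / plays H π' - meanReward ν R f π'| < radius Rmax n (plays H π') := by
    intro π' h'
    by_contra hcon
    exact absurd hgood (not_lt.2 (one_le_failPotential hRmax f hn H hH π' h' (not_lt.1 hcon)))
  have h1 := abs_lt.1 (hin π h0)
  have h2 := abs_lt.1 (hin _ hb0)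
  have hle : gap ν R f π ≤ 2 * radius Rmax n (plays H π) := by
    unfold gap; linarith [h1.2, h2.1]
  have hsq := sq_radius_eq (n := n) (Nat.one_le_iff_ne_zero.2 h0) Rmax
  rw [le_div_iff₀ (by positivity)]
  calc (plays H π : ℝ) * gap ν R f π ^ 2
      ≤ plays H π * (2 * radius Rmax n (plays H π)) ^ 2 := by gcongr
    _ = 4 * (plays H π * radius Rmax n (plays H π) ^ 2) := by ring
    _ = _ := by rw [hsq]; ring

/-- The leading constant of the regret of UCB. -/
def ucbConst (ν : Measure O) (R : O → ℝ) (Rmax : ℝ) (f : Inst D O) : ℝ :=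
  ∑ π, 16 * Rmax ^ 2 / gap ν R f π

/-- Each round is charged in one of two ways. While the potential is below one, a suboptimal choice
raises a play count that is still below its ceiling, so the truncated count grows. Otherwise the
potential is at least one and `Rmax` times it covers the round. -/
theorem pathRegret_ucb_le {ν : Measure O} {R : O → ℝ} {Rmax : ℝ} (hRmax : 0 < Rmax)
    {F : Set (Inst D O)} (hF : IsDecisionProblem ν R Rmax F) {f : Inst D O} (hf : f ∈ F)
    {n : ℕ} (hn : 1 ≤ n) {ucb : List (D × O) → D} (hucb : IsUCB R Rmax n ucb)
    (z : List O) (hz : z.length ≤ n) :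
    pathRegret ν R f (fun z => ucb (ucbHistory ucb z)) z ≤
      (∑ π, ENNReal.ofReal (gap ν R f π *
        min (plays (ucbHistory ucb z) π : ℝ)
          (16 * Rmax ^ 2 * Real.log n / gap ν R f π ^ 2 + 1))) +
      ENNReal.ofReal Rmax * ∑ t ∈ Finset.range z.length,
        failPotential ν R Rmax f n (ucbHistory ucb (z.take t)) := by
  classical
  induction z using List.reverseRecOn with
  | nil => simp [pathRegret]
  | append_singleton z o ih =>
    have hzn : z.length < n := by simpa using hz
    specialize ih hzn.le
    have hL : 0 ≤ Real.log n := Real.log_natCast_nonneg n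
    set A : List O → D := fun z => ucb (ucbHistory ucb z) with hA
    set H := ucbHistory ucb z with hH
    set c : D → ℝ := fun π => 16 * Rmax ^ 2 * Real.log n / gap ν R f π ^ 2 with hc
    have hc0 : ∀ π, 0 ≤ c π := fun π => by positivity
    have hHlen : H.length ≤ n := by rw [length_ucbHistory]; exact hzn.le
    have hpath : pathRegret ν R f A (z ++ [o]) =
        pathRegret ν R f A z + ENNReal.ofReal (gap ν R f (ucb H)) := by
      rw [pathRegret_append]
      simp [pathRegret, hA, hH]
    have hsum : ∑ t ∈ Finset.range (z ++ [o]).length,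
        failPotential ν R Rmax f n (ucbHistory ucb ((z ++ [o]).take t)) =
        (∑ t ∈ Finset.range z.length,
          failPotential ν R Rmax f n (ucbHistory ucb (z.take t))) +
          failPotential ν R Rmax f n H := by
      rw [List.length_append, List.length_singleton, Finset.sum_range_succ]
      congr 1
      · refine Finset.sum_congr rfl fun t ht => ?_
        rw [List.take_append_of_le_length (Finset.mem_range.1 ht).le]
      · simp [hH]
    rw [hpath, hsum, ucbHistory_append, ← hH]
    have hpl : ∀ π, (plays H π : ℝ) ≤ plays (H ++ [(ucb H, o)]) π := by
      intro π
      by_cases h : ucb H = π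
      · rw [← h, plays_append_self]; push_cast; linarith
      · rw [plays_append_of_ne H h]
    by_cases hgood : failPotential ν R Rmax f n H < 1
    · have hstep : (∑ π, ENNReal.ofReal (gap ν R f π * min (plays H π : ℝ) (c π + 1))) +
          ENNReal.ofReal (gap ν R f (ucb H)) ≤
          ∑ π, ENNReal.ofReal (gap ν R f π *
            min (plays (H ++ [(ucb H, o)]) π : ℝ) (c π + 1)) := by
        rw [← Finset.add_sum_erase _ _ (Finset.mem_univ (ucb H)),
          ← Finset.add_sum_erase (s := Finset.univ) (fun π => ENNReal.ofReal (gap ν R f π *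
            min (plays (H ++ [(ucb H, o)]) π : ℝ) (c π + 1))) (Finset.mem_univ (ucb H)),
          add_right_comm]
        refine add_le_add ?_ (Finset.sum_le_sum fun π hπ => ?_)
        · rw [← ENNReal.ofReal_add (mul_nonneg (gap_nonneg _ _ _ _)
            (le_min (by positivity) (by linarith [hc0 (ucb H)]))) (gap_nonneg _ _ _ _)]
          refine ENNReal.ofReal_le_ofReal ?_
          rcases (gap_nonneg ν R f (ucb H)).eq_or_lt with h0 | h0
          · rw [← h0]; simp
          · have hle : (plays H (ucb H) : ℝ) ≤ c (ucb H) :=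
              plays_ucb_le hRmax f hn hucb H hHlen hgood h0
            rw [plays_append_self, min_eq_left (by linarith), min_eq_left (by push_cast; linarith)]
            push_cast
            linarith
        · rw [plays_append_of_ne H (Finset.ne_of_mem_erase hπ).symm]
      calc _ ≤ ((∑ π, ENNReal.ofReal (gap ν R f π * min (plays H π : ℝ) (c π + 1))) +
            ENNReal.ofReal Rmax * ∑ t ∈ Finset.range z.length,
              failPotential ν R Rmax f n (ucbHistory ucb (z.take t))) +
            ENNReal.ofReal (gap ν R f (ucb H)) := by gcongr
        _ = ((∑ π, ENNReal.ofReal (gap ν R f π * min (plays H π : ℝ) (c π + 1))) +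
            ENNReal.ofReal (gap ν R f (ucb H))) +
            ENNReal.ofReal Rmax * ∑ t ∈ Finset.range z.length,
              failPotential ν R Rmax f n (ucbHistory ucb (z.take t)) := by ring
        _ ≤ _ := by
          refine add_le_add hstep ?_
          gcongr
          exact le_self_add
    · have h1 : 1 ≤ failPotential ν R Rmax f n H := not_lt.1 hgood
      calc _ ≤ ((∑ π, ENNReal.ofReal (gap ν R f π * min (plays H π : ℝ) (c π + 1))) +
            ENNReal.ofReal Rmax * ∑ t ∈ Finset.range z.length,
              failPotential ν R Rmax f n (ucbHistory ucb (z.take t))) +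
            ENNReal.ofReal Rmax * failPotential ν R Rmax f n H := by
              refine add_le_add ih ?_
              calc ENNReal.ofReal (gap ν R f (ucb H)) ≤ ENNReal.ofReal Rmax * 1 := by
                    rw [mul_one]; exact ENNReal.ofReal_le_ofReal (hF.gap_le hf _)
                _ ≤ _ := by gcongr
        _ = (∑ π, ENNReal.ofReal (gap ν R f π * min (plays H π : ℝ) (c π + 1))) +
            ENNReal.ofReal Rmax * (∑ t ∈ Finset.range z.length,
              failPotential ν R Rmax f n (ucbHistory ucb (z.take t)) +
              failPotential ν R Rmax f n H) := by ring
        _ ≤ _ := by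
          gcongr with π _
          · exact gap_nonneg _ _ _ _
          · exact_mod_cast hpl π

/-- The expected regret of UCB is logarithmic. -/
theorem value_ucb_le {ν : Measure O} {R : O → ℝ} {Rmax : ℝ}
    {F : Set (Inst D O)} (hF : IsDecisionProblem ν R Rmax F) {f : Inst D O} (hf : f ∈ F)
    {n : ℕ} (hn : 1 ≤ n) {ucb : List (D × O) → D} (hucb : IsUCB R Rmax n ucb)
    (alg : List O → D) (h : List O) (halg : ∀ z, alg (h ++ z) = ucb (ucbHistory ucb z))
    (r : ℕ) (hr : r ≤ n) (φ : List O → ℝ≥0∞)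
    (hφ : ∀ z : List O, z.length = r →
      φ (h ++ z) ≤ pathRegret ν R f (fun z => alg (h ++ z)) z) :
    value ν f alg r φ h ≤
      ENNReal.ofReal (ucbConst ν R Rmax f * Real.log n + 3 * Fintype.card D * Rmax) := by
  have hL : 0 ≤ Real.log n := Real.log_natCast_nonneg n
  have halg' : (fun z => alg (h ++ z)) = fun z => ucb (ucbHistory ucb z) := funext halg
  -- The exponents divide by `Rmax²`; for `Rmax = 0` all gaps vanish and no potential is needed.
  rcases (hF.Rmax_nonneg hf).eq_or_lt with h0 | hRmax
  · refine (value_le_of_supermartingale ν f alg r φ (fun _ => 0) h (fun z _ => by simp)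
      fun z hz => ?_).trans zero_le
    refine (hφ z hz).trans ((pathRegret_le hF hf _ z).trans ?_)
    simp [← h0]
  set a : ℝ≥0∞ := ∑ π, ENNReal.ofReal (gap ν R f π *
    (16 * Rmax ^ 2 * Real.log n / gap ν R f π ^ 2 + 1)) with ha
  -- In the supermartingale below, the potentials of past rounds are summed and those of the
  -- remaining rounds are represented by the current value, which dominates their conditional means.
  set B := fun z => failPotential ν R Rmax f n (ucbHistory ucb z) with hB
  have hW := value_le_of_supermartingale ν f alg r φ
    (fun z => a + ENNReal.ofReal Rmax * (∑ t ∈ Finset.range z.length, B (z.take t) +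
      ((r - z.length : ℕ) : ℝ≥0∞) * B z)) h ?_ ?_
  · refine hW.trans ?_
    have hBn : (r : ℝ≥0∞) * B [] ≤ 2 * Fintype.card D := by
      refine le_trans ?_ (failPotential_nil_le ν R Rmax f hn)
      have : (r : ℝ≥0∞) ≤ n := by exact_mod_cast hr
      gcongr
      exact le_rfl
    have ha' : a ≤ ENNReal.ofReal (ucbConst ν R Rmax f * Real.log n + Fintype.card D * Rmax) := by
      rw [ha, ← ENNReal.ofReal_sum_of_nonneg fun π _ =>
        mul_nonneg (gap_nonneg _ _ _ _) (by positivity)]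
      refine ENNReal.ofReal_le_ofReal ?_
      calc _ ≤ ∑ π, (16 * Rmax ^ 2 / gap ν R f π * Real.log n + Rmax) := by
            refine Finset.sum_le_sum fun π _ => ?_
            have hg := hF.gap_le hf π
            -- For a zero gap, division by zero makes the summand of `ucbConst` vanish, in agreement
            -- with a cost of zero.
            rcases (gap_nonneg ν R f π).eq_or_lt with h0 | h0
            · rw [← h0]; simp; exact hRmax.le
            · rw [mul_add]
              refine add_le_add (le_of_eq ?_) (by linarith)
              field_simp
        _ = _ := by
          rw [Finset.sum_add_distrib, ← Finset.sum_mul]; simp [ucbConst]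
    have hu0 : 0 ≤ ucbConst ν R Rmax f :=
      Finset.sum_nonneg fun π _ => div_nonneg (by positivity) (gap_nonneg _ _ _ _)
    calc _ ≤ ENNReal.ofReal (ucbConst ν R Rmax f * Real.log n + Fintype.card D * Rmax) +
          ENNReal.ofReal Rmax * (2 * Fintype.card D) := by
            simp only [List.length_nil, Finset.range_zero, Finset.sum_empty, zero_add, Nat.sub_zero]
            gcongr
      _ = ENNReal.ofReal (ucbConst ν R Rmax f * Real.log n + Fintype.card D * Rmax) +
          ENNReal.ofReal (Rmax * (2 * Fintype.card D)) := by
            rw [ENNReal.ofReal_mul hRmax.le, ENNReal.ofReal_mul (by norm_num)]; simp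
      _ = _ := by
        rw [← ENNReal.ofReal_add (by positivity) (by positivity)]
        congr 1; ring
  · intro z hz
    rw [halg z]
    have hm := measurable_failPotential_append (ν := ν) hF.measurable_reward Rmax f n
      (ucb (ucbHistory ucb z)) (ucbHistory ucb z)
    have := hF.isProbabilityMeasure hf (ucb (ucbHistory ucb z))
    have hsum : ∀ o, ∑ t ∈ Finset.range (z ++ [o]).length, B ((z ++ [o]).take t) =
        ∑ t ∈ Finset.range z.length, B (z.take t) + B z := by
      intro o
      rw [List.length_append, List.length_singleton, Finset.sum_range_succ]
      congr 1
      · refine Finset.sum_congr rfl fun t ht => ?_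
        rw [List.take_append_of_le_length (Finset.mem_range.1 ht).le]
      · simp
    obtain ⟨k, hk⟩ : ∃ k, r - z.length = k + 1 := ⟨r - z.length - 1, by omega⟩
    have hk' : ∀ o : O, r - (z ++ [o]).length = k := by
      intro o; rw [List.length_append, List.length_singleton]; omega
    have hBo : ∀ o, B (z ++ [o]) = failPotential ν R Rmax f n
        (ucbHistory ucb z ++ [(ucb (ucbHistory ucb z), o)]) := by
      intro o; simp only [hB, ucbHistory_append]
    simp only [hsum, hk', hk, hBo]
    rw [lintegral_add_left measurable_const, lintegral_const_mul _ (by fun_prop),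
      lintegral_add_left measurable_const, lintegral_const_mul _ hm]
    simp only [lintegral_const, measure_univ, mul_one]
    have := lintegral_failPotential_append_le hF hf n (ucb (ucbHistory ucb z)) (ucbHistory ucb z)
    calc _ ≤ a + ENNReal.ofReal Rmax * (∑ t ∈ Finset.range z.length, B (z.take t) + B z +
          k * B z) := by gcongr
      _ = _ := by push_cast; ring
  · intro z hz
    refine (hφ z hz).trans ?_
    rw [halg']
    refine (pathRegret_ucb_le hRmax hF hf hn hucb z (hz.le.trans hr)).trans ?_
    refine add_le_add (Finset.sum_le_sum fun π _ => ENNReal.ofReal_le_ofReal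
      (mul_le_mul_of_nonneg_left (min_le_right _ _) (gap_nonneg _ _ _ _))) ?_
    gcongr
    exact le_self_add

/-! ### KL divergences of densities -/

theorem withDensity_absolutelyContinuous_iff {ν : Measure O} {p q : O → ℝ≥0}
    (hp : Measurable p) (hq : Measurable q) :
    (ν.withDensity fun o => (p o : ℝ≥0∞)) ≪ (ν.withDensity fun o => (q o : ℝ≥0∞)) ↔
      ∀ᵐ o ∂ν, q o = 0 → p o = 0 := by
  have hp' : Measurable fun o => (p o : ℝ≥0∞) := hp.coe_nnreal_ennreal
  have hq' : Measurable fun o => (q o : ℝ≥0∞) := hq.coe_nnreal_ennreal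
  constructor
  · intro h
    have h0 : (ν.withDensity fun o => (q o : ℝ≥0∞)) {o | q o = 0} = 0 := by
      rw [withDensity_apply_eq_zero hq']
      convert measure_empty (μ := ν)
      ext o; simp
    have h1 := h h0
    rw [withDensity_apply_eq_zero hp'] at h1
    rw [ae_iff]
    refine measure_mono_null (fun o ho => ?_) h1
    simp only [Set.mem_ofPred_eq, Classical.not_imp] at ho
    exact ⟨by simpa using ho.2, ho.1⟩
  · intro h s hs
    rw [withDensity_apply_eq_zero hq'] at hs
    rw [withDensity_apply_eq_zero hp']
    have h' : ν {o | ¬ (q o = 0 → p o = 0)} = 0 := h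
    refine measure_mono_null (fun o ho => ?_) (measure_union_null hs h')
    by_cases hq0 : q o = 0
    · right
      simp only [Set.mem_ofPred_eq, Classical.not_imp]
      exact ⟨hq0, by simpa using ho.1⟩
    · left
      exact ⟨by simpa using hq0, ho.2⟩

/-- The Radon–Nikodym derivative is `p / q`. The result is an integral of a nonnegative function
against the common base measure, so divergences of different instances can be compared pointwise. -/
theorem klDiv_withDensity {ν : Measure O} {p q : O → ℝ≥0}
    (hp : Measurable p) (hq : Measurable q)
    (hp1 : ∫⁻ o, (p o : ℝ≥0∞) ∂ν = 1) (hq1 : ∫⁻ o, (q o : ℝ≥0∞) ∂ν = 1)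
    (hac : ∀ᵐ o ∂ν, q o = 0 → p o = 0) :
    klDiv (ν.withDensity fun o => (p o : ℝ≥0∞)) (ν.withDensity fun o => (q o : ℝ≥0∞)) =
      ∫⁻ o, ENNReal.ofReal (q o * klFun (p o / q o)) ∂ν := by
  have hp' : Measurable fun o => (p o : ℝ≥0∞) := hp.coe_nnreal_ennreal
  have hq' : Measurable fun o => (q o : ℝ≥0∞) := hq.coe_nnreal_ennreal
  have : IsProbabilityMeasure (ν.withDensity fun o => (p o : ℝ≥0∞)) := ⟨by simp [hp1]⟩
  have : IsProbabilityMeasure (ν.withDensity fun o => (q o : ℝ≥0∞)) := ⟨by simp [hq1]⟩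
  have hr : Measurable fun o => (p o : ℝ≥0∞) / q o := hp'.div hq'
  have heq : (ν.withDensity fun o => (p o : ℝ≥0∞)) =
      (ν.withDensity fun o => (q o : ℝ≥0∞)).withDensity fun o => (p o : ℝ≥0∞) / q o := by
    rw [← withDensity_mul _ hq' hr]
    refine withDensity_congr_ae ?_
    filter_upwards [hac] with o ho
    simp only [Pi.mul_apply]
    by_cases h0 : q o = 0
    · simp [h0, ho h0]
    · rw [ENNReal.mul_div_cancel (by simpa using h0) (by simp)]
  rw [klDiv_eq_lintegral_klFun_of_ac ((withDensity_absolutelyContinuous_iff hp hq).2 hac)]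
  have hrn : (ν.withDensity fun o => (p o : ℝ≥0∞)).rnDeriv
      (ν.withDensity fun o => (q o : ℝ≥0∞)) =ᵐ[ν.withDensity fun o => (q o : ℝ≥0∞)]
      fun o => (p o : ℝ≥0∞) / q o := by
    conv_lhs => rw [heq]
    exact Measure.rnDeriv_withDensity _ hr
  rw [lintegral_congr_ae (g := fun o => ENNReal.ofReal (klFun ((p o : ℝ≥0∞) / q o).toReal))
    (hrn.mono fun o ho => by simp only [ho])]
  have hkm : Measurable fun o => ENNReal.ofReal (klFun ((p o : ℝ≥0∞) / q o).toReal) :=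
    (continuous_klFun.measurable.comp hr.ennreal_toReal).ennreal_ofReal
  rw [lintegral_withDensity_eq_lintegral_mul _ hq' hkm]
  refine lintegral_congr fun o => ?_
  simp only [Pi.mul_apply, ENNReal.toReal_div, ENNReal.coe_toReal]
  rw [ENNReal.ofReal_mul (q o).coe_nonneg, ENNReal.ofReal_coe_nnreal]

theorem measurable_ofReal_mul_klFun {p q : O → ℝ≥0} (hp : Measurable p) (hq : Measurable q) :
    Measurable fun o => ENNReal.ofReal (q o * klFun (p o / q o)) := by
  have h1 : Measurable fun o => (p o : ℝ) := hp.coe_nnreal_real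
  have h2 : Measurable fun o => (q o : ℝ) := hq.coe_nnreal_real
  exact (h2.mul (continuous_klFun.measurable.comp (h1.div h2))).ennreal_ofReal

/-- The KL integrand under a relative perturbation of the first density. -/
theorem mul_klFun_perturb_le {p₀ p q η : ℝ} (hp₀ : 0 ≤ p₀) (hp : 0 ≤ p) (hq : 0 ≤ q)
    (hη : 0 ≤ η) (hη1 : η < 1) (h : |p - p₀| ≤ η * p₀) :
    q * klFun (p / q) ≤ (1 + η) * (q * klFun (p₀ / q)) + 2 * η * (p₀ + q) := by
  have hk0 : 0 ≤ klFun (p₀ / q) := klFun_nonneg (by positivity)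
  rcases hq.eq_or_lt with rfl | hq
  · simp; positivity
  rcases hp₀.eq_or_lt with rfl | hp₀
  · have : p = 0 := by simpa using h
    subst this
    simp only [zero_div, klFun_zero]
    nlinarith
  obtain ⟨hl, hu⟩ := abs_le.1 h
  obtain ⟨r, rfl⟩ : ∃ r, p = r * p₀ := ⟨p / p₀, by field_simp⟩
  have hr1 : 1 - η ≤ r := by
    by_contra hcon; push Not at hcon; nlinarith
  have hr2 : r ≤ 1 + η := by
    by_contra hcon; push Not at hcon; nlinarith
  have hr0 : 0 < r := by linarith
  -- The identity isolates the effect of the ratio `r = p / p₀`, which lies in `[1 - η, 1 + η]`.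
  -- Each correction then has size `η` times `p₀` or `q`.
  have hid : q * klFun (r * p₀ / q) =
      r * (q * klFun (p₀ / q)) + p₀ * (r * Real.log r) + q * (1 - r) := by
    simp only [klFun_apply]
    rw [mul_div_assoc, Real.log_mul hr0.ne' (by positivity)]
    field_simp
    ring
  have hlog : Real.log r ≤ r - 1 := Real.log_le_sub_one_of_pos hr0
  have h1 : r * Real.log r ≤ 2 * η := by
    rcases le_total 1 r with h1 | h1
    · calc r * Real.log r ≤ r * (r - 1) := by gcongr
        _ ≤ 2 * η := by nlinarith
    · have : Real.log r ≤ 0 := Real.log_nonpos hr0.le h1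
      nlinarith
  rw [hid]
  have hqk : 0 ≤ q * klFun (p₀ / q) := by positivity
  nlinarith [mul_le_mul_of_nonneg_left h1 hp₀.le, mul_le_mul_of_nonneg_right hr2 hqk,
    mul_nonneg hq.le hη]

theorem le_mul_klFun_perturb {p₀ p q η : ℝ} (hp₀ : 0 ≤ p₀) (hp : 0 ≤ p) (hq : 0 ≤ q)
    (hη : 0 ≤ η) (hη1 : η < 1) (h : |p - p₀| ≤ η * p₀) :
    (1 - η) * (q * klFun (p₀ / q)) ≤ q * klFun (p / q) + η * (p₀ + q) := by
  have hk0 : 0 ≤ klFun (p₀ / q) := klFun_nonneg (by positivity)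
  rcases hq.eq_or_lt with rfl | hq
  · simp; positivity
  rcases hp₀.eq_or_lt with rfl | hp₀
  · have : p = 0 := by simpa using h
    subst this
    simp only [zero_div, klFun_zero]
    nlinarith
  obtain ⟨hl, hu⟩ := abs_le.1 h
  obtain ⟨r, rfl⟩ : ∃ r, p = r * p₀ := ⟨p / p₀, by field_simp⟩
  have hr1 : 1 - η ≤ r := by
    by_contra hcon; push Not at hcon; nlinarith
  have hr2 : r ≤ 1 + η := by
    by_contra hcon; push Not at hcon; nlinarith
  have hr0 : 0 < r := by linarith
  have hid : q * klFun (r * p₀ / q) =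
      r * (q * klFun (p₀ / q)) + p₀ * (r * Real.log r) + q * (1 - r) := by
    simp only [klFun_apply]
    rw [mul_div_assoc, Real.log_mul hr0.ne' (by positivity)]
    field_simp
    ring
  have h1 : r - 1 ≤ r * Real.log r := by
    have := klFun_nonneg hr0.le
    rw [klFun_apply] at this
    linarith
  rw [hid]
  have hqk : 0 ≤ q * klFun (p₀ / q) := by positivity
  nlinarith [mul_le_mul_of_nonneg_left h1 hp₀.le, mul_le_mul_of_nonneg_right hr1 hqk,
    mul_le_mul_of_nonneg_left hr2 hq.le, mul_le_mul_of_nonneg_left hr1 hp₀.le]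

/-- `f` is a relative perturbation of `f₀` of size `η`. -/
def RelClose (ν : Measure O) (f₀ f : Inst D O) (η : ℝ) : Prop :=
  ∀ π, ∀ᵐ o ∂ν, |(f π o : ℝ) - f₀ π o| ≤ η * f₀ π o

theorem RelClose.eq_zero_iff {ν : Measure O} {f₀ f : Inst D O} {η : ℝ} (hη1 : η < 1)
    (h : RelClose ν f₀ f η) (π : D) : ∀ᵐ o ∂ν, f π o = 0 ↔ f₀ π o = 0 := by
  filter_upwards [h π] with o ho
  have h0 : (0 : ℝ) ≤ f₀ π o := (f₀ π o).coe_nonneg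
  constructor
  · intro hf
    rw [hf] at ho
    simp only [NNReal.coe_zero, zero_sub, abs_neg, abs_of_nonneg h0] at ho
    have : (f₀ π o : ℝ) = 0 := by nlinarith
    exact_mod_cast this
  · intro hf
    rw [hf] at ho
    simp only [NNReal.coe_zero, sub_zero, mul_zero] at ho
    exact_mod_cast abs_nonpos_iff.1 ho

theorem kl_of_ac {ν : Measure O} {R : O → ℝ} {Rmax : ℝ} {F : Set (Inst D O)}
    (hF : IsDecisionProblem ν R Rmax F) {f g : Inst D O} (hf : f ∈ F) (hg : g ∈ F) (π : D)
    (hac : ∀ᵐ o ∂ν, g π o = 0 → f π o = 0) :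
    kl ν f g π = ∫⁻ o, ENNReal.ofReal (g π o * klFun (f π o / g π o)) ∂ν :=
  klDiv_withDensity (hF.measurable_density f hf π) (hF.measurable_density g hg π)
    (hF.lintegral_density f hf π) (hF.lintegral_density g hg π) hac

theorem kl_of_not_ac {ν : Measure O} {R : O → ℝ} {Rmax : ℝ} {F : Set (Inst D O)}
    (hF : IsDecisionProblem ν R Rmax F) {f g : Inst D O} (hf : f ∈ F) (hg : g ∈ F) (π : D)
    (hac : ¬ ∀ᵐ o ∂ν, g π o = 0 → f π o = 0) : kl ν f g π = ⊤ :=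
  klDiv_of_not_ac fun h => hac ((withDensity_absolutelyContinuous_iff
    (hF.measurable_density f hf π) (hF.measurable_density g hg π)).1 h)

theorem RelClose.ac_iff {ν : Measure O} {f₀ f : Inst D O} {η : ℝ} (hη1 : η < 1)
    (h : RelClose ν f₀ f η) (g : Inst D O) (π : D) :
    (∀ᵐ o ∂ν, g π o = 0 → f π o = 0) ↔ ∀ᵐ o ∂ν, g π o = 0 → f₀ π o = 0 := by
  refine eventually_congr ?_
  filter_upwards [h.eq_zero_iff hη1 π] with o ho
  rw [ho]

theorem lintegral_ofReal_mul_add_density {ν : Measure O} {R : O → ℝ} {Rmax : ℝ}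
    {F : Set (Inst D O)} (hF : IsDecisionProblem ν R Rmax F) {f g : Inst D O} (hf : f ∈ F)
    (hg : g ∈ F) (π : D) {c : ℝ} (hc : 0 ≤ c) :
    ∫⁻ o, ENNReal.ofReal (c * (f π o + g π o)) ∂ν = ENNReal.ofReal (2 * c) := by
  have hfm : Measurable fun o => (f π o : ℝ≥0∞) :=
    (hF.measurable_density f hf π).coe_nnreal_ennreal
  have hgm : Measurable fun o => (g π o : ℝ≥0∞) :=
    (hF.measurable_density g hg π).coe_nnreal_ennreal
  have : ∀ o, ENNReal.ofReal (c * (f π o + g π o)) =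
      ENNReal.ofReal c * ((f π o : ℝ≥0∞) + g π o) := by
    intro o
    rw [ENNReal.ofReal_mul hc, ENNReal.ofReal_add (by positivity) (by positivity),
      ENNReal.ofReal_coe_nnreal, ENNReal.ofReal_coe_nnreal]
  simp_rw [this]
  rw [lintegral_const_mul _ (hfm.fun_add hgm), lintegral_add_left hfm,
    hF.lintegral_density f hf π, hF.lintegral_density g hg π, mul_comm 2 c,
    ENNReal.ofReal_mul hc]
  norm_num

/-- The pointwise bound is integrated; `p₀ + q` has integral two, whence `4 η`. If absolute
continuity fails for `f` it fails for `f₀`, because the two densities vanish at the same points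
almost everywhere. -/
theorem RelClose.kl_le {ν : Measure O} {R : O → ℝ} {Rmax : ℝ} {F : Set (Inst D O)}
    (hF : IsDecisionProblem ν R Rmax F) {f₀ f g : Inst D O} (hf₀ : f₀ ∈ F) (hf : f ∈ F)
    (hg : g ∈ F) {η : ℝ} (hη : 0 ≤ η) (hη1 : η < 1) (h : RelClose ν f₀ f η) (π : D) :
    kl ν f g π ≤ ENNReal.ofReal (1 + η) * kl ν f₀ g π + ENNReal.ofReal (4 * η) := by
  by_cases hac : ∀ᵐ o ∂ν, g π o = 0 → f π o = 0
  · rw [kl_of_ac hF hf hg π hac, kl_of_ac hF hf₀ hg π ((h.ac_iff hη1 g π).1 hac)]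
    have hm := measurable_ofReal_mul_klFun (hF.measurable_density f₀ hf₀ π)
      (hF.measurable_density g hg π)
    rw [← lintegral_const_mul _ hm, show 4 * η = 2 * (2 * η) by ring,
      ← lintegral_ofReal_mul_add_density hF hf₀ hg π (by positivity : 0 ≤ 2 * η),
      ← lintegral_add_left (hm.const_mul _)]
    refine lintegral_mono_ae ?_
    filter_upwards [h π] with o ho
    have hk : 0 ≤ (g π o : ℝ) * klFun (f₀ π o / g π o) :=
      mul_nonneg (g π o).coe_nonneg (klFun_nonneg (by positivity))
    rw [← ENNReal.ofReal_mul (by positivity), ← ENNReal.ofReal_add (by positivity) (by positivity)]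
    exact ENNReal.ofReal_le_ofReal (mul_klFun_perturb_le (by positivity) (by positivity)
      (by positivity) hη hη1 ho)
  · rw [kl_of_not_ac hF hf₀ hg π (fun h' => hac ((h.ac_iff hη1 g π).2 h')),
      ENNReal.mul_top (by simp; linarith), top_add]
    exact le_top

theorem RelClose.le_kl {ν : Measure O} {R : O → ℝ} {Rmax : ℝ} {F : Set (Inst D O)}
    (hF : IsDecisionProblem ν R Rmax F) {f₀ f g : Inst D O} (hf₀ : f₀ ∈ F) (hf : f ∈ F)
    (hg : g ∈ F) {η : ℝ} (hη : 0 ≤ η) (hη1 : η < 1) (h : RelClose ν f₀ f η) (π : D) :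
    ENNReal.ofReal (1 - η) * kl ν f₀ g π ≤ kl ν f g π + ENNReal.ofReal (2 * η) := by
  by_cases hac : ∀ᵐ o ∂ν, g π o = 0 → f π o = 0
  · rw [kl_of_ac hF hf hg π hac, kl_of_ac hF hf₀ hg π ((h.ac_iff hη1 g π).1 hac)]
    have hm := measurable_ofReal_mul_klFun (hF.measurable_density f₀ hf₀ π)
      (hF.measurable_density g hg π)
    have hm' := measurable_ofReal_mul_klFun (hF.measurable_density f hf π)
      (hF.measurable_density g hg π)
    rw [← lintegral_const_mul _ hm,
      ← lintegral_ofReal_mul_add_density hF hf₀ hg π hη,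
      ← lintegral_add_left hm']
    refine lintegral_mono_ae ?_
    filter_upwards [h π] with o ho
    have hk : 0 ≤ (g π o : ℝ) * klFun (f π o / g π o) :=
      mul_nonneg (g π o).coe_nonneg (klFun_nonneg (by positivity))
    rw [← ENNReal.ofReal_mul (by linarith), ← ENNReal.ofReal_add (by positivity) (by positivity)]
    exact ENNReal.ofReal_le_ofReal (le_mul_klFun_perturb (by positivity) (by positivity)
      (by positivity) hη hη1 ho)
  · rw [kl_of_not_ac hF hf hg π hac, top_add]
    exact le_top

/-! ### Rényi divergences -/

/-- The Hellinger-type integral `∫ p^{1-λ} q^λ`. -/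
def affinity (ν : Measure O) (lam : ℝ) (p q : O → ℝ≥0) : ℝ≥0∞ :=
  ∫⁻ x, (p x : ℝ≥0∞) ^ (1 - lam) * (q x : ℝ≥0∞) ^ lam ∂ν

theorem affinity_le_of_le_renyi {ν : Measure O} {lam d : ℝ} (hlam : 0 < lam) {p q : O → ℝ≥0}
    (h : (d : EReal) ≤ renyi ν (1 - lam) p q) :
    affinity ν lam p q ≤ ENNReal.ofReal (Real.exp (-(lam * d))) := by
  have hI : renyi ν (1 - lam) p q =
      ((-(1 / lam) : ℝ) : EReal) * ENNReal.log (affinity ν lam p q) := by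
    unfold renyi affinity
    congr 2
    · rw [show 1 - lam - 1 = -lam by ring, one_div_neg_eq_neg_one_div]
    · simp only [sub_sub_cancel]
  rw [hI] at h
  set I := affinity ν lam p q
  have hneg : -(1 / lam) < 0 := by
    have : 0 < 1 / lam := by positivity
    linarith
  rcases eq_or_ne I 0 with h0 | h0
  · rw [h0]; exact zero_le
  -- An infinite affinity would make the Rényi divergence `-∞`, below the real number `d`.
  rcases eq_or_ne I ⊤ with ht | ht
  · rw [ht, ENNReal.log_top, EReal.coe_mul_top_of_neg hneg] at h
    exact absurd (le_bot_iff.1 h) (EReal.coe_ne_bot _)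
  rw [ENNReal.log_pos_real h0 ht, ← EReal.coe_mul, EReal.coe_le_coe_iff] at h
  rw [← ENNReal.ofReal_toReal ht]
  refine ENNReal.ofReal_le_ofReal ?_
  have hpos : 0 < I.toReal := ENNReal.toReal_pos h0 ht
  rw [← Real.log_le_iff_le_exp hpos]
  have : lam * d ≤ lam * (-(1 / lam) * Real.log I.toReal) := by gcongr
  have heq : lam * (-(1 / lam) * Real.log I.toReal) = -Real.log I.toReal := by field_simp
  linarith

/-- This is the weighted inequality `p^(1-λ) q^λ ≤ (1-λ) p + λ q`, integrated. -/
theorem affinity_le_one {ν : Measure O} {R : O → ℝ} {Rmax : ℝ} {F : Set (Inst D O)}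
    (hF : IsDecisionProblem ν R Rmax F) {f g : Inst D O} (hf : f ∈ F) (hg : g ∈ F)
    {lam : ℝ} (h0 : 0 < lam) (h1 : lam < 1) (π : D) :
    affinity ν lam (f π) (g π) ≤ 1 := by
  have hfm : Measurable fun o => (f π o : ℝ≥0∞) :=
    (hF.measurable_density f hf π).coe_nnreal_ennreal
  have hgm : Measurable fun o => (g π o : ℝ≥0∞) :=
    (hF.measurable_density g hg π).coe_nnreal_ennreal
  calc affinity ν lam (f π) (g π)
      ≤ ∫⁻ o, (ENNReal.ofReal (1 - lam) * f π o + ENNReal.ofReal lam * g π o) ∂ν := by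
        refine lintegral_mono fun o => ?_
        have := NNReal.geom_mean_le_arith_mean2_weighted (1 - lam).toNNReal lam.toNNReal
          (f π o) (g π o) (by rw [← Real.toNNReal_add (by linarith) h0.le]; simp)
        rw [Real.coe_toNNReal _ (by linarith), Real.coe_toNNReal _ h0.le] at this
        simp only
        rw [← ENNReal.coe_rpow_of_nonneg _ (by linarith), ← ENNReal.coe_rpow_of_nonneg _ h0.le]
        unfold ENNReal.ofReal
        exact_mod_cast this
    _ = 1 := by
      rw [lintegral_add_left (hfm.const_mul _), lintegral_const_mul _ hfm,
        lintegral_const_mul _ hgm, hF.lintegral_density f hf π, hF.lintegral_density g hg π,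
        mul_one, mul_one, ← ENNReal.ofReal_add (by linarith) h0.le]
      simp

/-- The truncated KL divergence `min (KL - ε) α`, with truncated subtraction. -/
def truncKL (ν : Measure O) (ε α : ℝ) (f g : Inst D O) (π : D) : ℝ :=
  (min (kl ν f g π - ENNReal.ofReal ε) (ENNReal.ofReal α)).toReal

theorem truncKL_nonneg (ν : Measure O) (ε α : ℝ) (f g : Inst D O) (π : D) :
    0 ≤ truncKL ν ε α f g π := ENNReal.toReal_nonneg

theorem truncKL_le (ν : Measure O) (ε : ℝ) {α : ℝ} (hα : 0 ≤ α) (f g : Inst D O) (π : D) :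
    truncKL ν ε α f g π ≤ α :=
  ENNReal.toReal_le_of_le_ofReal hα (min_le_right _ _)

/-- The exponent up to which the Rényi condition is guaranteed to hold. -/
def renyiOrder (c₁ c₂ c₃ κ ε α : ℝ) : ℝ := min (1 / 2) (ε ^ c₁ * min (1 / α) c₂ ^ c₃ * κ)

/-- This is the form in which the Rényi condition is used: an exponential moment bound for
likelihood ratios, with one explicit order that is valid for all alternatives and decisions. -/
theorem exists_affinity_le {ν : Measure O} {R : O → ℝ} {Rmax : ℝ} {F : Set (Inst D O)}
    (hF : IsDecisionProblem ν R Rmax F) (h₁ : RenyiUniformConvergence ν F) {f : Inst D O}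
    (hf : f ∈ F) :
    ∃ c₁ c₂ c₃ κ : ℝ, 0 < c₁ ∧ 0 < c₂ ∧ 0 < c₃ ∧ 0 < κ ∧ ∀ ε > 0, ∀ α > 0, ∀ g ∈ F, ∀ π,
      affinity ν (renyiOrder c₁ c₂ c₃ κ ε α) (f π) (g π) ≤
        ENNReal.ofReal (Real.exp (-(renyiOrder c₁ c₂ c₃ κ ε α * truncKL ν ε α f g π))) := by
  obtain ⟨c₁, c₂, c₃, ι, lam₀, hc₁, hc₂, hc₃, hι, h⟩ := h₁
  refine ⟨c₁, c₂, c₃, ι f, hc₁, hc₂, hc₃, hι f hf, fun ε hε α hα g hg π => ?_⟩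
  obtain ⟨-, hlam, hR⟩ := h α hα ε hε f hf
  set lam := renyiOrder c₁ c₂ c₃ (ι f) ε α with hdef
  have hpos : 0 < lam := by
    have := hι f hf
    have : 0 < min (1 / α) c₂ := lt_min (by positivity) hc₂
    exact lt_min (by norm_num) (by positivity)
  have hlt : lam < 1 := (min_le_left _ _).trans_lt (by norm_num)
  have hle : lam ≤ lam₀ α ε f := (min_le_right _ _).trans hlam
  have hRen := hR lam hpos hlt hle g hg π
  -- Here the truncated exponent is zero and the trivial bound by one suffices.
  by_cases hk : kl ν f g π ≤ ENNReal.ofReal ε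
  · have : truncKL ν ε α f g π = 0 := by
      unfold truncKL; rw [tsub_eq_zero_of_le hk]; simp
    rw [this]
    simpa using affinity_le_one hF hf hg hpos hlt π
  push Not at hk
  refine affinity_le_of_le_renyi hpos (le_trans (le_of_eq ?_) hRen)
  unfold truncKL
  rcases eq_or_ne (kl ν f g π) ⊤ with ht | ht
  · rw [ht, EReal.coe_ennreal_top, EReal.top_sub_coe, ENNReal.top_sub (by simp)]
    simp [hα.le]
  · have hk' : ε ≤ (kl ν f g π).toReal := (ENNReal.ofReal_le_iff_le_toReal ht).1 hk.le
    rw [← ENNReal.ofReal_toReal ht, ← ENNReal.ofReal_sub _ hε.le, ← ENNReal.ofReal_min,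
      ENNReal.toReal_ofReal (le_min (by linarith) hα.le), EReal.coe_ennreal_ofReal,
      max_eq_left ENNReal.toReal_nonneg, ← EReal.coe_sub]
    exact EReal.coe_strictMono.monotone.map_min

/-- The Rényi condition rules out an infinite KL divergence between instances that are not mutually
singular. -/
theorem affinity_eq_zero_of_kl_eq_top {ν : Measure O} {F : Set (Inst D O)}
    (h₁ : RenyiUniformConvergence ν F) {f g : Inst D O} (hf : f ∈ F) (hg : g ∈ F) (π : D)
    (hkl : kl ν f g π = ⊤) : affinity ν (1 / 2) (f π) (g π) = 0 := by
  obtain ⟨c₁, c₂, c₃, ι, lam₀, hc₁, hc₂, hc₃, hι, h⟩ := h₁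
  have hbound : ∀ α : ℝ, 0 < α →
      affinity ν (1 / 2) (f π) (g π) ≤ ENNReal.ofReal (Real.exp (-(1 / 2 * α))) := by
    intro α hα
    have hc : 0 < min (1 / α) c₂ ^ c₃ * ι f :=
      mul_pos (Real.rpow_pos_of_pos (lt_min (by positivity) hc₂) _) (hι f hf)
    have hlim : Tendsto (fun ε : ℝ => ε ^ c₁ * (min (1 / α) c₂ ^ c₃ * ι f)) atTop atTop :=
      (tendsto_rpow_atTop hc₁).atTop_mul_const hc
    -- For infinite divergence the slack `ε` costs nothing. Taking it large pushes the guaranteed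
    -- range of orders beyond `1/2`, for every `α`.
    obtain ⟨ε, hε1, hε⟩ := ((hlim.eventually_ge_atTop (1 / 2)).and (eventually_gt_atTop 0)).exists
    obtain ⟨-, hlam, hR⟩ := h α hα ε hε f hf
    have := hR (1 / 2) (by norm_num) (by norm_num) (by
      refine hε1.trans (le_trans (le_of_eq ?_) hlam); ring) g hg π
    rw [hkl, EReal.coe_ennreal_top, EReal.top_sub_coe, min_eq_right le_top] at this
    exact affinity_le_of_le_renyi (by norm_num) this
  have hlim : Tendsto (fun α : ℝ => ENNReal.ofReal (Real.exp (-(1 / 2 * α)))) atTop (𝓝 0) := by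
    rw [← ENNReal.ofReal_zero]
    refine ENNReal.tendsto_ofReal (Real.tendsto_exp_neg_atTop_nhds_zero.comp ?_)
    exact tendsto_id.const_mul_atTop (by norm_num)
  exact le_antisymm (ge_of_tendsto hlim ((eventually_gt_atTop 0).mono hbound)) zero_le

/-- An instance close to `f₀` in sup-distance is a relative perturbation of `f₀`. -/
theorem relClose_of_densityDist_le {ν : Measure O} {R : O → ℝ} {Rmax : ℝ} {F : Set (Inst D O)}
    (hF : IsDecisionProblem ν R Rmax F) (h₁ : RenyiUniformConvergence ν F) {f₀ f : Inst D O}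
    (hf₀ : f₀ ∈ F) (hf : f ∈ F) {cmin : ℝ} (hcmin : 0 < cmin)
    (hmin : ∀ π o, f₀ π o ≠ 0 → cmin < f₀ π o) {η : ℝ} (hη : 0 ≤ η) (hη1 : η < 1)
    (hd : ∀ π, densityDist (f₀ π) (f π) ≤ ENNReal.ofReal (cmin * η)) :
    RelClose ν f₀ f η := by
  intro π
  have hpt : ∀ o, |(f π o : ℝ) - f₀ π o| ≤ cmin * η := by
    intro o
    have := (le_iSup (fun o => edist (f₀ π o) (f π o)) o).trans (hd π)
    rw [edist_dist, ENNReal.ofReal_le_ofReal_iff (by positivity), NNReal.dist_eq,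
      abs_sub_comm] at this
    exact this
  -- Off the support of `f₀` sup-closeness gives no relative bound, so `f` must be shown to vanish
  -- there. Infinite divergence would make the affinity zero, yet `f` is positive wherever `f₀` is,
  -- since `f₀ > cmin` there and `η < 1`.
  have hfin : kl ν f f₀ π ≠ ⊤ := by
    intro htop
    have h0 := affinity_eq_zero_of_kl_eq_top h₁ hf hf₀ π htop
    have hfm : Measurable fun o => (f π o : ℝ≥0∞) :=
      (hF.measurable_density f hf π).coe_nnreal_ennreal
    have hgm : Measurable fun o => (f₀ π o : ℝ≥0∞) :=
      (hF.measurable_density f₀ hf₀ π).coe_nnreal_ennreal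
    unfold affinity at h0
    rw [lintegral_eq_zero_iff ((hfm.pow_const _).fun_mul (hgm.pow_const _))] at h0
    have hz : ∀ᵐ o ∂ν, (f₀ π o : ℝ≥0∞) = 0 := by
      filter_upwards [h0] with o ho
      by_contra hne
      have hne' : f₀ π o ≠ 0 := by simpa using hne
      have h1 := hmin π o hne'
      have h2 := (abs_le.1 (hpt o)).1
      have h3 : (0 : ℝ) < f π o := by nlinarith
      have h4 : (f π o : ℝ≥0∞) ≠ 0 := by
        simpa using (NNReal.coe_pos.1 h3).ne'
      have ho' : (f π o : ℝ≥0∞) ^ (1 - 1 / 2 : ℝ) * (f₀ π o : ℝ≥0∞) ^ (1 / 2 : ℝ) = 0 := ho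
      rw [mul_eq_zero] at ho'
      rcases ho' with h' | h'
      · rw [ENNReal.rpow_eq_zero_iff] at h'
        rcases h' with h' | h'
        · exact h4 h'.1
        · exact ENNReal.coe_ne_top h'.1
      · rw [ENNReal.rpow_eq_zero_iff] at h'
        rcases h' with h' | h'
        · exact hne h'.1
        · exact ENNReal.coe_ne_top h'.1
    have := hF.lintegral_density f₀ hf₀ π
    rw [lintegral_congr_ae hz] at this
    simp at this
  have hac : ∀ᵐ o ∂ν, f₀ π o = 0 → f π o = 0 := by
    by_contra hcon
    exact hfin (kl_of_not_ac hF hf hf₀ π hcon)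
  filter_upwards [hac] with o ho
  by_cases h0 : f₀ π o = 0
  · simp [h0, ho h0]
  · refine (hpt o).trans ?_
    have := hmin π o h0
    nlinarith

/-! ### Continuity of the mean rewards -/

theorem abs_meanReward_sub_le {ν : Measure O} {R : O → ℝ} {Rmax : ℝ} {F : Set (Inst D O)}
    (hF : IsDecisionProblem ν R Rmax F) (hν : ν Set.univ < ⊤) {f₀ f : Inst D O}
    (hf₀ : f₀ ∈ F) (hf : f ∈ F) {η : ℝ} (hη : 0 ≤ η) (π : D)
    (hd : densityDist (f₀ π) (f π) ≤ ENNReal.ofReal η) :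
    |meanReward ν R f π - meanReward ν R f₀ π| ≤ Rmax * (ν Set.univ).toReal * η := by
  have hfin : IsFiniteMeasure ν := ⟨hν⟩
  have hR0 := hF.Rmax_nonneg hf
  -- The reward is bounded only almost surely under each law. Its clipped version has the same means
  -- and is bounded pointwise, so both laws can be compared under the base measure.
  set R' : O → ℝ := fun o => max 0 (min (R o) Rmax) with hR'
  have hR'm : Measurable R' := measurable_const.max (hF.measurable_reward.min measurable_const)
  have hR'b : ∀ o, 0 ≤ R' o ∧ R' o ≤ Rmax := fun o =>
    ⟨le_max_left _ _, max_le hR0 (min_le_right _ _)⟩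
  have hmean : ∀ g ∈ F, meanReward ν R g π = ∫ o, g π o • R' o ∂ν ∧
      Integrable (fun o => g π o • R' o) ν := by
    intro g hg
    have := hF.isProbabilityMeasure hg π
    have hi : Integrable R' (law ν g π) :=
      Integrable.of_mem_Icc 0 Rmax hR'm.aemeasurable (Eventually.of_forall hR'b)
    refine ⟨?_, (integrable_withDensity_iff_integrable_smul (hF.measurable_density g hg π)).1 hi⟩
    rw [← integral_withDensity_eq_integral_smul (hF.measurable_density g hg π)]
    refine integral_congr_ae ?_
    filter_upwards [hF.bounded_reward g hg π] with o ho
    simp [hR', ho.1, ho.2]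
  rw [(hmean f hf).1, (hmean f₀ hf₀).1, ← integral_sub (hmean f hf).2 (hmean f₀ hf₀).2,
    ← Real.norm_eq_abs]
  refine (norm_integral_le_of_norm_le_const (C := Rmax * η) (Eventually.of_forall fun o => ?_)).trans
    (le_of_eq ?_)
  · have := (le_iSup (fun o => edist (f₀ π o) (f π o)) o).trans hd
    rw [edist_dist, ENNReal.ofReal_le_ofReal_iff hη, NNReal.dist_eq, abs_sub_comm] at this
    rw [NNReal.smul_def, NNReal.smul_def, smul_eq_mul, smul_eq_mul, ← sub_mul, Real.norm_eq_abs,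
      abs_mul, abs_of_nonneg (hR'b o).1, mul_comm]
    exact mul_le_mul (hR'b o).2 this (abs_nonneg _) hR0
  · simp only [Measure.real]; ring

/-- Uniqueness of the optimum enters here: it leaves a positive margin, which makes the best
decision stable under small perturbations. -/
theorem gap_pos_of_ne_best {ν : Measure O} {R : O → ℝ} {Rmax : ℝ} {F : Set (Inst D O)}
    (hF : IsDecisionProblem ν R Rmax F) {f : Inst D O} (hf : f ∈ F) {π : D}
    (h : π ≠ best ν R f) : 0 < gap ν R f π := by
  refine lt_of_le_of_ne (gap_nonneg _ _ _ _) fun h0 => h ?_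
  have hb := Classical.choose_spec (Finite.exists_max (meanReward ν R f))
  refine (hF.unique_optimal f hf).unique (fun π' => ?_) hb
  have : meanReward ν R f π = meanReward ν R f (best ν R f) := by
    unfold gap at h0; linarith
  rw [this]
  exact hb π'

theorem best_eq_of_meanReward_close {ν : Measure O} {R : O → ℝ} {f₀ f : Inst D O} {s : ℝ}
    (hs : ∀ π, π ≠ best ν R f₀ → 2 * s < gap ν R f₀ π)
    (hd : ∀ π, |meanReward ν R f π - meanReward ν R f₀ π| ≤ s) :
    best ν R f = best ν R f₀ := by
  by_contra hne
  have h1 := hs _ hne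
  have h2 := abs_le.1 (hd (best ν R f))
  have h3 := abs_le.1 (hd (best ν R f₀))
  have h4 := Classical.choose_spec (Finite.exists_max (meanReward ν R f)) (best ν R f₀)
  have h5 : meanReward ν R f (best ν R f₀) ≤ meanReward ν R f (best ν R f) := h4
  unfold gap at h1
  linarith [h2.2, h3.1]

theorem abs_gap_sub_le {ν : Measure O} {R : O → ℝ} {f₀ f : Inst D O} {s : ℝ}
    (hbest : best ν R f = best ν R f₀)
    (hd : ∀ π, |meanReward ν R f π - meanReward ν R f₀ π| ≤ s) (π : D) :
    |gap ν R f π - gap ν R f₀ π| ≤ 2 * s := by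
  have h1 := abs_le.1 (hd π)
  have h2 := abs_le.1 (hd (best ν R f₀))
  unfold gap
  rw [hbest, abs_le]
  constructor <;> linarith [h1.1, h1.2, h2.1, h2.2]

/-! ### Phases with a fixed list of decisions -/

theorem zip_append_singleton {α β : Type*} (l : List α) (z : List β) (o : β)
    (hz : z.length < l.length) :
    l.zip (z ++ [o]) = l.zip z ++ [(l[z.length], o)] := by
  induction l generalizing z with
  | nil => simp at hz
  | cons a l ih =>
    cases z with
    | nil => simp
    | cons b z =>
      simp only [List.cons_append, List.zip_cons_cons, List.length_cons, List.getElem_cons_succ]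
      rw [ih z (by simpa using hz)]

/-- Expectations of sums of products over a phase in which the decisions are fixed in advance. -/
theorem value_fixed_plays_le {ν : Measure O} {R : O → ℝ} {Rmax : ℝ}
    {F : Set (Inst D O)} (hF : IsDecisionProblem ν R Rmax F) {f : Inst D O} (hf : f ∈ F)
    (alg : List O → D) (l : List D) (h : List O)
    (halg : ∀ z : List O, ∀ hz : z.length < l.length, alg (h ++ z) = l[z.length])
    {ι : Type*} (J : Finset ι) (u : ι → D → O → ℝ≥0∞) (hu : ∀ j ∈ J, ∀ π, Measurable (u j π))
    (a c : ℝ≥0∞) (φ : List O → ℝ≥0∞)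
    (hφ : ∀ z : List O, z.length = l.length →
      φ (h ++ z) ≤ a + c * ∑ j ∈ J, ((l.zip z).map fun p => u j p.1 p.2).prod) :
    value ν f alg l.length φ h ≤
      a + c * ∑ j ∈ J, (l.map fun π => ∫⁻ o, u j π o ∂(law ν f π)).prod := by
  -- The process multiplies the factors already observed by the one-step means of the plays still
  -- ahead; these are known because the list is fixed.
  have hW := value_le_of_supermartingale ν f alg l.length φ
    (fun z => a + c * ∑ j ∈ J, ((l.zip z).map fun p => u j p.1 p.2).prod *
      ((l.drop z.length).map fun π => ∫⁻ o, u j π o ∂(law ν f π)).prod) h ?_ ?_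
  · simpa using hW
  · intro z hz
    have := hF.isProbabilityMeasure hf l[z.length]
    rw [halg z hz]
    have hstep : ∀ j o, ((l.zip (z ++ [o])).map fun p => u j p.1 p.2).prod *
        ((l.drop (z ++ [o]).length).map fun π => ∫⁻ o, u j π o ∂(law ν f π)).prod =
        (((l.zip z).map fun p => u j p.1 p.2).prod *
        ((l.drop (z.length + 1)).map fun π => ∫⁻ o, u j π o ∂(law ν f π)).prod) *
          u j l[z.length] o := by
      intro j o
      rw [zip_append_singleton l z o hz, List.length_append, List.length_singleton]
      simp only [List.map_append, List.prod_append, List.map_cons, List.map_nil,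
        List.prod_singleton]
      ring
    simp only [hstep]
    have hmeas : ∀ j ∈ J, Measurable fun o => (((l.zip z).map fun p => u j p.1 p.2).prod *
        ((l.drop (z.length + 1)).map fun π => ∫⁻ o, u j π o ∂(law ν f π)).prod) *
          u j l[z.length] o := fun j hj => (hu j hj _).const_mul _
    rw [lintegral_add_left measurable_const, lintegral_const_mul _ (Finset.measurable_sum _ hmeas),
      lintegral_finsetSum _ hmeas]
    simp only [lintegral_const, measure_univ, mul_one]
    gcongr with j hj
    rw [lintegral_const_mul _ (hu j hj _), List.drop_eq_getElem_cons hz, List.map_cons,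
      List.prod_cons]
    exact le_of_eq (by ring)
  · intro z hz
    refine (hφ z hz).trans (le_of_eq ?_)
    simp [hz]

theorem prod_map_playList (N : D → ℕ) (I : D → ℝ≥0∞) :
    ((playList N).map I).prod = ∏ π, I π ^ N π := by
  have h : ∀ L : List D, ((L.flatMap fun π => List.replicate (N π) π).map I).prod =
      (L.map fun π => I π ^ N π).prod := by
    intro L
    induction L with
    | nil => simp
    | cons a L ih => simp [ih]
  rw [playList, h, Finset.prod_map_toList]

theorem length_playList (N : D → ℕ) : (playList N).length = ∑ π, N π := by
  unfold playList
  rw [List.length_flatMap, ← Finset.sum_map_toList]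
  simp

theorem sum_map_playList (N : D → ℕ) (I : D → ℝ≥0∞) :
    ((playList N).map I).sum = ∑ π, (N π : ℝ≥0∞) * I π := by
  have h : ∀ L : List D, ((L.flatMap fun π => List.replicate (N π) π).map I).sum =
      (L.map fun π => (N π : ℝ≥0∞) * I π).sum := by
    intro L
    induction L with
    | nil => simp
    | cons a L ih => simp [ih]
  rw [playList, h, Finset.sum_map_toList]

/-! ### Likelihood ratios -/

/-- Nonvanishing of all factors matters because `0 * ⊤ = 0`; this is why envelopes are made strictly
positive. -/
theorem list_prod_eq_top {ι : Type*} (l : List ι) (v : ι → ℝ≥0∞) (h0 : ∀ p ∈ l, v p ≠ 0)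
    (ht : ∃ p ∈ l, v p = ⊤) : (l.map v).prod = ⊤ := by
  induction l with
  | nil => simp at ht
  | cons a l ih =>
    have hne : (l.map v).prod ≠ 0 := by
      rw [Ne, List.prod_eq_zero_iff]
      intro hm
      obtain ⟨p, hp, hv⟩ := List.mem_map.1 hm
      exact h0 p (List.mem_cons_of_mem _ hp) hv
    rw [List.map_cons, List.prod_cons]
    by_cases ha : v a = ⊤
    · rw [ha, ENNReal.top_mul hne]
    · obtain ⟨p, hp, hv⟩ := ht
      rcases List.mem_cons.1 hp with rfl | hp
      · exact absurd hv ha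
      · rw [ih (fun p hp => h0 p (List.mem_cons_of_mem _ hp)) ⟨p, hp, hv⟩,
          ENNReal.mul_top (h0 a List.mem_cons_self)]

theorem list_prod_rpow {ι : Type*} (l : List ι) (v : ι → ℝ≥0∞) {lam : ℝ} (h : 0 ≤ lam) :
    (l.map fun p => v p ^ lam).prod = (l.map v).prod ^ lam := by
  induction l with
  | nil => simp
  | cons a l ih => simp only [List.map_cons, List.prod_cons, ih, ENNReal.mul_rpow_of_nonneg _ _ h]

theorem logLik_eq (f : Inst D O) (l : List (D × O)) :
    logLik f l = ENNReal.log ((l.map fun p => (f p.1 p.2 : ℝ≥0∞)).prod) := by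
  unfold logLik
  induction l with
  | nil => simp
  | cons a l ih =>
    simp only [List.map_cons, List.sum_cons, List.prod_cons, ENNReal.log_mul_add, ih]

theorem logLikRatio_eq (f g : Inst D O) (l : List (D × O)) :
    logLikRatio f g l =
      ENNReal.log ((l.map fun p => (f p.1 p.2 : ℝ≥0∞) / (g p.1 p.2 : ℝ≥0∞)).prod) := by
  unfold logLikRatio
  induction l with
  | nil => simp
  | cons a l ih =>
    simp only [List.map_cons, List.sum_cons, List.prod_cons, ENNReal.log_mul_add, ih]

theorem le_logLikRatio_iff {n : ℕ} (hn : 1 ≤ n) (f g : Inst D O) (l : List (D × O)) :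
    (Real.log n : EReal) ≤ logLikRatio f g l ↔
      (n : ℝ≥0∞) ≤ (l.map fun p => (f p.1 p.2 : ℝ≥0∞) / (g p.1 p.2 : ℝ≥0∞)).prod := by
  have hn' : (0 : ℝ) < n := by exact_mod_cast hn
  rw [logLikRatio_eq, ← ENNReal.log_ofReal_of_pos hn', ENNReal.log_le_log_iff,
    ENNReal.ofReal_natCast]

theorem prod_le_of_logLik_le {f g : Inst D O} {tol : ℝ} {l : List (D × O)}
    (h : logLik g l ≤ logLik f l + (tol : EReal)) :
    (l.map fun p => (g p.1 p.2 : ℝ≥0∞)).prod ≤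
      ENNReal.ofReal (Real.exp tol) * (l.map fun p => (f p.1 p.2 : ℝ≥0∞)).prod := by
  rw [logLik_eq, logLik_eq, add_comm, ← Real.log_exp tol,
    ← ENNReal.log_ofReal_of_pos (Real.exp_pos tol), ← ENNReal.log_mul_add,
    ENNReal.log_le_log_iff] at h
  exact h

/-- A lower bound for the ratio of an upper envelope `v` of `f` to `f₀` when `f` is almost as likely
as `f₀`. -/
theorem one_le_prod_of_prod_le {f₀ f : Inst D O} {v : D → O → ℝ≥0∞} {c : ℝ≥0∞} (hc : c ≠ 0)
    (hv0 : ∀ π o, v π o ≠ 0) (hfv : ∀ π o, (f π o : ℝ≥0∞) ≤ v π o) (l : List (D × O))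
    (h : (l.map fun p => (f₀ p.1 p.2 : ℝ≥0∞)).prod ≤
      c * (l.map fun p => (f p.1 p.2 : ℝ≥0∞)).prod) :
    1 ≤ c * (l.map fun p => v p.1 p.2 / f₀ p.1 p.2).prod := by
  -- The inequality is needed for every list, including observations of probability zero under `f₀`;
  -- there the positive envelope makes the product infinite.
  by_cases hz : ∃ p ∈ l, f₀ p.1 p.2 = 0
  · rw [list_prod_eq_top l _ (fun p _ => (ENNReal.div_ne_zero.2 ⟨hv0 _ _, by simp⟩))
      (by
        obtain ⟨p, hp, h0⟩ := hz
        exact ⟨p, hp, by simp [h0, ENNReal.div_zero (hv0 _ _)]⟩), ENNReal.mul_top hc]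
    exact le_top
  push Not at hz
  have hP0 : (l.map fun p => (f₀ p.1 p.2 : ℝ≥0∞)).prod ≠ 0 := by
    rw [Ne, List.prod_eq_zero_iff]
    intro hm
    obtain ⟨p, hp, h0⟩ := List.mem_map.1 hm
    exact hz p hp (by simpa using h0)
  have hPt : (l.map fun p => (f₀ p.1 p.2 : ℝ≥0∞)).prod ≠ ⊤ := by
    clear hP0 h hz
    induction l with
    | nil => simp
    | cons a l ih =>
      simp only [List.map_cons, List.prod_cons]
      exact ENNReal.mul_ne_top (by simp) ih
  have hle : (l.map fun p => (f p.1 p.2 : ℝ≥0∞)).prod ≤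
      (l.map fun p => v p.1 p.2 / f₀ p.1 p.2).prod *
        (l.map fun p => (f₀ p.1 p.2 : ℝ≥0∞)).prod := by
    rw [← List.prod_map_mul]
    refine List.prod_le_prod' fun p hp => ?_
    rw [ENNReal.div_mul_cancel (by simpa using hz p hp) (by simp)]
    exact hfv _ _
  have : 1 * (l.map fun p => (f₀ p.1 p.2 : ℝ≥0∞)).prod ≤
      (c * (l.map fun p => v p.1 p.2 / f₀ p.1 p.2).prod) *
        (l.map fun p => (f₀ p.1 p.2 : ℝ≥0∞)).prod := by
    rw [one_mul, mul_assoc]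
    exact h.trans (by gcongr)
  exact (ENNReal.mul_le_mul_iff_left hP0 hPt).1 this

/-- A lower bound for the ratio of an upper envelope `v` of `g` to `f₀` when the likelihood ratio
of `f` against `g` is small. -/
theorem one_le_prod_of_ratio_lt {f₀ f g : Inst D O} {v : D → O → ℝ≥0∞} {c x : ℝ≥0∞}
    (hx : x ≠ 0) (hc0 : c ≠ 0) (hv0 : ∀ π o, v π o ≠ 0)
    (hgv : ∀ π o, (g π o : ℝ≥0∞) ≤ v π o)
    (hff : ∀ π o, f₀ π o ≠ 0 → (f₀ π o : ℝ≥0∞) ≤ c * f π o) (l : List (D × O))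
    (h : (l.map fun p => (f p.1 p.2 : ℝ≥0∞) / (g p.1 p.2 : ℝ≥0∞)).prod ≤ x) :
    1 ≤ (x * c ^ l.length) * (l.map fun p => v p.1 p.2 / f₀ p.1 p.2).prod := by
  by_cases hz : ∃ p ∈ l, f₀ p.1 p.2 = 0
  · rw [list_prod_eq_top l _ (fun p _ => (ENNReal.div_ne_zero.2 ⟨hv0 _ _, by simp⟩))
      (by
        obtain ⟨p, hp, h0⟩ := hz
        exact ⟨p, hp, by simp [h0, ENNReal.div_zero (hv0 _ _)]⟩),
      ENNReal.mul_top (mul_ne_zero hx (pow_ne_zero _ hc0))]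
    exact le_top
  push Not at hz
  -- Observation by observation, `f₀ ≤ c f` and `g ≤ v` give `1 ≤ c (v / f₀) (f / g)`. Multiplying
  -- over the list leaves one factor `c` per observation.
  have hone : ∀ p ∈ l, 1 ≤ c * ((v p.1 p.2 / f₀ p.1 p.2) *
      ((f p.1 p.2 : ℝ≥0∞) / (g p.1 p.2 : ℝ≥0∞))) := by
    intro p hp
    have h0 := hz p hp
    have h0' : (f₀ p.1 p.2 : ℝ≥0∞) ≠ 0 := by simpa using h0
    have hle := hff p.1 p.2 h0
    have hf0 : (f p.1 p.2 : ℝ≥0∞) ≠ 0 := by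
      intro hf0
      rw [hf0, mul_zero] at hle
      exact h0' (le_antisymm hle zero_le)
    by_cases hg0 : g p.1 p.2 = 0
    · rw [hg0, ENNReal.coe_zero, ENNReal.div_zero hf0, ENNReal.mul_top
        (ENNReal.div_ne_zero.2 ⟨hv0 _ _, by simp⟩), ENNReal.mul_top hc0]
      exact le_top
    · have hg0' : (g p.1 p.2 : ℝ≥0∞) ≠ 0 := by simpa using hg0
      calc (1 : ℝ≥0∞) = (f₀ p.1 p.2 / f₀ p.1 p.2) * ((g p.1 p.2 : ℝ≥0∞) / g p.1 p.2) := by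
            rw [ENNReal.div_self h0' (by simp), ENNReal.div_self hg0' (by simp), one_mul]
        _ ≤ (c * f p.1 p.2 / f₀ p.1 p.2) * (v p.1 p.2 / g p.1 p.2) := by
            gcongr
            exact hgv _ _
        _ = _ := by simp only [div_eq_mul_inv]; ring
  calc (1 : ℝ≥0∞) ≤ (l.map fun p => c * ((v p.1 p.2 / f₀ p.1 p.2) *
      ((f p.1 p.2 : ℝ≥0∞) / (g p.1 p.2 : ℝ≥0∞)))).prod := by
        refine List.one_le_prod_of_one_le fun y hy => ?_
        obtain ⟨p, hp, rfl⟩ := List.mem_map.1 hy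
        exact hone p hp
    _ = c ^ l.length * ((l.map fun p => v p.1 p.2 / f₀ p.1 p.2).prod *
        (l.map fun p => (f p.1 p.2 : ℝ≥0∞) / (g p.1 p.2 : ℝ≥0∞)).prod) := by
        rw [List.prod_map_mul, List.prod_map_mul]
        simp
    _ ≤ c ^ l.length * ((l.map fun p => v p.1 p.2 / f₀ p.1 p.2).prod * x) := by gcongr
    _ = _ := by ring

/-! ### Covers -/

theorem exists_cover {F G : Set (Inst D O)} (hG : G ⊆ F) {ε : ℝ} (hε : 0 ≤ ε)
    (hfin : coveringNumber F ε ≠ ⊤) :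
    ∃ J : Finset (Inst D O), (∀ j ∈ J, j ∈ G) ∧ J.card ≤ (coveringNumber F ε).toNat ∧
      ∀ g ∈ G, ∃ j ∈ J, ∀ π o, (g π o : ℝ≥0∞) ≤ j π o + ENNReal.ofReal (2 * ε) := by
  classical
  have hne : (Set.range fun C : {C : Set (Inst D O) // C ⊆ F ∧ ∀ g ∈ F, ∃ g' ∈ C,
      instDist g g' ≤ ENNReal.ofReal ε} => C.1.encard).Nonempty :=
    ⟨_, ⟨F, subset_rfl, fun g hg => ⟨g, hg, by simp [instDist, densityDist]⟩⟩, rfl⟩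
  obtain ⟨⟨C, hCF, hC⟩, hCeq⟩ := csInf_mem hne
  have hcard : C.encard = coveringNumber F ε := by
    simp only at hCeq
    rw [hCeq, coveringNumber, iInf_subtype', iInf]
  have hCfin : C.Finite := Set.encard_ne_top_iff.1 (hcard ▸ hfin)
  set C' := hCfin.toFinset with hC'
  -- The centres must lie in `G`, where the information lower bound holds. Each centre near `G` is
  -- replaced by a nearby point of `G`, which doubles the radius.
  let rep : Inst D O → Inst D O := fun g' =>
    if h : ∃ g ∈ G, instDist g g' ≤ ENNReal.ofReal ε then h.choose else g'
  set S := C'.filter fun g' => ∃ g ∈ G, instDist g g' ≤ ENNReal.ofReal ε with hS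
  have hpt : ∀ g g' : Inst D O, instDist g g' ≤ ENNReal.ofReal ε → ∀ π o,
      (g π o : ℝ) ≤ g' π o + ε ∧ (g' π o : ℝ) ≤ g π o + ε := by
    intro g g' h π o
    have h1 : edist (g π o) (g' π o) ≤ ENNReal.ofReal ε :=
      (le_iSup (fun o => edist (g π o) (g' π o)) o).trans
        ((le_iSup (fun π => densityDist (g π) (g' π)) π).trans h)
    rw [edist_dist, ENNReal.ofReal_le_ofReal_iff hε, NNReal.dist_eq, abs_le] at h1
    constructor <;> linarith [h1.1, h1.2]
  have hrep : ∀ g' ∈ S, rep g' ∈ G ∧ instDist (rep g') g' ≤ ENNReal.ofReal ε := by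
    intro g' hg'
    have h := (Finset.mem_filter.1 hg').2
    simp only [rep, dif_pos h]
    exact h.choose_spec
  refine ⟨S.image rep, fun j hj => ?_, ?_, fun g hg => ?_⟩
  · obtain ⟨g', hg', rfl⟩ := Finset.mem_image.1 hj
    exact (hrep g' hg').1
  · refine Finset.card_image_le.trans ((Finset.card_filter_le _ _).trans (le_of_eq ?_))
    rw [← hcard, hCfin.encard_eq_coe_toFinset_card]
    rfl
  · obtain ⟨g', hg'C, hd⟩ := hC g (hG hg)
    have hg'S : g' ∈ S := Finset.mem_filter.2 ⟨hCfin.mem_toFinset.2 hg'C, g, hg, hd⟩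
    refine ⟨rep g', Finset.mem_image_of_mem _ hg'S, fun π o => ?_⟩
    have h1 := (hpt g g' hd π o).1
    have h2 := (hpt _ _ (hrep g' hg'S).2 π o).2
    rw [← ENNReal.ofReal_coe_nnreal, ← ENNReal.ofReal_coe_nnreal,
      ← ENNReal.ofReal_add (by positivity) (by positivity)]
    exact ENNReal.ofReal_le_ofReal (by linarith)

/-! ### The moment bound -/

theorem lintegral_ratio_rpow_le {ν : Measure O} {R : O → ℝ} {Rmax : ℝ} {F : Set (Inst D O)}
    (hF : IsDecisionProblem ν R Rmax F) (hν : ν Set.univ < ⊤) {f g : Inst D O} (hf : f ∈ F)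
    (hg : g ∈ F) (π : D) {lam d α M : ℝ} (h0 : 0 < lam) (h1 : lam ≤ 1 / 2) (hdα : d ≤ α)
    (haff : affinity ν lam (f π) (g π) ≤ ENNReal.ofReal (Real.exp (-(lam * d)))) :
    ∫⁻ o, (((g π o : ℝ≥0∞) + ENNReal.ofReal (2 * Real.exp (-M))) / f π o) ^ lam ∂(law ν f π) ≤
      ENNReal.ofReal (Real.exp (-(lam * d) +
        2 * ((ν Set.univ).toReal + 1) * Real.exp (lam * (α - M)))) := by
  have hfm : Measurable fun o => (f π o : ℝ≥0∞) :=
    (hF.measurable_density f hf π).coe_nnreal_ennreal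
  have hgm : Measurable fun o => (g π o : ℝ≥0∞) :=
    (hF.measurable_density g hg π).coe_nnreal_ennreal
  set e : ℝ≥0∞ := ENNReal.ofReal (2 * Real.exp (-M)) with he
  set V := (ν Set.univ).toReal + 1 with hV
  have hV0 : 0 ≤ V := by positivity
  have he' : e ^ lam ≤ ENNReal.ofReal (2 * Real.exp (-(lam * M))) := by
    rw [he, ENNReal.ofReal_rpow_of_nonneg (by positivity) h0.le]
    refine ENNReal.ofReal_le_ofReal ?_
    rw [Real.mul_rpow (by norm_num) (by positivity), ← Real.exp_mul]
    have : (2 : ℝ) ^ lam ≤ 2 ^ (1 : ℝ) := Real.rpow_le_rpow_of_exponent_le (by norm_num) (by linarith)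
    rw [Real.rpow_one] at this
    rw [show -M * lam = -(lam * M) by ring]
    gcongr
  -- Subadditivity of the power splits off the envelope's constant. Its coefficient `f^(1-λ) ≤ 1 +
  -- f` has a finite integral because the base measure is finite.
  have hpt : ∀ o, (f π o : ℝ≥0∞) * (((g π o : ℝ≥0∞) + e) / f π o) ^ lam ≤
      (f π o : ℝ≥0∞) ^ (1 - lam) * (g π o : ℝ≥0∞) ^ lam + (1 + f π o) * e ^ lam := by
    intro o
    by_cases hz : f π o = 0
    · simp [hz]
    have hz' : (f π o : ℝ≥0∞) ≠ 0 := by simpa using hz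
    rw [ENNReal.div_rpow_of_nonneg _ _ h0.le]
    have heq : (f π o : ℝ≥0∞) * ((((g π o : ℝ≥0∞) + e) ^ lam) / (f π o : ℝ≥0∞) ^ lam) =
        (f π o : ℝ≥0∞) ^ (1 - lam) * ((g π o : ℝ≥0∞) + e) ^ lam := by
      rw [ENNReal.rpow_sub _ _ hz' (by simp), ENNReal.rpow_one]
      simp only [div_eq_mul_inv]; ring
    rw [heq]
    have hsub : ((g π o : ℝ≥0∞) + e) ^ lam ≤ (g π o : ℝ≥0∞) ^ lam + e ^ lam :=
      ENNReal.rpow_add_le_add_rpow _ _ h0.le (by linarith)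
    have hf1 : (f π o : ℝ≥0∞) ^ (1 - lam) ≤ 1 + f π o := by
      rcases le_total (f π o : ℝ≥0∞) 1 with h | h
      · exact (ENNReal.rpow_le_one h (by linarith)).trans le_self_add
      · calc (f π o : ℝ≥0∞) ^ (1 - lam) ≤ (f π o : ℝ≥0∞) ^ (1 : ℝ) :=
              ENNReal.rpow_le_rpow_of_exponent_le h (by linarith)
          _ ≤ _ := by rw [ENNReal.rpow_one]; exact le_add_self
    calc _ ≤ (f π o : ℝ≥0∞) ^ (1 - lam) * ((g π o : ℝ≥0∞) ^ lam + e ^ lam) := by gcongr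
      _ = (f π o : ℝ≥0∞) ^ (1 - lam) * (g π o : ℝ≥0∞) ^ lam +
          (f π o : ℝ≥0∞) ^ (1 - lam) * e ^ lam := by ring
      _ ≤ _ := by gcongr
  have hVint : ∫⁻ o, (1 + (f π o : ℝ≥0∞)) * e ^ lam ∂ν = ENNReal.ofReal V * e ^ lam := by
    rw [lintegral_mul_const _ (by fun_prop), lintegral_add_left measurable_const,
      hF.lintegral_density f hf π, hV, ENNReal.ofReal_add (by positivity) (by positivity),
      ENNReal.ofReal_toReal hν.ne]
    simp
  have hum : Measurable fun o => (((g π o : ℝ≥0∞) + e) / f π o) ^ lam :=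
    ((hgm.add_const _).div hfm).pow_const _
  unfold law
  rw [lintegral_withDensity_eq_lintegral_mul _ hfm hum]
  calc _ ≤ ∫⁻ o, ((f π o : ℝ≥0∞) ^ (1 - lam) * (g π o : ℝ≥0∞) ^ lam +
        (1 + f π o) * e ^ lam) ∂ν := lintegral_mono hpt
    _ = affinity ν lam (f π) (g π) + ENNReal.ofReal V * e ^ lam := by
        rw [lintegral_add_left (by fun_prop), hVint]; rfl
    _ ≤ ENNReal.ofReal (Real.exp (-(lam * d))) +
        ENNReal.ofReal V * ENNReal.ofReal (2 * Real.exp (-(lam * M))) := by gcongr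
    _ = ENNReal.ofReal (Real.exp (-(lam * d)) + V * (2 * Real.exp (-(lam * M)))) := by
        rw [← ENNReal.ofReal_mul hV0, ← ENNReal.ofReal_add (by positivity) (by positivity)]
    _ ≤ _ := by
      refine ENNReal.ofReal_le_ofReal ?_
      rw [Real.exp_add]
      have h2 : 2 * V * Real.exp (lam * (α - M)) + 1 ≤
          Real.exp (2 * V * Real.exp (lam * (α - M))) := Real.add_one_le_exp _
      -- This is where the truncation level matters: `d ≤ α` lets the discretization error be
      -- absorbed as a relative error `exp (λ (α - M))`.
      have h3 : Real.exp (-(lam * M)) ≤ Real.exp (-(lam * d)) * Real.exp (lam * (α - M)) := by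
        rw [← Real.exp_add, Real.exp_le_exp]
        nlinarith
      calc _ ≤ Real.exp (-(lam * d)) + V * (2 * (Real.exp (-(lam * d)) *
            Real.exp (lam * (α - M)))) := by gcongr
        _ = Real.exp (-(lam * d)) * (2 * V * Real.exp (lam * (α - M)) + 1) := by ring
        _ ≤ _ := by gcongr

/-- Upper envelopes of the instances. -/
def envelope (M : ℝ) (g : Inst D O) (π : D) (o : O) : ℝ≥0∞ :=
  (g π o : ℝ≥0∞) + ENNReal.ofReal (2 * Real.exp (-M))

theorem envelope_ne_zero (M : ℝ) (g : Inst D O) (π : D) (o : O) : envelope M g π o ≠ 0 := by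
  unfold envelope
  have : 0 < ENNReal.ofReal (2 * Real.exp (-M)) := ENNReal.ofReal_pos.2 (by positivity)
  exact ne_of_gt (this.trans_le le_add_self)

/-- The moments of the envelope ratios of a class of alternatives over a fixed list of plays. -/
theorem exists_cover_moment_le {ν : Measure O} {R : O → ℝ} {Rmax : ℝ} {F : Set (Inst D O)}
    (hF : IsDecisionProblem ν R Rmax F) (hν : ν Set.univ < ⊤) {f : Inst D O} (hf : f ∈ F)
    {G : Set (Inst D O)} (hG : G ⊆ F) (N : D → ℕ) {lam ε α M T X : ℝ} (h0 : 0 < lam)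
    (h1 : lam ≤ 1 / 2) (hα : 0 ≤ α)
    (haff : ∀ g ∈ F, ∀ π, affinity ν lam (f π) (g π) ≤
      ENNReal.ofReal (Real.exp (-(lam * truncKL ν ε α f g π))))
    (hfin : coveringNumber F (Real.exp (-M)) ≠ ⊤)
    (hcard : ((coveringNumber F (Real.exp (-M))).toNat : ℝ) ≤ X)
    (hT : ∀ g ∈ G, T ≤ ∑ π, N π * truncKL ν ε α f g π) :
    ∃ J : Finset (Inst D O), (∀ j ∈ J, j ∈ G) ∧
      (∀ g ∈ G, ∃ j ∈ J, ∀ π o, (g π o : ℝ≥0∞) ≤ envelope M j π o) ∧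
      ∑ j ∈ J, ((playList N).map fun π =>
        ∫⁻ o, (envelope M j π o / f π o) ^ lam ∂(law ν f π)).prod ≤
        ENNReal.ofReal (X * Real.exp (-(lam * T) + (∑ π, (N π : ℝ)) *
          (2 * ((ν Set.univ).toReal + 1) * Real.exp (lam * (α - M))))) := by
  obtain ⟨J, hJG, hJc, hJ⟩ := exists_cover hG (Real.exp_pos (-M)).le hfin
  refine ⟨J, hJG, hJ, ?_⟩
  set E := 2 * ((ν Set.univ).toReal + 1) * Real.exp (lam * (α - M)) with hE
  have hX : 0 ≤ X := le_trans (by positivity) hcard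
  have hterm : ∀ j ∈ J, ((playList N).map fun π =>
      ∫⁻ o, (envelope M j π o / f π o) ^ lam ∂(law ν f π)).prod ≤
      ENNReal.ofReal (Real.exp (-(lam * T) + (∑ π, (N π : ℝ)) * E)) := by
    intro j hj
    rw [prod_map_playList]
    calc _ ≤ ∏ π, ENNReal.ofReal (Real.exp (-(lam * truncKL ν ε α f j π) + E)) ^ N π := by
          refine Finset.prod_le_prod' fun π _ => ?_
          gcongr
          exact lintegral_ratio_rpow_le hF hν hf (hG (hJG j hj)) π h0 h1
            (truncKL_le ν ε hα f j π) (haff j (hG (hJG j hj)) π)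
      _ = ENNReal.ofReal (Real.exp (∑ π, (N π : ℝ) * (-(lam * truncKL ν ε α f j π) + E))) := by
          rw [Real.exp_sum, ENNReal.ofReal_prod_of_nonneg fun _ _ => (Real.exp_pos _).le]
          refine Finset.prod_congr rfl fun π _ => ?_
          rw [← ENNReal.ofReal_pow (Real.exp_pos _).le, ← Real.exp_nat_mul]
      _ ≤ _ := by
          refine ENNReal.ofReal_le_ofReal (Real.exp_le_exp.2 ?_)
          have := hT j (hJG j hj)
          have hsum : ∑ π, (N π : ℝ) * (-(lam * truncKL ν ε α f j π) + E) =
              -(lam * ∑ π, (N π : ℝ) * truncKL ν ε α f j π) + (∑ π, (N π : ℝ)) * E := by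
            rw [Finset.mul_sum, Finset.sum_mul, ← Finset.sum_neg_distrib,
              ← Finset.sum_add_distrib]
            exact Finset.sum_congr rfl fun π _ => by ring
          rw [hsum]
          nlinarith
  calc _ ≤ ∑ j ∈ J, ENNReal.ofReal (Real.exp (-(lam * T) + (∑ π, (N π : ℝ)) * E)) :=
        Finset.sum_le_sum hterm
    _ = ENNReal.ofReal J.card * ENNReal.ofReal (Real.exp (-(lam * T) + (∑ π, (N π : ℝ)) * E)) := by
        simp
    _ ≤ ENNReal.ofReal X * ENNReal.ofReal (Real.exp (-(lam * T) + (∑ π, (N π : ℝ)) * E)) := by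
        gcongr
        exact le_trans (by exact_mod_cast hJc) hcard
    _ = _ := by rw [← ENNReal.ofReal_mul hX]

/-! ### The phases of Test-to-Commit -/

theorem value_mono (ν : Measure O) (f : Inst D O) (alg : List O → D) (t : ℕ)
    (φ ψ : List O → ℝ≥0∞) (h : List O)
    (hle : ∀ z : List O, z.length = t → φ (h ++ z) ≤ ψ (h ++ z)) :
    value ν f alg t φ h ≤ value ν f alg t ψ h := by
  induction t generalizing h with
  | zero => simpa [value] using hle [] rfl
  | succ t ih =>
    simp only [value]
    refine lintegral_mono fun o => ih _ fun z hz => ?_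
    simpa using hle (o :: z) (by simpa using hz)

theorem value_const_add {ν : Measure O} {R : O → ℝ} {Rmax : ℝ}
    {F : Set (Inst D O)} (hF : IsDecisionProblem ν R Rmax F) {f : Inst D O} (hf : f ∈ F)
    (alg : List O → D) (t : ℕ) (a : ℝ≥0∞) (φ : List O → ℝ≥0∞) (h : List O) :
    value ν f alg t (fun z => a + φ z) h = a + value ν f alg t φ h := by
  induction t generalizing h with
  | zero => rfl
  | succ t ih =>
    have := hF.isProbabilityMeasure hf (alg h)
    simp only [value, ih]
    rw [lintegral_add_left measurable_const]
    simp

theorem t2c_init (ν : Measure O) (R : O → ℝ) (F : Set (Inst D O)) (n : ℕ)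
    (est : List O → Inst D O) (wt : List O → D → ℝ≥0) (ucb : List (D × O) → D)
    (x : List O) (hx : x.length < (initPlays D n).length) :
    t2c ν R F n est wt ucb x = (initPlays D n)[x.length] := by
  simp only [t2c, dif_pos hx]

theorem t2c_ident (ν : Measure O) (R : O → ℝ) (F : Set (Inst D O)) (n : ℕ)
    (est : List O → Inst D O) (wt : List O → D → ℝ≥0) (ucb : List (D × O) → D)
    (x y : List O) (hx : x.length = (initPlays D n).length)
    (hy : y.length < (identPlays n (wt x)).length) :
    t2c ν R F n est wt ucb (x ++ y) = (identPlays n (wt x))[y.length] := by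
  have h1 : ¬ (x ++ y).length < (initPlays D n).length := by
    rw [List.length_append]; omega
  have ht : (x ++ y).take (initPlays D n).length = x := by rw [← hx, List.take_left]
  have hd : (x ++ y).drop (initPlays D n).length = y := by rw [← hx, List.drop_left]
  simp only [t2c, dif_neg h1, ht, hd, dif_pos hy]

theorem zip_append_right_of_length_eq {α β : Type*} (l : List α) (y z : List β)
    (h : y.length = l.length) : l.zip (y ++ z) = l.zip y := by
  have := List.zip_append (l₁ := l) (l₂ := y) (r₁ := []) (r₂ := z) h.symm
  simpa using this

theorem t2c_commit (ν : Measure O) (R : O → ℝ) (F : Set (Inst D O)) (n : ℕ)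
    (est : List O → Inst D O) (wt : List O → D → ℝ≥0) (ucb : List (D × O) → D)
    (x y z : List O) (hx : x.length = (initPlays D n).length)
    (hy : y.length = (identPlays n (wt x)).length)
    (hacc : Accepts ν R F n (est x) ((identPlays n (wt x)).zip y)) :
    t2c ν R F n est wt ucb (x ++ y ++ z) = best ν R (est x) := by
  have h1 : ¬ (x ++ (y ++ z)).length < (initPlays D n).length := by
    rw [List.length_append]; omega
  have ht : (x ++ (y ++ z)).take (initPlays D n).length = x := by rw [← hx, List.take_left]
  have hd : (x ++ (y ++ z)).drop (initPlays D n).length = y ++ z := by rw [← hx, List.drop_left]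
  have h2 : ¬ ((x ++ (y ++ z)).drop (initPlays D n).length).length <
      (identPlays n (wt ((x ++ (y ++ z)).take (initPlays D n).length))).length := by
    rw [ht, hd, List.length_append]; omega
  have hacc' : Accepts ν R F n (est ((x ++ (y ++ z)).take (initPlays D n).length))
      ((identPlays n (wt ((x ++ (y ++ z)).take (initPlays D n).length))).zip
        ((x ++ (y ++ z)).drop (initPlays D n).length)) := by
    rwa [ht, hd, zip_append_right_of_length_eq _ _ _ hy]
  rw [List.append_assoc]
  simp only [t2c, dif_neg h1]
  rw [dif_neg h2, if_pos hacc', ht]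

theorem t2c_ucb (ν : Measure O) (R : O → ℝ) (F : Set (Inst D O)) (n : ℕ)
    (est : List O → Inst D O) (wt : List O → D → ℝ≥0) (ucb : List (D × O) → D)
    (x y z : List O) (hx : x.length = (initPlays D n).length)
    (hy : y.length = (identPlays n (wt x)).length)
    (hacc : ¬ Accepts ν R F n (est x) ((identPlays n (wt x)).zip y)) :
    t2c ν R F n est wt ucb (x ++ y ++ z) = ucb (ucbHistory ucb z) := by
  have h1 : ¬ (x ++ (y ++ z)).length < (initPlays D n).length := by
    rw [List.length_append]; omega
  have ht : (x ++ (y ++ z)).take (initPlays D n).length = x := by rw [← hx, List.take_left]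
  have hd : (x ++ (y ++ z)).drop (initPlays D n).length = y ++ z := by rw [← hx, List.drop_left]
  have h2 : ¬ ((x ++ (y ++ z)).drop (initPlays D n).length).length <
      (identPlays n (wt ((x ++ (y ++ z)).take (initPlays D n).length))).length := by
    rw [ht, hd, List.length_append]; omega
  have hacc' : ¬ Accepts ν R F n (est ((x ++ (y ++ z)).take (initPlays D n).length))
      ((identPlays n (wt ((x ++ (y ++ z)).take (initPlays D n).length))).zip
        ((x ++ (y ++ z)).drop (initPlays D n).length)) := by
    rwa [ht, hd, zip_append_right_of_length_eq _ _ _ hy]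
  rw [List.append_assoc]
  simp only [t2c, dif_neg h1]
  rw [dif_neg h2, if_neg hacc', ht, hd, ← hy, List.drop_left]

/-- The number of plays of each decision in the second phase. -/
def identCount (n : ℕ) (w : D → ℝ≥0) (π : D) : ℕ :=
  ⌈((1 + 1 / cap n) * w π + 1 / cap n) * Real.log n⌉₊

theorem identPlays_eq (n : ℕ) (w : D → ℝ≥0) : identPlays n w = playList (identCount n w) := rfl

/-- The regret of the second phase. -/
def identCost (ν : Measure O) (R : O → ℝ) (f : Inst D O) (n : ℕ) (w : D → ℝ≥0) : ℝ≥0∞ :=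
  ∑ π, (identCount n w π : ℝ≥0∞) * ENNReal.ofReal (gap ν R f π)

theorem pathRegret_fixed_plays (ν : Measure O) (R : O → ℝ) (f : Inst D O) (alg : List O → D)
    (l : List D) (y : List O) (hy : y.length = l.length)
    (halg : ∀ z : List O, ∀ hz : z.length < l.length, alg z = l[z.length]) :
    pathRegret ν R f alg y = (l.map fun π => ENNReal.ofReal (gap ν R f π)).sum := by
  unfold pathRegret
  rw [hy, Finset.sum_range, ← List.sum_ofFn]
  congr 1
  refine List.ext_getElem (by simp) fun i h1 h2 => ?_
  have hi : i < l.length := by simpa using h1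
  have hlen : (y.take i).length = i := by rw [List.length_take]; omega
  simp only [List.getElem_ofFn, List.getElem_map]
  rw [halg (y.take i) (by omega)]
  simp only [hlen]

/-- The bound on the regret of UCB with horizon `n`. -/
def ucbBound (ν : Measure O) (R : O → ℝ) (Rmax : ℝ) (f : Inst D O) (n : ℕ) : ℝ≥0∞ :=
  ENNReal.ofReal (ucbConst ν R Rmax f * Real.log n + 3 * Fintype.card D * Rmax)

/-- A correct commitment costs nothing, a wrong one at most `n Rmax`, and a rejection the UCB bound.
The charge `b` may depend on the observations, so that callers can make it large exactly when one of
the costly cases occurs. -/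
theorem value_last_phase_le {ν : Measure O} {R : O → ℝ} {Rmax : ℝ}
    {F : Set (Inst D O)} (hF : IsDecisionProblem ν R Rmax F) {f : Inst D O} (hf : f ∈ F)
    {n : ℕ} (hn : 1 ≤ n) {est : List O → Inst D O} {wt : List O → D → ℝ≥0}
    {ucb : List (D × O) → D} (hucb : IsUCB R Rmax n ucb)
    (x y : List O) (hx : x.length = (initPlays D n).length)
    (hy : y.length = (identPlays n (wt x)).length) (r : ℕ) (hr : r ≤ n) (b : ℝ≥0∞)
    (hwrong : Accepts ν R F n (est x) ((identPlays n (wt x)).zip y) →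
      best ν R (est x) ≠ best ν R f → n * ENNReal.ofReal Rmax ≤ b)
    (hrej : ¬ Accepts ν R F n (est x) ((identPlays n (wt x)).zip y) →
      ucbBound ν R Rmax f n ≤ b) :
    value ν f (t2c ν R F n est wt ucb) r (pathRegret ν R f (t2c ν R F n est wt ucb)) (x ++ y) ≤
      pathRegret ν R f (t2c ν R F n est wt ucb) x + identCost ν R f n (wt x) + b := by
  set alg := t2c ν R F n est wt ucb with halg
  have hxy : pathRegret ν R f alg (x ++ y) =
      pathRegret ν R f alg x + identCost ν R f n (wt x) := by
    rw [pathRegret_append, pathRegret_fixed_plays ν R f _ (identPlays n (wt x)) y hy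
      fun z hz => t2c_ident ν R F n est wt ucb x z hx hz, identPlays_eq, sum_map_playList]
    rfl
  rw [← hxy]
  let ψ : List O → ℝ≥0∞ := fun h =>
    pathRegret ν R f (fun z => alg (x ++ y ++ z)) (h.drop (x ++ y).length)
  calc value ν f alg r (pathRegret ν R f alg) (x ++ y)
      ≤ value ν f alg r (fun h => pathRegret ν R f alg (x ++ y) + ψ h) (x ++ y) := by
        refine value_mono _ _ _ _ _ _ _ fun z _ => ?_
        simp only [ψ, List.drop_left]
        rw [pathRegret_append]
    _ = pathRegret ν R f alg (x ++ y) + value ν f alg r ψ (x ++ y) := by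
        rw [value_const_add hF hf]
    _ ≤ _ := by
      gcongr
      by_cases hacc : Accepts ν R F n (est x) ((identPlays n (wt x)).zip y)
      · have halg' : (fun z => alg (x ++ y ++ z)) = fun _ => best ν R (est x) :=
          funext fun z => t2c_commit ν R F n est wt ucb x y z hx hy hacc
        refine value_le_of_supermartingale ν f alg r ψ (fun _ => b) (x ++ y) (fun z _ => ?_)
          fun z hz => ?_
        · have := hF.isProbabilityMeasure hf (alg (x ++ y ++ z))
          rw [lintegral_const, measure_univ, mul_one]
        · simp only [ψ, List.drop_left]
          by_cases hb : best ν R (est x) = best ν R f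
          · rw [halg', hb]
            simp [pathRegret, gap_best]
          · refine (pathRegret_le hF hf _ z).trans (le_trans ?_ (hwrong hacc hb))
            have : (z.length : ℝ≥0∞) ≤ n := by exact_mod_cast hz.le.trans hr
            gcongr
      · refine le_trans (value_ucb_le hF hf hn hucb alg (x ++ y)
          (fun z => t2c_ucb ν R F n est wt ucb x y z hx hy hacc) r hr ψ fun z _ => ?_) (hrej hacc)
        simp only [ψ, List.drop_left]
        exact le_rfl

/-- The regret after the first phase when the estimate identifies the best decision. -/
theorem value_second_phase_le_of_good {ν : Measure O} {R : O → ℝ} {Rmax : ℝ}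
    {F : Set (Inst D O)} (hF : IsDecisionProblem ν R Rmax F) {f : Inst D O} (hf : f ∈ F)
    {n : ℕ} (hn : 1 ≤ n) {est : List O → Inst D O} {wt : List O → D → ℝ≥0}
    {ucb : List (D × O) → D} (hucb : IsUCB R Rmax n ucb)
    (x : List O) (hx : x.length = (initPlays D n).length)
    (hlen : (initPlays D n).length + (identPlays n (wt x)).length ≤ n)
    (hbest : best ν R (est x) = best ν R f)
    {ι : Type*} (J : Finset ι) (u : ι → D → O → ℝ≥0∞) (hu : ∀ j ∈ J, ∀ π, Measurable (u j π))
    (c p : ℝ≥0∞)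
    (hrej : ∀ y : List O, y.length = (identPlays n (wt x)).length →
      ¬ Accepts ν R F n (est x) ((identPlays n (wt x)).zip y) →
      1 ≤ c * ∑ j ∈ J, (((identPlays n (wt x)).zip y).map fun p => u j p.1 p.2).prod)
    (hp : c * ∑ j ∈ J, ((identPlays n (wt x)).map fun π => ∫⁻ o, u j π o ∂(law ν f π)).prod ≤ p) :
    value ν f (t2c ν R F n est wt ucb) (n - (initPlays D n).length)
        (pathRegret ν R f (t2c ν R F n est wt ucb)) x ≤
      pathRegret ν R f (t2c ν R F n est wt ucb) x + identCost ν R f n (wt x) +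
        ucbBound ν R Rmax f n * p := by
  set alg := t2c ν R F n est wt ucb with halg
  obtain ⟨r, hr⟩ : ∃ r, n - (initPlays D n).length = (identPlays n (wt x)).length + r :=
    ⟨n - (initPlays D n).length - (identPlays n (wt x)).length, by omega⟩
  rw [hr, value_add]
  -- The UCB bound is multiplied by a quantity that is at least one upon rejection and whose mean is
  -- at most `p`; the rejection event itself need not be measurable.
  refine (value_fixed_plays_le hF hf alg (identPlays n (wt x)) x
    (fun z hz => t2c_ident ν R F n est wt ucb x z hx hz) J u hu
    (pathRegret ν R f alg x + identCost ν R f n (wt x)) (ucbBound ν R Rmax f n * c) _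
    fun y hy => ?_).trans ?_
  · refine value_last_phase_le hF hf hn hucb x y hx hy r (by omega) _
      (fun _ hne => absurd hbest hne) fun hnacc => ?_
    rw [mul_assoc]
    exact le_mul_of_one_le_right' (hrej y hy hnacc)
  · rw [mul_assoc]
    gcongr

/-- The mean is the mass of `g` on the support of `f`, hence possibly less than one. -/
theorem lintegral_ratio_le_one {ν : Measure O} {R : O → ℝ} {Rmax : ℝ}
    {F : Set (Inst D O)} (hF : IsDecisionProblem ν R Rmax F) {f g : Inst D O} (hf : f ∈ F)
    (hg : g ∈ F) (π : D) :
    ∫⁻ o, (g π o : ℝ≥0∞) / f π o ∂(law ν f π) ≤ 1 := by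
  have hfm : Measurable fun o => (f π o : ℝ≥0∞) :=
    (hF.measurable_density f hf π).coe_nnreal_ennreal
  have hgm : Measurable fun o => (g π o : ℝ≥0∞) :=
    (hF.measurable_density g hg π).coe_nnreal_ennreal
  unfold law
  rw [lintegral_withDensity_eq_lintegral_mul _ hfm (hgm.fun_div hfm), ← hF.lintegral_density g hg π]
  refine lintegral_mono fun o => ?_
  simp only [Pi.mul_apply]
  exact ENNReal.mul_div_le

/-- The regret after the first phase in general. -/
theorem value_second_phase_le {ν : Measure O} {R : O → ℝ} {Rmax : ℝ}
    {F : Set (Inst D O)} (hF : IsDecisionProblem ν R Rmax F) {f : Inst D O} (hf : f ∈ F)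
    {n : ℕ} (hn : 1 ≤ n) {est : List O → Inst D O} {wt : List O → D → ℝ≥0}
    {ucb : List (D × O) → D} (hucb : IsUCB R Rmax n ucb)
    (x : List O) (hx : x.length = (initPlays D n).length)
    (hlen : (initPlays D n).length + (identPlays n (wt x)).length ≤ n)
    (hest : est x ∈ F) :
    value ν f (t2c ν R F n est wt ucb) (n - (initPlays D n).length)
        (pathRegret ν R f (t2c ν R F n est wt ucb)) x ≤
      pathRegret ν R f (t2c ν R F n est wt ucb) x + identCost ν R f n (wt x) +
        ucbBound ν R Rmax f n + ENNReal.ofReal Rmax := by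
  set alg := t2c ν R F n est wt ucb with halg
  obtain ⟨r, hr⟩ : ∃ r, n - (initPlays D n).length = (identPlays n (wt x)).length + r :=
    ⟨n - (initPlays D n).length - (identPlays n (wt x)).length, by omega⟩
  have hfm : ∀ π, Measurable fun o => (est x π o : ℝ≥0∞) / f π o := fun π =>
    (hF.measurable_density _ hest π).coe_nnreal_ennreal.div
      (hF.measurable_density f hf π).coe_nnreal_ennreal
  rw [hr, value_add]
  refine (value_fixed_plays_le hF hf alg (identPlays n (wt x)) x
    (fun z hz => t2c_ident ν R F n est wt ucb x z hx hz) {()}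
    (fun _ π o => (est x π o : ℝ≥0∞) / f π o) (fun _ _ π => hfm π)
    (pathRegret ν R f alg x + identCost ν R f n (wt x) + ucbBound ν R Rmax f n)
    (ENNReal.ofReal Rmax) _ fun y hy => ?_).trans ?_
  · rw [add_assoc (pathRegret ν R f alg x + identCost ν R f n (wt x))]
    refine value_last_phase_le hF hf hn hucb x y hx hy r (by omega) _
      (fun hacc hne => le_trans ?_ le_add_self) fun _ => le_self_add
    -- When the estimate has a different best decision, the true instance is one of the tested
    -- alternatives, so acceptance forces this likelihood ratio to be at least `n`.
    have := (le_logLikRatio_iff hn _ _ _).1 (hacc f hf (Ne.symm hne))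
    rw [Finset.sum_singleton, mul_comm]
    gcongr
  · have : ((identPlays n (wt x)).map fun π =>
        ∫⁻ o, (est x π o : ℝ≥0∞) / f π o ∂(law ν f π)).prod ≤ 1 := by
      rw [identPlays_eq, prod_map_playList]
      exact Finset.prod_le_one' fun π _ => pow_le_one₀ zero_le (lintegral_ratio_le_one hF hf hest π)
    rw [Finset.sum_singleton]
    gcongr
    exact mul_le_of_le_one_right' this

/-- The regret of Test-to-Commit, given bounds for the regret after the first phase. -/
theorem ofReal_regret_t2c_le {ν : Measure O} {R : O → ℝ} {Rmax : ℝ}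
    {F : Set (Inst D O)} (hF : IsDecisionProblem ν R Rmax F) {f : Inst D O} (hf : f ∈ F)
    {n : ℕ} {est : List O → Inst D O} {wt : List O → D → ℝ≥0}
    {ucb : List (D × O) → D} (hlen : (initPlays D n).length ≤ n)
    {ι : Type*} (J : Finset ι) (u : ι → D → O → ℝ≥0∞) (hu : ∀ j ∈ J, ∀ π, Measurable (u j π))
    (a c : ℝ≥0∞)
    (hx : ∀ x : List O, x.length = (initPlays D n).length →
      value ν f (t2c ν R F n est wt ucb) (n - (initPlays D n).length)
        (pathRegret ν R f (t2c ν R F n est wt ucb)) x ≤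
      pathRegret ν R f (t2c ν R F n est wt ucb) x + (a +
        c * ∑ j ∈ J, (((initPlays D n).zip x).map fun p => u j p.1 p.2).prod)) :
    ENNReal.ofReal (regret ν R f (t2c ν R F n est wt ucb) n) ≤
      (initPlays D n).length * ENNReal.ofReal Rmax + a +
        c * ∑ j ∈ J, ((initPlays D n).map fun π => ∫⁻ o, u j π o ∂(law ν f π)).prod := by
  refine (ofReal_regret_le_value ν R f _ n).trans ?_
  set alg := t2c ν R F n est wt ucb with halg
  obtain ⟨r, hr⟩ : ∃ r, n = (initPlays D n).length + r :=
    ⟨n - (initPlays D n).length, by omega⟩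
  have hr' : n - (initPlays D n).length = r := by omega
  rw [hr'] at hx
  calc value ν f alg n (pathRegret ν R f alg) []
      = value ν f alg (initPlays D n).length (value ν f alg r (pathRegret ν R f alg)) [] := by
        rw [← value_add, ← hr]
    _ ≤ _ := by
      refine value_fixed_plays_le hF hf alg (initPlays D n) []
        (fun z hz => t2c_init ν R F n est wt ucb z hz) J u hu _ c _ fun z hz => ?_
      rw [List.nil_append]
      refine (hx z hz).trans ?_
      rw [← add_assoc]
      gcongr
      rw [← hz]
      exact pathRegret_le hF hf alg z

/-! ### Instances close to the truth -/

theorem cost_eq_ofReal (ν : Measure O) (R : O → ℝ) (f : Inst D O) (w : D → ℝ≥0) :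
    cost ν R f w = ENNReal.ofReal (∑ π, (w π : ℝ) * gap ν R f π) := by
  unfold cost
  rw [ENNReal.ofReal_sum_of_nonneg fun π _ => mul_nonneg (w π).coe_nonneg (gap_nonneg _ _ _ _)]
  refine Finset.sum_congr rfl fun π _ => ?_
  rw [ENNReal.ofReal_mul (w π).coe_nonneg, ENNReal.ofReal_coe_nnreal]

/-- `f` is within `r` of `f₀` in sup-distance. -/
def SupClose (f₀ f : Inst D O) (r : ℝ) : Prop :=
  ∀ π, densityDist (f₀ π) (f π) ≤ ENNReal.ofReal r

/-- On the support, `f ≥ (1 - η) f₀`, and `(1 + 2η)(1 - η) ≥ 1` for `η ≤ 1/2`. Replacing the truth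
by the estimate thus costs at most `exp (2η)` per observation. -/
theorem SupClose.le_mul {f₀ f : Inst D O} {cmin η : ℝ} (hcmin : 0 < cmin)
    (hmin : ∀ π o, f₀ π o ≠ 0 → cmin < f₀ π o) (hη : 0 ≤ η) (hη1 : η ≤ 1 / 2)
    (h : SupClose f₀ f (cmin * η)) (π : D) (o : O) (h0 : f₀ π o ≠ 0) :
    (f₀ π o : ℝ≥0∞) ≤ ENNReal.ofReal (1 + 2 * η) * f π o := by
  have h1 := (le_iSup (fun o => edist (f₀ π o) (f π o)) o).trans (h π)
  rw [edist_dist, ENNReal.ofReal_le_ofReal_iff (by positivity), NNReal.dist_eq] at h1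
  have h2 := (abs_le.1 h1).2
  have h3 := hmin π o h0
  rw [← ENNReal.ofReal_coe_nnreal, ← ENNReal.ofReal_coe_nnreal, ← ENNReal.ofReal_mul (by positivity)]
  refine ENNReal.ofReal_le_ofReal ?_
  have h4 : (f₀ π o : ℝ) * (1 - η) ≤ f π o := by nlinarith
  have h5 : (0 : ℝ) ≤ f₀ π o := (f₀ π o).coe_nonneg
  calc (f₀ π o : ℝ) ≤ (1 + 2 * η) * ((f₀ π o : ℝ) * (1 - η)) := by
        have : 0 ≤ (f₀ π o : ℝ) * (η * (1 - 2 * η)) :=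
          mul_nonneg h5 (mul_nonneg hη (by linarith))
        nlinarith
    _ ≤ _ := by gcongr

/-- A feasible point for `f₀`, slightly enlarged, is feasible for a relative perturbation of `f₀`. -/
theorem Feasible.of_relClose {ν : Measure O} {R : O → ℝ} {Rmax : ℝ} {F : Set (Inst D O)}
    (hF : IsDecisionProblem ν R Rmax F) {f₀ f : Inst D O} (hf₀ : f₀ ∈ F) (hf : f ∈ F)
    {η : ℝ} (hη : 0 ≤ η) (hη1 : η < 1) (hrel : RelClose ν f₀ f η)
    (hbest : best ν R f = best ν R f₀) {B B' : ℝ} {w : D → ℝ≥0} (hw : Feasible ν R F f₀ B w)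
    {θ : ℝ≥0} (hθ : 1 ≤ (1 + θ : ℝ) * (1 - η - 2 * η * ∑ π, (w π : ℝ)))
    (hcap : ∀ π, (1 + θ : ℝ) * w π ≤ B') :
    Feasible ν R F f B' (fun π => (1 + θ) * w π) := by
  refine ⟨fun g hg hgf => ?_, fun π => by push_cast; exact hcap π⟩
  rw [hbest] at hgf
  have h1 := hw.1 g hg hgf
  set W := ∑ π, (w π : ℝ) with hW
  have hW0 : 0 ≤ W := Finset.sum_nonneg fun π _ => (w π).coe_nonneg
  have hsum : ENNReal.ofReal (1 - η) ≤
      (∑ π, (w π : ℝ≥0∞) * kl ν f g π) + ENNReal.ofReal (2 * η * W) := by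
    calc ENNReal.ofReal (1 - η) ≤ ENNReal.ofReal (1 - η) * ∑ π, (w π : ℝ≥0∞) * kl ν f₀ g π :=
          le_mul_of_one_le_right' h1
      _ = ∑ π, (w π : ℝ≥0∞) * (ENNReal.ofReal (1 - η) * kl ν f₀ g π) := by
          rw [Finset.mul_sum]; exact Finset.sum_congr rfl fun π _ => by ring
      _ ≤ ∑ π, (w π : ℝ≥0∞) * (kl ν f g π + ENNReal.ofReal (2 * η)) := by
          gcongr with π
          exact hrel.le_kl hF hf₀ hf hg hη hη1 π
      _ = _ := by
          simp_rw [mul_add]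
          rw [Finset.sum_add_distrib, ← Finset.sum_mul, mul_comm (2 * η) W,
            ENNReal.ofReal_mul hW0, hW,
            ENNReal.ofReal_sum_of_nonneg fun π _ => (w π).coe_nonneg]
          simp
  have hsub : ENNReal.ofReal (1 - η - 2 * η * W) ≤ ∑ π, (w π : ℝ≥0∞) * kl ν f g π := by
    rw [ENNReal.ofReal_sub _ (by positivity)]
    exact tsub_le_iff_right.2 hsum
  calc (1 : ℝ≥0∞) ≤ ENNReal.ofReal ((1 + θ : ℝ) * (1 - η - 2 * η * W)) := by
        rw [← ENNReal.ofReal_one]; exact ENNReal.ofReal_le_ofReal hθ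
    _ = (1 + θ) * ENNReal.ofReal (1 - η - 2 * η * W) := by
        rw [ENNReal.ofReal_mul (by positivity),
          ENNReal.ofReal_add (by norm_num) (by positivity)]
        simp
    _ ≤ (1 + θ) * ∑ π, (w π : ℝ≥0∞) * kl ν f g π := by gcongr
    _ = _ := by
        rw [Finset.mul_sum]
        exact Finset.sum_congr rfl fun π _ => by push_cast; ring

/-- The alternatives that the second phase with weights `w` distinguishes from `f₀`. -/
def Separated (ν : Measure O) (F : Set (Inst D O)) (f₀ : Inst D O) (b : ℝ) (w : D → ℝ≥0) :
    Set (Inst D O) :=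
  {g ∈ F | ENNReal.ofReal (1 - 1 / (4 * b)) ≤ ∑ π, (w π : ℝ≥0∞) * kl ν f₀ g π}

/-- The weights sum to at most `K b`, so passing from `f` to `f₀` loses an additive `4 η K b ≤ 1 /
(16 b)` and a factor `1 + η`. This restates feasibility for the estimate as information under the
true law, where the moment bounds hold. -/
theorem mem_separated_of_feasible {ν : Measure O} {R : O → ℝ} {Rmax : ℝ} {F : Set (Inst D O)}
    (hF : IsDecisionProblem ν R Rmax F) {f₀ f : Inst D O} (hf₀ : f₀ ∈ F) (hf : f ∈ F)
    {η b : ℝ} (hη : 0 ≤ η) (hb : 1 ≤ b) (hηb : 64 * Fintype.card D * b ^ 2 * η ≤ 1)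
    (hrel : RelClose ν f₀ f η) {w : D → ℝ≥0} (hw : Feasible ν R F f b w) {g : Inst D O}
    (hg : g ∈ F) (hne : best ν R g ≠ best ν R f) :
    g ∈ Separated ν F f₀ b w := by
  refine ⟨hg, ?_⟩
  have hK : (1 : ℝ) ≤ Fintype.card D := by exact_mod_cast Fintype.card_pos
  set K : ℝ := (Fintype.card D : ℝ) with hKdef
  have hη' : 64 * b * (K * (b * η)) ≤ 1 := by nlinarith
  have hKb : η ≤ K * (b * η) := by nlinarith [mul_nonneg (sub_nonneg.2 hK) (by positivity : 0 ≤ b * η), mul_nonneg (sub_nonneg.2 hb) hη]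
  have hη1 : η < 1 := by nlinarith
  set S := ∑ π, (w π : ℝ≥0∞) * kl ν f₀ g π with hS
  rcases eq_or_ne S ⊤ with ht | ht
  · rw [ht]; exact le_top
  set W := ∑ π, (w π : ℝ) with hW
  have hW0 : 0 ≤ W := Finset.sum_nonneg fun π _ => (w π).coe_nonneg
  have hWb : W ≤ K * b := by
    calc W ≤ ∑ _π : D, b := Finset.sum_le_sum fun π _ => hw.2 π
      _ = K * b := by simp [hKdef]
  have h1 : 1 ≤ ENNReal.ofReal (1 + η) * S + ENNReal.ofReal (4 * η * W) := by
    calc (1 : ℝ≥0∞) ≤ ∑ π, (w π : ℝ≥0∞) * kl ν f g π := hw.1 g hg hne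
      _ ≤ ∑ π, (w π : ℝ≥0∞) * (ENNReal.ofReal (1 + η) * kl ν f₀ g π + ENNReal.ofReal (4 * η)) := by
          gcongr with π
          exact hrel.kl_le hF hf₀ hf hg hη hη1 π
      _ = _ := by
          simp_rw [mul_add]
          rw [Finset.sum_add_distrib, ← Finset.sum_mul, mul_comm (4 * η) W,
            ENNReal.ofReal_mul hW0, hW,
            ENNReal.ofReal_sum_of_nonneg fun π _ => (w π).coe_nonneg, hS, Finset.mul_sum]
          congr 1
          · exact Finset.sum_congr rfl fun π _ => by ring
          · simp
  rw [← ENNReal.ofReal_toReal ht, ← ENNReal.ofReal_mul (by positivity),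
    ← ENNReal.ofReal_add (by positivity) (by positivity), ← ENNReal.ofReal_one,
    ENNReal.ofReal_le_ofReal_iff (by positivity)] at h1
  rw [← ENNReal.ofReal_toReal ht]
  refine ENNReal.ofReal_le_ofReal ?_
  have h2 : 4 * η * W ≤ 4 * (K * (b * η)) := by nlinarith
  set y := K * (b * η) with hy
  have hy' : y ≤ 1 / (64 * b) := by
    rw [le_div_iff₀ (by positivity)]; linarith
  have hq : (1 : ℝ) / (64 * b) = (1 / (4 * b)) / 16 := by field_simp; norm_num
  set q := 1 / (4 * b) with hqdef
  have hq0 : 0 < q := by positivity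
  by_contra hcon
  push Not at hcon
  nlinarith [ENNReal.toReal_nonneg (a := S)]

/-! ### Length, information and cost of the second phase -/

theorem le_identCount {n : ℕ} (w : D → ℝ≥0) (π : D) :
    ((1 + 1 / cap n) * w π + 1 / cap n) * Real.log n ≤ identCount n w π :=
  Nat.le_ceil _

theorem identCount_le {n : ℕ} (hcap : 0 < cap n) (w : D → ℝ≥0) (π : D) :
    (identCount n w π : ℝ) ≤ ((1 + 1 / cap n) * w π + 1 / cap n) * Real.log n + 1 :=
  (Nat.ceil_lt_add_one (mul_nonneg (by positivity) (Real.log_natCast_nonneg n))).le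

/-- The information collected in the second phase about the separated alternatives. -/
theorem le_sum_identCount_mul_truncKL {ν : Measure O} {F : Set (Inst D O)} {f₀ g : Inst D O}
    {n : ℕ} (hb : 2 ≤ cap n) {w : D → ℝ≥0} (hw : ∀ π, (w π : ℝ) ≤ cap n)
    (hg : g ∈ Separated ν F f₀ (cap n) w) :
    (1 + 1 / (4 * cap n)) * Real.log n ≤ ∑ π, (identCount n w π : ℝ) *
      truncKL ν (1 / (4 * Fintype.card D * cap n ^ 2)) (2 * cap n) f₀ g π := by
  set b := cap n with hbdef
  set L := Real.log n with hLdef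
  have hL : 0 ≤ L := Real.log_natCast_nonneg n
  have hK : (1 : ℝ) ≤ Fintype.card D := by exact_mod_cast Fintype.card_pos
  set K : ℝ := (Fintype.card D : ℝ) with hKdef
  set ε := 1 / (4 * K * b ^ 2) with hε
  have hb0 : 0 < b := by linarith
  have hε0 : 0 < ε := by positivity
  have hnn : ∀ π, 0 ≤ (identCount n w π : ℝ) * truncKL ν ε (2 * b) f₀ g π := fun π =>
    mul_nonneg (by positivity) (truncKL_nonneg _ _ _ _ _ _)
  -- A divergence reaching the truncation level `2 b` is handled by the extra `ln n / b` plays of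
  -- every decision, which alone give `2 ln n`. Otherwise all divergences are finite and the
  -- truncation removes only `ε`.
  by_cases hbig : ∃ π, ENNReal.ofReal (2 * b) ≤ kl ν f₀ g π - ENNReal.ofReal ε
  · obtain ⟨π, hπ⟩ := hbig
    have htr : truncKL ν ε (2 * b) f₀ g π = 2 * b := by
      unfold truncKL
      rw [min_eq_right hπ, ENNReal.toReal_ofReal (by positivity)]
    have hN : 1 / b * L ≤ identCount n w π := by
      refine le_trans ?_ (le_identCount w π)
      rw [← hbdef, ← hLdef]
      have : 0 ≤ (1 + 1 / b) * (w π : ℝ) := by positivity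
      gcongr
      linarith
    calc (1 + 1 / (4 * b)) * L ≤ 2 * L := by
          have : 1 / (4 * b) ≤ 1 := by
            rw [div_le_one (by positivity)]; linarith
          nlinarith
      _ = (1 / b * L) * (2 * b) := by field_simp
      _ ≤ identCount n w π * truncKL ν ε (2 * b) f₀ g π := by rw [htr]; gcongr
      _ ≤ _ := Finset.single_le_sum
          (f := fun π => (identCount n w π : ℝ) * truncKL ν ε (2 * b) f₀ g π)
          (fun π _ => hnn π) (Finset.mem_univ π)
  · push Not at hbig
    have hfin : ∀ π, kl ν f₀ g π ≠ ⊤ := by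
      intro π ht
      have := hbig π
      rw [ht, ENNReal.top_sub (by simp)] at this
      exact absurd this not_top_lt
    have htr : ∀ π, (kl ν f₀ g π).toReal - ε ≤ truncKL ν ε (2 * b) f₀ g π := by
      intro π
      unfold truncKL
      rw [min_eq_left (hbig π).le]
      have := ENNReal.le_toReal_sub (a := kl ν f₀ g π) (b := ENNReal.ofReal ε) (by simp)
      rwa [ENNReal.toReal_ofReal hε0.le] at this
    have hS : 1 - 1 / (4 * b) ≤ ∑ π, (w π : ℝ) * (kl ν f₀ g π).toReal := by
      have h2 := hg.2
      have : ∑ π, (w π : ℝ≥0∞) * kl ν f₀ g π =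
          ENNReal.ofReal (∑ π, (w π : ℝ) * (kl ν f₀ g π).toReal) := by
        rw [ENNReal.ofReal_sum_of_nonneg fun π _ =>
          mul_nonneg (w π).coe_nonneg ENNReal.toReal_nonneg]
        refine Finset.sum_congr rfl fun π _ => ?_
        rw [ENNReal.ofReal_mul (w π).coe_nonneg, ENNReal.ofReal_coe_nnreal,
          ENNReal.ofReal_toReal (hfin π)]
      rw [this, ENNReal.ofReal_le_ofReal_iff (Finset.sum_nonneg fun π _ =>
          mul_nonneg (w π).coe_nonneg ENNReal.toReal_nonneg)] at h2
      exact h2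
    have hterm : ∀ π, (1 + 1 / b) * L * (w π * ((kl ν f₀ g π).toReal - ε)) ≤
        (identCount n w π : ℝ) * truncKL ν ε (2 * b) f₀ g π := by
      intro π
      have hN : (1 + 1 / b) * w π * L ≤ identCount n w π := by
        refine le_trans ?_ (le_identCount w π)
        rw [← hbdef, ← hLdef]
        have : 0 ≤ 1 / b := by positivity
        gcongr
        linarith
      calc _ = ((1 + 1 / b) * w π * L) * ((kl ν f₀ g π).toReal - ε) := by ring
        _ ≤ ((1 + 1 / b) * w π * L) * truncKL ν ε (2 * b) f₀ g π := by
            gcongr; exact htr π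
        _ ≤ _ := by
            gcongr; exact truncKL_nonneg _ _ _ _ _ _
    have hW : ∑ π, (w π : ℝ) ≤ K * b := by
      calc ∑ π, (w π : ℝ) ≤ ∑ _π : D, b := Finset.sum_le_sum fun π _ => hw π
        _ = K * b := by simp [hKdef]
    have hWε : ε * ∑ π, (w π : ℝ) ≤ 1 / (4 * b) := by
      calc ε * ∑ π, (w π : ℝ) ≤ ε * (K * b) := by gcongr
        _ = 1 / (4 * b) := by rw [hε]; field_simp
    -- One loss of `1 / (4b)` comes from near-feasibility, the other from `ε` times the total
    -- weight. The inflation `1 + 1/b` outweighs both exactly when `b ≥ 2`.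
    calc (1 + 1 / (4 * b)) * L ≤ (1 + 1 / b) * L * (1 - 1 / (4 * b) - 1 / (4 * b)) := by
          have : (1 + 1 / b) * (1 - 1 / (4 * b) - 1 / (4 * b)) - (1 + 1 / (4 * b)) =
              (b - 2) / (4 * b ^ 2) := by field_simp; ring
          have h2 : 0 ≤ (b - 2) / (4 * b ^ 2) := div_nonneg (by linarith) (by positivity)
          nlinarith
      _ ≤ (1 + 1 / b) * L * (∑ π, (w π : ℝ) * (kl ν f₀ g π).toReal - ε * ∑ π, (w π : ℝ)) := by
          gcongr
      _ = ∑ π, (1 + 1 / b) * L * (w π * ((kl ν f₀ g π).toReal - ε)) := by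
          rw [← Finset.mul_sum, Finset.mul_sum Finset.univ _ ε, ← Finset.sum_sub_distrib]
          congr 1
          exact Finset.sum_congr rfl fun π _ => by ring
      _ ≤ _ := Finset.sum_le_sum fun π _ => hterm π

/-- An upper bound for the number of rounds of the second phase. -/
def identBound (D : Type*) [Fintype D] (n : ℕ) : ℝ :=
  Fintype.card D * ((cap n + 1 + 1 / cap n) * Real.log n + 1)

theorem sum_identCount_le {n : ℕ} (hb : 0 < cap n) {w : D → ℝ≥0} (hw : ∀ π, (w π : ℝ) ≤ cap n) :
    ∑ π, (identCount n w π : ℝ) ≤ identBound D n := by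
  have hL : 0 ≤ Real.log n := Real.log_natCast_nonneg n
  calc ∑ π, (identCount n w π : ℝ) ≤
        ∑ _π : D, ((cap n + 1 + 1 / cap n) * Real.log n + 1) := by
        refine Finset.sum_le_sum fun π _ => (identCount_le hb w π).trans ?_
        gcongr
        calc (1 + 1 / cap n) * (w π : ℝ) ≤ (1 + 1 / cap n) * cap n := by gcongr; exact hw π
          _ = cap n + 1 := by field_simp
    _ = _ := by simp [identBound]; ring

theorem identCost_le {ν : Measure O} {R : O → ℝ} {Rmax : ℝ} {F : Set (Inst D O)}
    (hF : IsDecisionProblem ν R Rmax F) {f : Inst D O} (hf : f ∈ F) {n : ℕ} (hb : 0 < cap n)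
    {w : D → ℝ≥0} (hw : ∀ π, (w π : ℝ) ≤ cap n) :
    identCost ν R f n w ≤ ENNReal.ofReal (identBound D n * Rmax) := by
  have hR := hF.Rmax_nonneg hf
  unfold identCost
  calc _ ≤ ∑ π, (identCount n w π : ℝ≥0∞) * ENNReal.ofReal Rmax := by
        gcongr with π
        exact hF.gap_le hf π
    _ = ENNReal.ofReal ((∑ π, (identCount n w π : ℝ)) * Rmax) := by
        rw [ENNReal.ofReal_mul (by positivity),
          ENNReal.ofReal_sum_of_nonneg fun _ _ => by positivity, Finset.sum_mul]
        simp
    _ ≤ _ := by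
        refine ENNReal.ofReal_le_ofReal ?_
        gcongr
        exact sum_identCount_le hb hw

theorem identCost_le_of_sum_le {ν : Measure O} {R : O → ℝ} {Rmax : ℝ} {F : Set (Inst D O)}
    (hF : IsDecisionProblem ν R Rmax F) {f : Inst D O} (hf : f ∈ F) {n : ℕ} (hb : 0 < cap n)
    {w : D → ℝ≥0} {A : ℝ} (hA : ∑ π, (w π : ℝ) * gap ν R f π ≤ A) :
    identCost ν R f n w ≤ ENNReal.ofReal ((1 + 1 / cap n) * Real.log n * A +
      Fintype.card D * Rmax * (1 / cap n * Real.log n + 1)) := by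
  have hR := hF.Rmax_nonneg hf
  have hL : 0 ≤ Real.log n := Real.log_natCast_nonneg n
  have heq : identCost ν R f n w =
      ENNReal.ofReal (∑ π, (identCount n w π : ℝ) * gap ν R f π) := by
    rw [ENNReal.ofReal_sum_of_nonneg fun π _ => mul_nonneg (by positivity) (gap_nonneg _ _ _ _)]
    refine Finset.sum_congr rfl fun π _ => ?_
    rw [ENNReal.ofReal_mul (by positivity)]
    simp
  rw [heq]
  refine ENNReal.ofReal_le_ofReal ?_
  calc ∑ π, (identCount n w π : ℝ) * gap ν R f π
      ≤ ∑ π, ((1 + 1 / cap n) * Real.log n * (w π * gap ν R f π) +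
          Rmax * (1 / cap n * Real.log n + 1)) := by
        refine Finset.sum_le_sum fun π _ => ?_
        have h1 := identCount_le hb w π
        have h2 := gap_nonneg ν R f π
        have h3 := hF.gap_le hf π
        calc (identCount n w π : ℝ) * gap ν R f π
            ≤ (((1 + 1 / cap n) * w π + 1 / cap n) * Real.log n + 1) * gap ν R f π := by gcongr
          _ = (1 + 1 / cap n) * Real.log n * (w π * gap ν R f π) +
              (1 / cap n * Real.log n + 1) * gap ν R f π := by ring
          _ ≤ (1 + 1 / cap n) * Real.log n * (w π * gap ν R f π) +
              (1 / cap n * Real.log n + 1) * Rmax := by gcongr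
          _ = _ := by ring
    _ = (1 + 1 / cap n) * Real.log n * ∑ π, (w π : ℝ) * gap ν R f π +
          Fintype.card D * Rmax * (1 / cap n * Real.log n + 1) := by
        rw [Finset.sum_add_distrib, ← Finset.mul_sum]
        simp; ring
    _ ≤ _ := by gcongr

/-! ### The regret at a fixed horizon -/

/-- The weights computed for an instance close to the truth are nearly optimal for the truth. -/
theorem sum_weights_gap_le {ν : Measure O} {R : O → ℝ} {Rmax : ℝ} {F : Set (Inst D O)}
    (hF : IsDecisionProblem ν R Rmax F) {f₀ f : Inst D O} (hf₀ : f₀ ∈ F) (hf : f ∈ F)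
    {η s : ℝ} (hη : 0 ≤ η) (hη1 : η < 1) (hrel : RelClose ν f₀ f η)
    (hbest : best ν R f = best ν R f₀)
    (hgap : ∀ π, |gap ν R f π - gap ν R f₀ π| ≤ 2 * s) {B b tol : ℝ} (htol : 0 ≤ tol)
    {w ŵ : D → ℝ≥0} (hw : Feasible ν R F f₀ B w)
    {θ : ℝ≥0} (hθ : 1 ≤ (1 + θ : ℝ) * (1 - η - 2 * η * ∑ π, (w π : ℝ)))
    (hcap : ∀ π, (1 + θ : ℝ) * w π ≤ b) (hŵb : ∀ π, (ŵ π : ℝ) ≤ b)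
    (hŵ : cost ν R f ŵ ≤ complexityAt ν R F f b + ENNReal.ofReal tol) :
    ∑ π, (ŵ π : ℝ) * gap ν R f₀ π ≤
      (1 + θ) * (∑ π, (w π : ℝ) * gap ν R f₀ π + 2 * s * ∑ π, (w π : ℝ)) + tol +
        2 * s * (Fintype.card D * b) := by
  have hs : 0 ≤ 2 * s := (abs_nonneg _).trans (hgap (Classical.arbitrary D))
  have hfeas := hw.of_relClose hF hf₀ hf hη hη1 hrel hbest hθ hcap
  -- The enlarged weights `(1 + θ) w` serve as competitor in the program of `f`.
  have h1 : cost ν R f ŵ ≤ cost ν R f (fun π => (1 + θ) * w π) + ENNReal.ofReal tol :=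
    hŵ.trans (add_le_add (iInf₂_le _ hfeas) le_rfl)
  have hnn : 0 ≤ ∑ π, (((1 + θ) * w π : ℝ≥0) : ℝ) * gap ν R f π :=
    Finset.sum_nonneg fun π _ => mul_nonneg (by positivity) (gap_nonneg _ _ _ _)
  rw [cost_eq_ofReal, cost_eq_ofReal, ← ENNReal.ofReal_add hnn htol,
    ENNReal.ofReal_le_ofReal_iff (by positivity)] at h1
  have h2 : ∑ π, (ŵ π : ℝ) * gap ν R f₀ π ≤
      ∑ π, (ŵ π : ℝ) * gap ν R f π + 2 * s * (Fintype.card D * b) := by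
    calc ∑ π, (ŵ π : ℝ) * gap ν R f₀ π
        ≤ ∑ π, ((ŵ π : ℝ) * gap ν R f π + 2 * s * b) := by
          refine Finset.sum_le_sum fun π _ => ?_
          have h3 := (abs_le.1 (hgap π)).1
          have h4 := hŵb π
          have h5 : (ŵ π : ℝ) * gap ν R f₀ π ≤ ŵ π * (gap ν R f π + 2 * s) := by
            gcongr; linarith
          nlinarith
      _ = _ := by rw [Finset.sum_add_distrib]; simp; ring
  have h3 : ∑ π, (((1 + θ) * w π : ℝ≥0) : ℝ) * gap ν R f π ≤
      (1 + θ) * (∑ π, (w π : ℝ) * gap ν R f₀ π + 2 * s * ∑ π, (w π : ℝ)) := by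
    calc ∑ π, (((1 + θ) * w π : ℝ≥0) : ℝ) * gap ν R f π
        ≤ ∑ π, (1 + θ) * ((w π : ℝ) * gap ν R f₀ π + 2 * s * w π) := by
          refine Finset.sum_le_sum fun π _ => ?_
          have h3 := (abs_le.1 (hgap π)).2
          push_cast
          calc (1 + θ : ℝ) * w π * gap ν R f π ≤ (1 + θ) * w π * (gap ν R f₀ π + 2 * s) := by
                gcongr; linarith
            _ = _ := by ring
      _ = _ := by
          rw [← Finset.mul_sum, Finset.sum_add_distrib, ← Finset.mul_sum]
  linarith

/-- The probability of rejecting an estimate that is close to the truth. -/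
theorem exists_rejection_bound {ν : Measure O} {R : O → ℝ} {Rmax : ℝ} {F : Set (Inst D O)}
    (hF : IsDecisionProblem ν R Rmax F) (hν : ν Set.univ < ⊤) {f₀ f : Inst D O} (hf₀ : f₀ ∈ F)
    (hf : f ∈ F) {n : ℕ} (hn : 1 ≤ n) {η cmin : ℝ} (hcmin : 0 < cmin)
    (hmin : ∀ π o, f₀ π o ≠ 0 → cmin < f₀ π o) (hη : 0 ≤ η)
    (hηb : 64 * Fintype.card D * cap n ^ 2 * η ≤ 1) (hb : 2 ≤ cap n)
    (hrel : RelClose ν f₀ f η) (hsup : SupClose f₀ f (cmin * η)) {w : D → ℝ≥0}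
    (hw : Feasible ν R F f (cap n) w) {lam M X : ℝ} (h0 : 0 < lam)
    (h1 : lam ≤ 1 / 2)
    (haff : ∀ g ∈ F, ∀ π, affinity ν lam (f₀ π) (g π) ≤ ENNReal.ofReal (Real.exp (-(lam *
      truncKL ν (1 / (4 * Fintype.card D * cap n ^ 2)) (2 * cap n) f₀ g π))))
    (hfin : coveringNumber F (Real.exp (-M)) ≠ ⊤)
    (hcard : ((coveringNumber F (Real.exp (-M))).toNat : ℝ) ≤ X) :
    ∃ (J : Finset (Inst D O)) (u : Inst D O → D → O → ℝ≥0∞) (c : ℝ≥0∞),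
      (∀ j ∈ J, ∀ π, Measurable (u j π)) ∧
      (∀ y : List O, y.length = (identPlays n w).length →
        ¬ Accepts ν R F n f ((identPlays n w).zip y) →
        1 ≤ c * ∑ j ∈ J, (((identPlays n w).zip y).map fun p => u j p.1 p.2).prod) ∧
      c * ∑ j ∈ J, ((identPlays n w).map fun π => ∫⁻ o, u j π o ∂(law ν f₀ π)).prod ≤
        ENNReal.ofReal (X * Real.exp (-(lam * (Real.log n / (4 * cap n) -
          2 * η * identBound D n)) + identBound D n *
          (2 * ((ν Set.univ).toReal + 1) * Real.exp (lam * (2 * cap n - M))))) := by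
  have hb0 : 0 < cap n := by linarith
  have hn' : (0 : ℝ) < n := by exact_mod_cast hn
  have hK : (1 : ℝ) ≤ Fintype.card D := by exact_mod_cast Fintype.card_pos
  have hη1 : η ≤ 1 / 2 := by
    have : (1 : ℝ) ≤ Fintype.card D * cap n ^ 2 := by nlinarith
    nlinarith
  obtain ⟨J, hJG, hJ, hmom⟩ := exists_cover_moment_le hF hν hf₀
    (G := Separated ν F f₀ (cap n) w) (fun g hg => hg.1) (identCount n w) h0 h1
    (by positivity) haff hfin hcard
    (fun g hg => le_sum_identCount_mul_truncKL hb hw.2 hg)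
  set Nt := ∑ π, (identCount n w π : ℝ) with hNt
  have hNtb : Nt ≤ identBound D n := sum_identCount_le hb0 hw.2
  have hlen : ((identPlays n w).length : ℝ) = Nt := by
    rw [identPlays_eq, length_playList, hNt]; push_cast; rfl
  set c₀ : ℝ≥0∞ := ENNReal.ofReal (1 + 2 * η) with hc₀
  have hX : 0 ≤ X := le_trans (by positivity) hcard
  -- The prefactor collects the test threshold `n` and the cost of replacing `f` by `f₀` at each
  -- observation, all raised to the Chernoff exponent.
  refine ⟨J, fun j π o => (envelope M j π o / f₀ π o) ^ lam,
    ((n : ℝ≥0∞) * c₀ ^ (identPlays n w).length) ^ lam, fun j hj π => ?_, fun y hy hacc => ?_, ?_⟩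
  · unfold envelope
    exact (((hF.measurable_density j (hJG j hj).1 π).coe_nnreal_ennreal.add_const _).div
      (hF.measurable_density f₀ hf₀ π).coe_nnreal_ennreal).pow_const _
  · unfold Accepts at hacc
    push Not at hacc
    obtain ⟨g, hg, hne, hlt⟩ := hacc
    have hprod := not_le.1 (mt (le_logLikRatio_iff hn f g _).2 (not_le.2 hlt))
    obtain ⟨j, hj, hgj⟩ := hJ g (mem_separated_of_feasible hF hf₀ hf hη (by linarith) hηb hrel hw
      hg hne)
    have h := one_le_prod_of_ratio_lt (f₀ := f₀) (v := envelope M j) (c := c₀)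
      (x := (n : ℝ≥0∞)) (by simp; omega) (by simp [hc₀]; linarith)
      (envelope_ne_zero M j) hgj (hsup.le_mul hcmin hmin hη hη1) _ hprod.le
    have hzl : ((identPlays n w).zip y).length = (identPlays n w).length := by
      rw [List.length_zip, hy, min_self]
    rw [hzl] at h
    have h' := ENNReal.rpow_le_rpow h h0.le
    rw [ENNReal.one_rpow, ENNReal.mul_rpow_of_nonneg _ _ h0.le, ← list_prod_rpow _ _ h0.le] at h'
    have hle : ∀ v : Inst D O → ℝ≥0∞, v j ≤ ∑ j ∈ J, v j := fun v =>
      Finset.single_le_sum_of_canonicallyOrdered hj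
    have hj' := hle fun j => (((identPlays n w).zip y).map fun p =>
      (envelope M j p.1 p.2 / f₀ p.1 p.2) ^ lam).prod
    beta_reduce at hj' ⊢
    exact h'.trans (by gcongr)
  · have hc : ((n : ℝ≥0∞) * c₀ ^ (identPlays n w).length) ^ lam ≤
        ENNReal.ofReal (Real.exp (lam * (Real.log n + 2 * η * Nt))) := by
      have hle : (n : ℝ≥0∞) * c₀ ^ (identPlays n w).length ≤
          ENNReal.ofReal (Real.exp (Real.log n + 2 * η * Nt)) := by
        rw [hc₀, ← ENNReal.ofReal_pow (by positivity), ← ENNReal.ofReal_natCast,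
          ← ENNReal.ofReal_mul hn'.le]
        refine ENNReal.ofReal_le_ofReal ?_
        rw [Real.exp_add, Real.exp_log hn', mul_comm (2 * η) Nt, ← hlen, Real.exp_nat_mul]
        gcongr
        linarith [Real.add_one_le_exp (2 * η)]
      calc _ ≤ ENNReal.ofReal (Real.exp (Real.log n + 2 * η * Nt)) ^ lam :=
            ENNReal.rpow_le_rpow hle h0.le
        _ = _ := by
            rw [ENNReal.ofReal_rpow_of_pos (Real.exp_pos _), ← Real.exp_mul, mul_comm]
    rw [← identPlays_eq] at hmom
    refine (mul_le_mul' hc hmom).trans ?_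
    rw [← ENNReal.ofReal_mul (Real.exp_pos _).le]
    refine ENNReal.ofReal_le_ofReal ?_
    rw [mul_left_comm, ← Real.exp_add]
    refine mul_le_mul_of_nonneg_left (Real.exp_le_exp.2 ?_) hX
    set E := 2 * ((ν Set.univ).toReal + 1) * Real.exp (lam * (2 * cap n - M)) with hE
    have hE0 : 0 ≤ E := by positivity
    have h2 : lam * (2 * η * Nt) ≤ lam * (2 * η * identBound D n) := by gcongr
    have h3 : Nt * E ≤ identBound D n * E := by gcongr
    -- The threshold `ln n` cancels; the surplus `ln n / (4 cap n)` drives the bound.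
    have h4 : (1 + 1 / (4 * cap n)) * Real.log n = Real.log n + Real.log n / (4 * cap n) := by ring
    rw [h4]
    nlinarith

/-- The alternatives that the first phase has to exclude. -/
def Distant (ν : Measure O) (F : Set (Inst D O)) (f₀ : Inst D O) (δ : ℝ) : Set (Inst D O) :=
  {g ∈ F | ∃ π, ENNReal.ofReal δ < kl ν f₀ g π}

/-- One decision with divergence above `δ` suffices: a slack of `δ/2` leaves `δ/2`, below the
truncation level one. -/
theorem le_sum_mul_truncKL_of_distant {ν : Measure O} {F : Set (Inst D O)} {f₀ g : Inst D O}
    {δ : ℝ} (hδ : 0 < δ) (hδ1 : δ ≤ 1) (m : ℕ) (hg : g ∈ Distant ν F f₀ δ) :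
    m * (δ / 2) ≤ ∑ π, ((fun _ : D => m) π : ℝ) * truncKL ν (δ / 2) 1 f₀ g π := by
  obtain ⟨-, π, hπ⟩ := hg
  have htr : δ / 2 ≤ truncKL ν (δ / 2) 1 f₀ g π := by
    unfold truncKL
    rw [← ENNReal.ofReal_le_iff_le_toReal (ne_top_of_le_ne_top (by simp) (min_le_right _ _))]
    refine le_min ?_ (ENNReal.ofReal_le_ofReal (by linarith))
    calc ENNReal.ofReal (δ / 2) = ENNReal.ofReal δ - ENNReal.ofReal (δ / 2) := by
          rw [← ENNReal.ofReal_sub _ (by positivity)]; congr 1; ring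
      _ ≤ _ := tsub_le_tsub_right hπ.le _
  calc (m : ℝ) * (δ / 2) ≤ m * truncKL ν (δ / 2) 1 f₀ g π := by gcongr
    _ ≤ _ := Finset.single_le_sum (f := fun π => (m : ℝ) * truncKL ν (δ / 2) 1 f₀ g π)
        (fun π _ => mul_nonneg (by positivity) (truncKL_nonneg _ _ _ _ _ _)) (Finset.mem_univ π)

/-- The number of plays of each decision in the first phase. -/
def initCount (n : ℕ) : ℕ := ⌈Real.log n / Real.log (Real.log n)⌉₊

theorem initPlays_eq (n : ℕ) : initPlays D n = playList fun _ : D => initCount n := rfl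

theorem length_initPlays (n : ℕ) :
    ((initPlays D n).length : ℝ) = Fintype.card D * initCount n := by
  rw [initPlays_eq, length_playList]
  simp

/-- The probability that the estimate is far from the truth. -/
theorem exists_estimation_bound {ν : Measure O} {R : O → ℝ} {Rmax : ℝ} {F : Set (Inst D O)}
    (hF : IsDecisionProblem ν R Rmax F) (hν : ν Set.univ < ⊤) {f₀ : Inst D O} (hf₀ : f₀ ∈ F)
    {n : ℕ} {tol : ℝ} {est : List O → Inst D O} (hest : IsMLE F n tol est)
    {δ : ℝ} (hδ : 0 < δ) (hδ1 : δ ≤ 1) {lam M X : ℝ} (h0 : 0 < lam) (h1 : lam ≤ 1 / 2)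
    (haff : ∀ g ∈ F, ∀ π, affinity ν lam (f₀ π) (g π) ≤ ENNReal.ofReal (Real.exp (-(lam *
      truncKL ν (δ / 2) 1 f₀ g π))))
    (hfin : coveringNumber F (Real.exp (-M)) ≠ ⊤)
    (hcard : ((coveringNumber F (Real.exp (-M))).toNat : ℝ) ≤ X) :
    ∃ (J : Finset (Inst D O)) (u : Inst D O → D → O → ℝ≥0∞) (c : ℝ≥0∞),
      (∀ j ∈ J, ∀ π, Measurable (u j π)) ∧
      (∀ x : List O, x.length = (initPlays D n).length → est x ∈ Distant ν F f₀ δ →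
        1 ≤ c * ∑ j ∈ J, (((initPlays D n).zip x).map fun p => u j p.1 p.2).prod) ∧
      c * ∑ j ∈ J, ((initPlays D n).map fun π => ∫⁻ o, u j π o ∂(law ν f₀ π)).prod ≤
        ENNReal.ofReal (X * Real.exp (lam * tol - lam * (initCount n * (δ / 2)) +
          Fintype.card D * initCount n *
          (2 * ((ν Set.univ).toReal + 1) * Real.exp (lam * (1 - M))))) := by
  obtain ⟨J, hJG, hJ, hmom⟩ := exists_cover_moment_le hF hν hf₀
    (G := Distant ν F f₀ δ) (fun g hg => hg.1) (fun _ : D => initCount n) h0 h1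
    zero_le_one haff hfin hcard
    (fun g hg => le_sum_mul_truncKL_of_distant hδ hδ1 (initCount n) hg)
  have hX : 0 ≤ X := le_trans (by positivity) hcard
  refine ⟨J, fun j π o => (envelope M j π o / f₀ π o) ^ lam,
    ENNReal.ofReal (Real.exp tol) ^ lam, fun j hj π => ?_, fun x hx hd => ?_, ?_⟩
  · unfold envelope
    exact (((hF.measurable_density j (hJG j hj).1 π).coe_nnreal_ennreal.add_const _).div
      (hF.measurable_density f₀ hf₀ π).coe_nnreal_ennreal).pow_const _
  · obtain ⟨j, hj, hgj⟩ := hJ _ hd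
    -- An approximate maximizer is at least as likely as the truth up to `exp tol`, so its envelope
    -- inherits this.
    have h := one_le_prod_of_prod_le (c := ENNReal.ofReal (Real.exp tol)) (by simp [Real.exp_pos])
      (envelope_ne_zero M j) hgj _
      (prod_le_of_logLik_le (hest.maximal x hx f₀ hf₀))
    have h' := ENNReal.rpow_le_rpow h h0.le
    rw [ENNReal.one_rpow, ENNReal.mul_rpow_of_nonneg _ _ h0.le, ← list_prod_rpow _ _ h0.le] at h'
    have hle : ∀ v : Inst D O → ℝ≥0∞, v j ≤ ∑ j ∈ J, v j := fun v =>
      Finset.single_le_sum_of_canonicallyOrdered hj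
    have hj' := hle fun j => (((initPlays D n).zip x).map fun p =>
      (envelope M j p.1 p.2 / f₀ p.1 p.2) ^ lam).prod
    beta_reduce at hj' ⊢
    exact h'.trans (by gcongr)
  · rw [← initPlays_eq] at hmom
    rw [ENNReal.ofReal_rpow_of_pos (Real.exp_pos _), ← Real.exp_mul]
    refine (mul_le_mul' le_rfl hmom).trans ?_
    rw [← ENNReal.ofReal_mul (Real.exp_pos _).le]
    refine ENNReal.ofReal_le_ofReal (le_of_eq ?_)
    rw [mul_left_comm, ← Real.exp_add]
    congr 2
    simp only [Finset.sum_const, Finset.card_univ, nsmul_eq_mul]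
    ring

/-- The bound on the probability of an estimation error. -/
def estimationError (D : Type*) [Fintype D] (n : ℕ) (V X lam tol δ M : ℝ) : ℝ :=
  X * Real.exp (lam * tol - lam * (initCount n * (δ / 2)) +
    Fintype.card D * initCount n * (2 * (V + 1) * Real.exp (lam * (1 - M))))

/-- The bound on the probability of a rejection. -/
def rejectionError (D : Type*) [Fintype D] (n : ℕ) (V X lam η M : ℝ) : ℝ :=
  X * Real.exp (-(lam * (Real.log n / (4 * cap n) - 2 * η * identBound D n)) +
    identBound D n * (2 * (V + 1) * Real.exp (lam * (2 * cap n - M))))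

/-- The bound on the regret of the second phase when the estimate is close to the truth. -/
def goodCost (ν : Measure O) (R : O → ℝ) (Rmax : ℝ) (f : Inst D O) (n : ℕ) (w : D → ℝ≥0)
    (θ s tol : ℝ) : ℝ :=
  (1 + 1 / cap n) * Real.log n * ((1 + θ) * (∑ π, (w π : ℝ) * gap ν R f π +
    2 * s * ∑ π, (w π : ℝ)) + tol + 2 * s * (Fintype.card D * cap n)) +
    Fintype.card D * Rmax * (1 / cap n * Real.log n + 1)

/-- The case distinction on the estimate is made for each first-phase history. A distant estimate is
charged to the estimation error with the crude second-phase bound; a near one has near-optimal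
weights and is charged only a rejection probability. -/
theorem ofReal_regret_le {ν : Measure O} {R : O → ℝ} {Rmax : ℝ} {F : Set (Inst D O)}
    (hF : IsDecisionProblem ν R Rmax F) (h₁ : RenyiUniformConvergence ν F)
    (hν : ν Set.univ < ⊤) {f₀ : Inst D O} (hf₀ : f₀ ∈ F)
    {cmin : ℝ} (hcmin : 0 < cmin) (hmin : ∀ π o, f₀ π o ≠ 0 → cmin < f₀ π o)
    {ι c₅ : ℝ} (hι : 0 < ι) (hc₅ : 0 < c₅)
    (hctrl : ∀ f ∈ F, ∀ π, kl ν f₀ f π ≤ 1 →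
      densityDist (f₀ π) (f π) ≤ ENNReal.ofReal ι * kl ν f₀ f π ^ c₅)
    {n : ℕ} (hn : 1 ≤ n) {tol : ℝ} (htol : 0 ≤ tol) {est : List O → Inst D O}
    {wt : List O → D → ℝ≥0} {ucb : List (D × O) → D} (hest : IsMLE F n tol est)
    (hwt : SolvesProgram ν R F n tol est wt) (hucb : IsUCB R Rmax n ucb)
    {B : ℝ} {w : D → ℝ≥0} (hw : Feasible ν R F f₀ B w)
    {η δ M X lam₁ lam₂ : ℝ} {θ : ℝ≥0} (hη : 0 ≤ η)
    (hηb : 64 * Fintype.card D * cap n ^ 2 * η ≤ 1) (hb : 2 ≤ cap n)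
    (hθ : 1 ≤ (1 + θ : ℝ) * (1 - η - 2 * η * ∑ π, (w π : ℝ)))
    (hcap : ∀ π, (1 + θ : ℝ) * w π ≤ cap n)
    (hgap : ∀ π, π ≠ best ν R f₀ →
      2 * (Rmax * (ν Set.univ).toReal * (cmin * η)) < gap ν R f₀ π)
    (hδ : 0 < δ) (hδ1 : δ ≤ 1) (hδη : ι * δ ^ c₅ ≤ cmin * η)
    (hlen : Fintype.card D * initCount n + identBound D n ≤ n)
    (hl₁ : 0 < lam₁) (hl₁' : lam₁ ≤ 1 / 2) (hl₂ : 0 < lam₂) (hl₂' : lam₂ ≤ 1 / 2)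
    (haff₁ : ∀ g ∈ F, ∀ π, affinity ν lam₁ (f₀ π) (g π) ≤ ENNReal.ofReal (Real.exp (-(lam₁ *
      truncKL ν (δ / 2) 1 f₀ g π))))
    (haff₂ : ∀ g ∈ F, ∀ π, affinity ν lam₂ (f₀ π) (g π) ≤ ENNReal.ofReal (Real.exp (-(lam₂ *
      truncKL ν (1 / (4 * Fintype.card D * cap n ^ 2)) (2 * cap n) f₀ g π))))
    (hfin : coveringNumber F (Real.exp (-M)) ≠ ⊤)
    (hcard : ((coveringNumber F (Real.exp (-M))).toNat : ℝ) ≤ X) :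
    ENNReal.ofReal (regret ν R f₀ (t2c ν R F n est wt ucb) n) ≤ ENNReal.ofReal (
      Fintype.card D * initCount n * Rmax +
      (goodCost ν R Rmax f₀ n w θ (Rmax * (ν Set.univ).toReal * (cmin * η)) tol +
        (ucbConst ν R Rmax f₀ * Real.log n + 3 * Fintype.card D * Rmax) *
          rejectionError D n (ν Set.univ).toReal X lam₂ η M) +
      (identBound D n * Rmax + (ucbConst ν R Rmax f₀ * Real.log n + 3 * Fintype.card D * Rmax) +
        Rmax) * estimationError D n (ν Set.univ).toReal X lam₁ tol δ M) := by
  have hb0 : 0 < cap n := by linarith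
  have hL : 0 ≤ Real.log n := Real.log_natCast_nonneg n
  have hR := hF.Rmax_nonneg hf₀
  have hX : 0 ≤ X := le_trans (by positivity) hcard
  have hK : (1 : ℝ) ≤ Fintype.card D := by exact_mod_cast Fintype.card_pos
  have hη1 : η < 1 := by
    have : (1 : ℝ) ≤ Fintype.card D * cap n ^ 2 := by nlinarith
    nlinarith
  set s := Rmax * (ν Set.univ).toReal * (cmin * η) with hs
  have hs0 : 0 ≤ s := by positivity
  set U : ℝ := ucbConst ν R Rmax f₀ * Real.log n + 3 * Fintype.card D * Rmax with hU
  have hU0 : 0 ≤ U := by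
    have : 0 ≤ ucbConst ν R Rmax f₀ :=
      Finset.sum_nonneg fun π _ => div_nonneg (by positivity) (gap_nonneg _ _ _ _)
    positivity
  set rej := rejectionError D n (ν Set.univ).toReal X lam₂ η M with hrej
  have hrej0 : 0 ≤ rej := by rw [hrej, rejectionError]; positivity
  set er := estimationError D n (ν Set.univ).toReal X lam₁ tol δ M with her
  have her0 : 0 ≤ er := by rw [her, estimationError]; positivity
  set A := goodCost ν R Rmax f₀ n w θ s tol with hA
  have hA0 : 0 ≤ A := by
    have : 0 ≤ ∑ π, (w π : ℝ) * gap ν R f₀ π :=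
      Finset.sum_nonneg fun π _ => mul_nonneg (w π).coe_nonneg (gap_nonneg _ _ _ _)
    rw [hA, goodCost]; positivity
  have hIB : 0 ≤ identBound D n := by unfold identBound; positivity
  have hilen : (initPlays D n).length ≤ n := by
    have : ((initPlays D n).length : ℝ) ≤ n := by rw [length_initPlays]; linarith
    exact_mod_cast this
  obtain ⟨J, u, c, hu, hbad, hc⟩ := exists_estimation_bound hF hν hf₀ hest hδ hδ1 hl₁ hl₁' haff₁
    hfin hcard
  have hmain := ofReal_regret_t2c_le hF hf₀ (est := est) (wt := wt) (ucb := ucb) hilen J u hu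
    (ENNReal.ofReal A + ENNReal.ofReal U * ENNReal.ofReal rej)
    ((ENNReal.ofReal (identBound D n * Rmax) + ENNReal.ofReal U + ENNReal.ofReal Rmax) * c) ?_
  · refine hmain.trans ?_
    rw [mul_assoc]
    calc _ ≤ ((initPlays D n).length : ℝ≥0∞) * ENNReal.ofReal Rmax +
          (ENNReal.ofReal A + ENNReal.ofReal U * ENNReal.ofReal rej) +
          (ENNReal.ofReal (identBound D n * Rmax) + ENNReal.ofReal U + ENNReal.ofReal Rmax) *
            ENNReal.ofReal er := by
            gcongr
            exact hc
      _ = _ := by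
          rw [← ENNReal.ofReal_natCast, length_initPlays, ← ENNReal.ofReal_mul (by positivity),
            ← ENNReal.ofReal_mul hU0, ← ENNReal.ofReal_add hA0 (by positivity),
            ← ENNReal.ofReal_add (by positivity) (by positivity),
            ← ENNReal.ofReal_add (by positivity) (by positivity),
            ← ENNReal.ofReal_add (by positivity) (by positivity),
            ← ENNReal.ofReal_mul (by positivity),
            ← ENNReal.ofReal_add (by positivity) (by positivity)]
  · intro x hx
    have hex := hest.mem x hx
    have hcapx := hwt.le_cap x hx
    have hlenx : (initPlays D n).length + (identPlays n (wt x)).length ≤ n := by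
      have h1 := sum_identCount_le hb0 hcapx
      have h2 : (((initPlays D n).length + (identPlays n (wt x)).length : ℕ) : ℝ) ≤ n := by
        push_cast
        rw [length_initPlays, identPlays_eq, length_playList]
        push_cast
        linarith
      exact_mod_cast h2
    by_cases hd : est x ∈ Distant ν F f₀ δ
    · refine (value_second_phase_le hF hf₀ hn hucb x hx hlenx hex).trans ?_
      rw [add_assoc, add_assoc]
      refine add_le_add le_rfl (le_trans ?_ le_add_self)
      rw [mul_assoc]
      refine le_trans ?_ (le_mul_of_one_le_right' (hbad x hx hd))
      rw [← add_assoc]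
      exact add_le_add (add_le_add (identCost_le hF hf₀ hb0 hcapx) le_rfl) le_rfl
    · have hkl : ∀ π, kl ν f₀ (est x) π ≤ ENNReal.ofReal δ := by
        intro π
        by_contra hcon
        exact hd ⟨hex, π, not_le.1 hcon⟩
      have hsup : SupClose f₀ (est x) (cmin * η) := by
        intro π
        refine (hctrl _ hex π ((hkl π).trans ?_)).trans ?_
        · rw [← ENNReal.ofReal_one]; exact ENNReal.ofReal_le_ofReal hδ1
        · calc ENNReal.ofReal ι * kl ν f₀ (est x) π ^ c₅
              ≤ ENNReal.ofReal ι * ENNReal.ofReal δ ^ c₅ := by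
                gcongr; exact hkl π
            _ = ENNReal.ofReal (ι * δ ^ c₅) := by
                rw [ENNReal.ofReal_rpow_of_pos hδ, ← ENNReal.ofReal_mul hι.le]
            _ ≤ _ := ENNReal.ofReal_le_ofReal hδη
      have hrel := relClose_of_densityDist_le hF h₁ hf₀ hex hcmin hmin hη hη1 hsup
      -- From here on the estimate shares its best decision with `f₀`, so an accepted estimate
      -- incurs no further regret.
      have hmean : ∀ π, |meanReward ν R (est x) π - meanReward ν R f₀ π| ≤ s := fun π =>
        abs_meanReward_sub_le hF hν hf₀ hex (by positivity) π (hsup π)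
      have hbest := best_eq_of_meanReward_close hgap hmean
      obtain ⟨hfeas, hopt⟩ := hwt.optimal x hx
        ⟨_, hw.of_relClose hF hf₀ hex hη hη1 hrel hbest hθ hcap⟩
      have hsum := sum_weights_gap_le hF hf₀ hex hη hη1 hrel hbest
        (abs_gap_sub_le hbest hmean) htol hw hθ hcap hcapx hopt
      obtain ⟨J', u', c', hu', hrej', hp'⟩ := exists_rejection_bound hF hν hf₀ hex hn hcmin hmin hη
        hηb hb hrel hsup hfeas hl₂ hl₂' haff₂ hfin hcard
      refine (value_second_phase_le_of_good hF hf₀ hn hucb x hx hlenx hbest J' u' hu' c'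
        (ENNReal.ofReal rej) hrej' hp').trans ?_
      rw [add_assoc]
      refine add_le_add le_rfl (le_trans ?_ le_self_add)
      exact add_le_add (identCost_le_of_sum_le hF hf₀ hb0 hsum) le_rfl

/-! ### Asymptotics -/

/-- A function that decays more slowly than every negative power. -/
def Slow (s : ℝ → ℝ) : Prop := ∀ θ : ℝ, 0 < θ → ∀ᶠ x in atTop, x ^ (-θ) ≤ s x

theorem Slow.const {c : ℝ} (hc : 0 < c) : Slow fun _ => c := fun _ hθ =>
  (tendsto_rpow_neg_atTop hθ).eventually_le_const hc

theorem Slow.mul {s t : ℝ → ℝ} (hs : Slow s) (ht : Slow t) : Slow fun x => s x * t x := by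
  intro θ hθ
  filter_upwards [hs (θ / 2) (by positivity), ht (θ / 2) (by positivity), eventually_gt_atTop 0]
    with x h1 h2 hx
  calc x ^ (-θ) = x ^ (-(θ / 2)) * x ^ (-(θ / 2)) := by
        rw [← Real.rpow_add hx]; congr 1; ring
    _ ≤ s x * t x := mul_le_mul h1 h2 (by positivity) (le_trans (by positivity) h1)

theorem Slow.min {s t : ℝ → ℝ} (hs : Slow s) (ht : Slow t) : Slow fun x => min (s x) (t x) := by
  intro θ hθ
  filter_upwards [hs θ hθ, ht θ hθ] with x h1 h2
  exact le_min h1 h2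

theorem Slow.rpow {s : ℝ → ℝ} (hs : Slow s) {p : ℝ} (hp : 0 < p) : Slow fun x => s x ^ p := by
  intro θ hθ
  filter_upwards [hs (θ / p) (by positivity), eventually_gt_atTop 0] with x h1 hx
  calc x ^ (-θ) = (x ^ (-(θ / p))) ^ p := by
        rw [← Real.rpow_mul hx.le]; congr 1; field_simp
    _ ≤ s x ^ p := by gcongr

theorem Slow.inv_log : Slow fun x => (Real.log x)⁻¹ := by
  intro θ hθ
  have h := (isLittleO_log_rpow_atTop hθ).bound (by norm_num : (0 : ℝ) < 1)
  filter_upwards [h, eventually_gt_atTop 1] with x hx h1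
  have hlog : 0 < Real.log x := Real.log_pos h1
  rw [Real.norm_of_nonneg hlog.le, one_mul, Real.norm_of_nonneg (by positivity)] at hx
  rw [Real.rpow_neg (by linarith)]
  exact inv_anti₀ hlog hx

/-- The cap of the program as a function of `ln n`. -/
def capFun (x : ℝ) : ℝ := Real.log x ^ (1 / 4 : ℝ)

theorem cap_eq (n : ℕ) : cap n = capFun (Real.log n) := rfl

theorem tendsto_capFun : Tendsto capFun atTop atTop :=
  (tendsto_rpow_atTop (by norm_num)).comp Real.tendsto_log_atTop

theorem Slow.inv_capFun : Slow fun x => (capFun x)⁻¹ := by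
  intro θ hθ
  filter_upwards [Slow.inv_log.rpow (by norm_num : (0 : ℝ) < 1 / 4) θ hθ, eventually_gt_atTop 1]
    with x hx h1
  refine hx.trans (le_of_eq ?_)
  rw [capFun, Real.inv_rpow (Real.log_pos h1).le]

theorem capFun_le_rpow {θ : ℝ} (hθ : 0 < θ) : ∀ᶠ x in atTop, capFun x ≤ x ^ θ := by
  filter_upwards [Slow.inv_capFun θ hθ, eventually_gt_atTop 0,
    tendsto_capFun.eventually_gt_atTop 0] with x hx h0 hc
  rw [Real.rpow_neg h0.le] at hx
  exact (inv_le_inv₀ (by positivity) hc).1 hx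

theorem tendsto_log_div_rpow {θ : ℝ} (hθ : 0 < θ) :
    Tendsto (fun x : ℝ => Real.log x / x ^ θ) atTop (𝓝 0) :=
  (isLittleO_log_rpow_atTop hθ).tendsto_div_nhds_zero

/-- The main exponent: a slow multiple of `x` dominates `√x` and `ln x`. -/
theorem eventually_exponent_le {s : ℝ → ℝ} (hs : Slow s) (c : ℝ) :
    ∀ᶠ x in atTop, c * √x + 2 - x * s x ≤ -Real.log x := by
  have hlim : Tendsto (fun x : ℝ => x ^ (3 / 4 : ℝ) *
      (1 - c * x ^ (-(1 / 4) : ℝ) - 2 * x ^ (-(3 / 4) : ℝ) - Real.log x / x ^ (3 / 4 : ℝ)))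
      atTop atTop := by
    refine (tendsto_rpow_atTop (by norm_num)).atTop_mul_pos (C := 1) one_pos ?_
    have h1 := (tendsto_rpow_neg_atTop (by norm_num : (0 : ℝ) < 1 / 4)).const_mul c
    have h2 := (tendsto_rpow_neg_atTop (by norm_num : (0 : ℝ) < 3 / 4)).const_mul 2
    have h3 := tendsto_log_div_rpow (by norm_num : (0 : ℝ) < 3 / 4)
    have := ((tendsto_const_nhds (x := (1 : ℝ))).sub h1).sub h2 |>.sub h3
    simpa using this
  -- Slowness with exponent `1/4` gives `x * s x ≥ x^(3/4)`, which beats `√x`.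
  filter_upwards [hs (1 / 4) (by norm_num), hlim.eventually_ge_atTop 0, eventually_gt_atTop 0]
    with x hx hl h0
  have h1 : x ^ (3 / 4 : ℝ) ≤ x * s x := by
    calc x ^ (3 / 4 : ℝ) = x * x ^ (-(1 / 4) : ℝ) := by
          nth_rw 2 [← Real.rpow_one x]
          rw [← Real.rpow_add h0]; norm_num
      _ ≤ x * s x := by gcongr
  have h2 : x ^ (3 / 4 : ℝ) *
      (1 - c * x ^ (-(1 / 4) : ℝ) - 2 * x ^ (-(3 / 4) : ℝ) - Real.log x / x ^ (3 / 4 : ℝ)) =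
      x ^ (3 / 4 : ℝ) - c * √x - 2 - Real.log x := by
    have e1 : x ^ (3 / 4 : ℝ) * x ^ (-(1 / 4) : ℝ) = √x := by
      rw [← Real.rpow_add h0, Real.sqrt_eq_rpow]; norm_num
    have e2 : x ^ (3 / 4 : ℝ) * x ^ (-(3 / 4) : ℝ) = 1 := by
      rw [← Real.rpow_add h0]; norm_num
    have e3 : x ^ (3 / 4 : ℝ) * (Real.log x / x ^ (3 / 4 : ℝ)) = Real.log x := by
      field_simp
    linear_combination (-c) * e1 - 2 * e2 - e3
  rw [h2] at hl
  linarith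

/-- The discretization error is negligible. -/
theorem eventually_discretization_le {lam : ℝ → ℝ} (hlam : Slow lam) {a : ℝ → ℝ}
    (ha : ∀ᶠ x in atTop, a x ≤ √x / 2) (C : ℝ) :
    ∀ᶠ x in atTop, C * x ^ 2 * Real.exp (lam x * (a x - √x)) ≤ 1 := by
  have hlim : Tendsto (fun x : ℝ => |C| * (x ^ (1 / 4 : ℝ)) ^ (8 : ℕ) *
      Real.exp (-(x ^ (1 / 4 : ℝ)))) atTop (𝓝 0) := by
    have h := (Real.tendsto_pow_mul_exp_neg_atTop_nhds_zero 8).comp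
      (tendsto_rpow_atTop (by norm_num : (0 : ℝ) < 1 / 4))
    have := h.const_mul |C|
    simpa [Function.comp_def, mul_assoc] using this
  have h8 : ∀ᶠ x : ℝ in atTop, 2 ≤ x ^ (1 / 8 : ℝ) :=
    (tendsto_rpow_atTop (by norm_num)).eventually_ge_atTop 2
  filter_upwards [hlam (1 / 8) (by norm_num), ha, hlim.eventually_le_const one_pos,
    eventually_gt_atTop 0, h8] with x hx hax hl h0 h8
  have hpow : (x ^ (1 / 4 : ℝ)) ^ (8 : ℕ) = x ^ 2 := by
    rw [← Real.rpow_natCast, ← Real.rpow_mul h0.le]; norm_num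
  have hlam0 : 0 ≤ lam x := le_trans (by positivity) hx
  -- With `lam x ≥ x^(-1/8)` and `√x - a x ≥ √x / 2`, the exponent is at least `x^(3/8) / 2` in
  -- size, hence at least `x^(1/4)` once `x^(1/8) ≥ 2`.
  have hexp : lam x * (a x - √x) ≤ -(x ^ (1 / 4 : ℝ)) := by
    have h1 : x ^ (1 / 4 : ℝ) ≤ lam x * (√x / 2) := by
      calc x ^ (1 / 4 : ℝ) = x ^ (-(1 / 8) : ℝ) * (x ^ (1 / 4 : ℝ) * x ^ (1 / 8 : ℝ)) := by
            rw [← Real.rpow_add h0, ← Real.rpow_add h0]; norm_num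
        _ ≤ x ^ (-(1 / 8) : ℝ) * (x ^ (1 / 4 : ℝ) * x ^ (1 / 8 : ℝ) * (x ^ (1 / 8 : ℝ) / 2)) := by
            refine mul_le_mul_of_nonneg_left ?_ (by positivity)
            exact le_mul_of_one_le_right (by positivity) (by linarith)
        _ = x ^ (-(1 / 8) : ℝ) * (√x / 2) := by
            have : √x = x ^ (1 / 4 : ℝ) * x ^ (1 / 8 : ℝ) * x ^ (1 / 8 : ℝ) := by
              rw [← Real.rpow_add h0, ← Real.rpow_add h0, Real.sqrt_eq_rpow]; norm_num
            rw [this]; ring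
        _ ≤ _ := by gcongr
    nlinarith
  calc C * x ^ 2 * Real.exp (lam x * (a x - √x))
      ≤ |C| * x ^ 2 * Real.exp (-(x ^ (1 / 4 : ℝ))) := by
        gcongr
        exact le_abs_self C
    _ ≤ 1 := by rw [← hpow]; exact hl

theorem tendsto_log_natCast : Tendsto (fun n : ℕ => Real.log n) atTop atTop :=
  Real.tendsto_log_atTop.comp tendsto_natCast_atTop_atTop

theorem initCount_bounds : ∀ᶠ n : ℕ in atTop,
    Real.log n * (Real.log (Real.log n))⁻¹ ≤ initCount n ∧
      (initCount n : ℝ) ≤ Real.log n * (Real.log (Real.log n))⁻¹ + 1 ∧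
      (initCount n : ℝ) ≤ 2 * Real.log n := by
  filter_upwards [tendsto_log_natCast.eventually_ge_atTop 3] with n hn
  have hlog : 1 ≤ Real.log (Real.log n) := by
    rw [Real.le_log_iff_exp_le (by linarith)]
    exact Real.exp_one_lt_three.le.trans hn
  have h1 : Real.log n * (Real.log (Real.log n))⁻¹ ≤ initCount n := by
    rw [← div_eq_mul_inv]; exact Nat.le_ceil _
  have h2 : (initCount n : ℝ) ≤ Real.log n * (Real.log (Real.log n))⁻¹ + 1 := by
    rw [← div_eq_mul_inv]
    exact (Nat.ceil_lt_add_one (by positivity)).le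
  refine ⟨h1, h2, ?_⟩
  have : Real.log n * (Real.log (Real.log n))⁻¹ ≤ Real.log n :=
    mul_le_of_le_one_right (by linarith) (inv_le_one_of_one_le₀ hlog)
  linarith

theorem slow_renyiOrder {c₁ c₂ c₃ κ : ℝ} (hc₁ : 0 < c₁) (hc₂ : 0 < c₂) (hc₃ : 0 < c₃)
    (hκ : 0 < κ) {ε α : ℝ → ℝ} (hε : Slow ε) (hα : Slow fun x => 1 / α x) :
    Slow fun x => renyiOrder c₁ c₂ c₃ κ (ε x) (α x) :=
  (Slow.const (by norm_num)).min
    (((hε.rpow hc₁).mul ((hα.min (Slow.const hc₂)).rpow hc₃)).mul (Slow.const hκ))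

theorem renyiOrder_pos {c₁ c₂ c₃ κ ε α : ℝ} (hc₂ : 0 < c₂)
    (hκ : 0 < κ) (hε : 0 < ε) (hα : 0 < α) : 0 < renyiOrder c₁ c₂ c₃ κ ε α := by
  have : 0 < min (1 / α) c₂ := lt_min (by positivity) hc₂
  exact lt_min (by norm_num) (by positivity)

theorem renyiOrder_le {c₁ c₂ c₃ κ ε α : ℝ} : renyiOrder c₁ c₂ c₃ κ ε α ≤ 1 / 2 := min_le_left _ _

theorem identBound_le {n : ℕ} (hb : 2 ≤ cap n) (hL : 1 ≤ Real.log n) :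
    identBound D n ≤ Fintype.card D * (3 * (cap n * Real.log n)) := by
  unfold identBound
  have h1 : 1 / cap n ≤ 1 := by rw [div_le_one (by linarith)]; linarith
  have h2 : (cap n + 1 + 1 / cap n) * Real.log n ≤ (2 * cap n) * Real.log n := by
    gcongr; linarith
  have h3 : 1 ≤ cap n * Real.log n := by nlinarith
  gcongr
  linarith

/-- The gain `lam * initCount * δ / 2` is `x` times a slow function and beats the entropy `c √x`.
The tolerance and the discretization contribute at most one each, the `2` of
`eventually_exponent_le`. -/
theorem eventually_estimationError_le {δ lam : ℝ → ℝ} {tol : ℕ → ℝ} (hδ : Slow δ) (hlam : Slow lam)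
    (hlam1 : ∀ x, lam x ≤ 1 / 2) (htol : Tendsto tol atTop (𝓝 0)) (V c : ℝ) (hV : 0 ≤ V) :
    ∀ᶠ n : ℕ in atTop, estimationError D n V (Real.exp (c * √(Real.log n))) (lam (Real.log n))
      (tol n) (δ (Real.log n)) √(Real.log n) ≤ (Real.log n)⁻¹ := by
  have hs : Slow fun x => lam x * (δ x * (Real.log x)⁻¹ * (1 / 2)) :=
    hlam.mul ((hδ.mul Slow.inv_log).mul (Slow.const (by norm_num)))
  have ha : ∀ᶠ x : ℝ in atTop, (fun _ => (1 : ℝ)) x ≤ √x / 2 := by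
    filter_upwards [Real.tendsto_sqrt_atTop.eventually_ge_atTop 2] with x hx
    linarith
  filter_upwards [initCount_bounds, tendsto_log_natCast.eventually (eventually_exponent_le hs c),
    tendsto_log_natCast.eventually (eventually_discretization_le hlam ha
      (Fintype.card D * 2 * (2 * (V + 1)))), tendsto_log_natCast.eventually_ge_atTop 1,
    htol.eventually_le_const (by norm_num : (0 : ℝ) < 1),
    tendsto_log_natCast.eventually (hlam 1 one_pos),
    tendsto_log_natCast.eventually (hδ 1 one_pos)] with n hm hexp hdisc hL htol1 hlam0 hδ0
  set x := Real.log n with hx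
  have hl0 : 0 ≤ lam x := le_trans (by positivity) hlam0
  have hd0 : 0 ≤ δ x := le_trans (by positivity) hδ0
  unfold estimationError
  rw [← Real.exp_add, ← Real.exp_log (by positivity : 0 < x⁻¹), Real.log_inv]
  refine Real.exp_le_exp.2 (le_trans ?_ hexp)
  have h1 : lam x * tol n ≤ 1 := by
    have := hlam1 x
    nlinarith
  have h2 : x * (lam x * (δ x * (Real.log x)⁻¹ * (1 / 2))) ≤
      lam x * (initCount n * (δ x / 2)) := by
    calc _ = lam x * ((x * (Real.log x)⁻¹) * (δ x / 2)) := by ring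
      _ ≤ _ := by gcongr; exact hm.1
  have h3 : Fintype.card D * initCount n * (2 * (V + 1) * Real.exp (lam x * (1 - √x))) ≤ 1 := by
    calc _ ≤ Fintype.card D * (2 * x ^ 2) * (2 * (V + 1) * Real.exp (lam x * (1 - √x))) := by
          gcongr
          refine hm.2.2.trans ?_
          nlinarith
      _ = Fintype.card D * 2 * (2 * (V + 1)) * x ^ 2 * Real.exp (lam x * (1 - √x)) := by ring
      _ ≤ 1 := hdisc
  linarith

/-- The surplus `x / (4 b)` loses at most half to the replacement of the estimate by the truth,
which is how the constant `64` in `η` is used; the rest is still `x` times a slow function. -/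
theorem eventually_rejectionError_le {lam : ℝ → ℝ} (hlam : Slow lam) (V c : ℝ) (hV : 0 ≤ V) :
    ∀ᶠ n : ℕ in atTop, rejectionError D n V (Real.exp (c * √(Real.log n))) (lam (Real.log n))
      (1 / (64 * Fintype.card D * cap n ^ 2)) √(Real.log n) ≤ (Real.log n)⁻¹ := by
  have hs : Slow fun x => lam x * ((capFun x)⁻¹ * (1 / 8)) :=
    hlam.mul (Slow.inv_capFun.mul (Slow.const (by norm_num)))
  have ha : ∀ᶠ x : ℝ in atTop, (fun x => 2 * capFun x) x ≤ √x / 2 := by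
    filter_upwards [capFun_le_rpow (by norm_num : (0 : ℝ) < 1 / 4),
      (tendsto_rpow_atTop (by norm_num : (0 : ℝ) < 1 / 4)).eventually_ge_atTop 4,
      eventually_gt_atTop 0] with x h1 h2 h0
    have : √x = x ^ (1 / 4 : ℝ) * x ^ (1 / 4 : ℝ) := by
      rw [← Real.rpow_add h0, Real.sqrt_eq_rpow]; norm_num
    rw [this]
    nlinarith
  filter_upwards [tendsto_log_natCast.eventually (eventually_exponent_le hs c),
    tendsto_log_natCast.eventually (eventually_discretization_le hlam ha
      (Fintype.card D * 3 * (2 * (V + 1)))), tendsto_log_natCast.eventually_ge_atTop 1,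
    tendsto_log_natCast.eventually (hlam 1 one_pos),
    tendsto_log_natCast.eventually (tendsto_capFun.eventually_ge_atTop 2),
    tendsto_log_natCast.eventually (capFun_le_rpow one_pos)] with n hexp hdisc hL hlam0 hb hbx
  have hIB := identBound_le (D := D) (n := n) hb hL
  rw [cap_eq] at hIB ⊢
  set x := Real.log n with hx
  set b := capFun x with hbdef
  rw [Real.rpow_one] at hbx
  have hl0 : 0 ≤ lam x := le_trans (by positivity) hlam0
  have hK : (1 : ℝ) ≤ Fintype.card D := by exact_mod_cast Fintype.card_pos
  unfold rejectionError
  rw [cap_eq, ← hx, ← hbdef, ← Real.exp_add, ← Real.exp_log (by positivity : 0 < x⁻¹),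
    Real.log_inv]
  refine Real.exp_le_exp.2 (le_trans ?_ hexp)
  have h2 : x * (lam x * (b⁻¹ * (1 / 8))) ≤
      lam x * (x / (4 * b) - 2 * (1 / (64 * Fintype.card D * b ^ 2)) * identBound D n) := by
    have h21 : 2 * (1 / (64 * Fintype.card D * b ^ 2)) * identBound D n ≤ x / (8 * b) := by
      calc _ ≤ 2 * (1 / (64 * Fintype.card D * b ^ 2)) * (Fintype.card D * (3 * (b * x))) := by
            gcongr
        _ = 3 * x / (32 * b) := by field_simp; ring
        _ ≤ x / (8 * b) := by
            rw [div_le_div_iff₀ (by positivity) (by positivity)]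
            nlinarith [mul_nonneg (by linarith : 0 ≤ x) (by linarith : 0 ≤ b)]
    calc _ = lam x * (x / (4 * b) - x / (8 * b)) := by field_simp; ring
      _ ≤ _ := by gcongr
  have h3 : identBound D n * (2 * (V + 1) * Real.exp (lam x * (2 * b - √x))) ≤ 1 := by
    calc _ ≤ (Fintype.card D * (3 * (x * x))) *
          (2 * (V + 1) * Real.exp (lam x * (2 * b - √x))) := by
          gcongr
          exact hIB.trans (by gcongr)
      _ = Fintype.card D * 3 * (2 * (V + 1)) * x ^ 2 * Real.exp (lam x * (2 * b - √x)) := by ring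
      _ ≤ 1 := hdisc
  linarith

/-- The scale `exp (-√(ln n))` balances two demands: the entropy stays of order `√(ln n)`, while
`√(ln n)` exceeds the truncation level `2 cap n`. -/
theorem eventually_coveringNumber_le {ν : Measure O} {F : Set (Inst D O)}
    (h₂ : LogCovering ν F) : ∃ c : ℝ, ∀ᶠ n : ℕ in atTop,
      coveringNumber F (Real.exp (-√(Real.log n))) ≠ ⊤ ∧
      ((coveringNumber F (Real.exp (-√(Real.log n)))).toNat : ℝ) ≤
        Real.exp (c * √(Real.log n)) := by
  obtain ⟨c, hc⟩ := h₂.1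
  refine ⟨c, ?_⟩
  have hlim : Tendsto (fun n : ℕ => Real.exp (-√(Real.log n))) atTop (𝓝[>] 0) := by
    refine tendsto_nhdsWithin_iff.2 ⟨?_, Eventually.of_forall fun _ => Real.exp_pos _⟩
    exact Real.tendsto_exp_neg_atTop_nhds_zero.comp
      (Real.tendsto_sqrt_atTop.comp tendsto_log_natCast)
  filter_upwards [hlim.eventually hc] with n hn
  refine ⟨hn.1, (Real.le_exp_log _).trans (Real.exp_le_exp.2 (hn.2.trans_eq ?_))⟩
  rw [one_div, ← Real.exp_neg, Real.log_exp, neg_neg]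

/-! ### Choice of the parameters and the limiting bound -/

theorem tendsto_capFun_div : Tendsto (fun x => capFun x * x⁻¹) atTop (𝓝 0) := by
  have h := (isLittleO_log_rpow_rpow_atTop (1 / 4 : ℝ) one_pos).tendsto_div_nhds_zero
  refine h.congr fun x => ?_
  rw [Real.rpow_one, capFun, div_eq_mul_inv]

/-- The accuracy to which the divergence from the true instance is estimated. -/
def estAccuracy (C c₅ x : ℝ) : ℝ := min 1 ((C * ((capFun x)⁻¹ * (capFun x)⁻¹)) ^ (1 / c₅))

theorem slow_estAccuracy {C c₅ : ℝ} (hC : 0 < C) (hc₅ : 0 < c₅) : Slow (estAccuracy C c₅) :=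
  (Slow.const one_pos).min
    (((Slow.const hC).mul (Slow.inv_capFun.mul Slow.inv_capFun)).rpow (by positivity))

theorem estAccuracy_pos {C c₅ x : ℝ} (hC : 0 < C) (hx : 0 < capFun x) :
    0 < estAccuracy C c₅ x := lt_min one_pos (by positivity)

theorem estAccuracy_rpow_le {C c₅ x : ℝ} (hC : 0 < C) (hc₅ : 0 < c₅) (hx : 0 < capFun x) :
    estAccuracy C c₅ x ^ c₅ ≤ C * ((capFun x)⁻¹ * (capFun x)⁻¹) := by
  calc _ ≤ ((C * ((capFun x)⁻¹ * (capFun x)⁻¹)) ^ (1 / c₅)) ^ c₅ :=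
        Real.rpow_le_rpow (estAccuracy_pos hC hx).le (min_le_right _ _) hc₅.le
    _ = _ := by
        rw [← Real.rpow_mul (by positivity), one_div_mul_cancel hc₅.ne', Real.rpow_one]

/-- The regret bound divided by `ln n` converges to the cost of the weights. -/
theorem tendsto_normalized_bound {tol : ℕ → ℝ} (htol : Tendsto tol atTop (𝓝 0))
    (K Rm u S W c : ℝ) :
    Tendsto (fun n : ℕ =>
      let p := (cap n)⁻¹
      let q := (Real.log n)⁻¹
      K * Rm * ((Real.log (Real.log n))⁻¹ + q) +
      ((1 + p) * ((1 + p) * (c + 2 * (S * p ^ 2) * W) + tol n + 2 * (S * p) * K) +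
        K * Rm * (p + q)) + (u + 3 * K * Rm * q) * q +
      (3 * K * Rm * (cap n * q) + (u + 3 * K * Rm * q + Rm * q) * q)) atTop (𝓝 c) := by
  have hp : Tendsto (fun n : ℕ => (cap n)⁻¹) atTop (𝓝 0) :=
    (tendsto_capFun.comp tendsto_log_natCast).inv_tendsto_atTop
  have hq : Tendsto (fun n : ℕ => (Real.log n)⁻¹) atTop (𝓝 0) :=
    tendsto_log_natCast.inv_tendsto_atTop
  have hr : Tendsto (fun n : ℕ => (Real.log (Real.log n))⁻¹) atTop (𝓝 0) :=
    (Real.tendsto_log_atTop.comp tendsto_log_natCast).inv_tendsto_atTop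
  have hy : Tendsto (fun n : ℕ => cap n * (Real.log n)⁻¹) atTop (𝓝 0) :=
    tendsto_capFun_div.comp tendsto_log_natCast
  have hcont : Continuous fun v : ℝ × ℝ × ℝ × ℝ × ℝ =>
      K * Rm * (v.2.2.1 + v.2.1) +
      ((1 + v.1) * ((1 + v.1) * (c + 2 * (S * v.1 ^ 2) * W) + v.2.2.2.2 + 2 * (S * v.1) * K) +
        K * Rm * (v.1 + v.2.1)) + (u + 3 * K * Rm * v.2.1) * v.2.1 +
      (3 * K * Rm * v.2.2.2.1 + (u + 3 * K * Rm * v.2.1 + Rm * v.2.1) * v.2.1) := by fun_prop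
  have h := (hcont.tendsto (0, 0, 0, 0, 0)).comp
    (hp.prodMk_nhds (hq.prodMk_nhds (hr.prodMk_nhds (hy.prodMk_nhds htol))))
  simpa [Function.comp_def] using h

/-- This guarantees that the first two phases, of length `O((ln n)²)`, fit into the horizon. -/
theorem eventually_sq_le_natCast (C : ℝ) :
    ∀ᶠ n : ℕ in atTop, C * Real.log n ^ 2 ≤ n := by
  have h := ((Real.tendsto_pow_mul_exp_neg_atTop_nhds_zero 2).comp
    tendsto_log_natCast).const_mul C
  rw [mul_zero] at h
  filter_upwards [h.eventually_le_const one_pos, eventually_gt_atTop 0] with n hn h0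
  have h0' : (0 : ℝ) < n := by exact_mod_cast h0
  simp only [Function.comp_apply] at hn
  rw [Real.exp_neg, Real.exp_log h0', ← mul_assoc, ← div_eq_mul_inv, div_le_one h0'] at hn
  exact hn

set_option maxHeartbeats 1000000 in
/-- Every feasible weight vector bounds the asymptotic regret. -/
theorem eventually_regret_div_log_le {ν : Measure O} {R : O → ℝ} {Rmax : ℝ}
    {F : Set (Inst D O)} (hF : IsDecisionProblem ν R Rmax F)
    (h₁ : RenyiUniformConvergence ν F) (h₂ : LogCovering ν F) {f₀ : Inst D O} (hf₀ : f₀ ∈ F)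
    (h₃ : DensityControl ν F f₀) {tol : ℕ → ℝ} (htol : ∀ n, 0 ≤ tol n)
    (htol_lim : Tendsto tol atTop (𝓝 0)) {est : ℕ → List O → Inst D O}
    {wt : ℕ → List O → D → ℝ≥0} {ucb : ℕ → List (D × O) → D}
    (hest : ∀ n, IsMLE F n (tol n) (est n))
    (hwt : ∀ n, SolvesProgram ν R F n (tol n) (est n) (wt n))
    (hucb : ∀ n, IsUCB R Rmax n (ucb n)) {B : ℝ} {w : D → ℝ≥0} (hw : Feasible ν R F f₀ B w)
    {a : ℝ} (ha : ∑ π, (w π : ℝ) * gap ν R f₀ π < a) :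
    ∀ᶠ n : ℕ in atTop,
      regret ν R f₀ (t2c ν R F n (est n) (wt n) (ucb n)) n / Real.log n ≤ a := by
  obtain ⟨⟨cmin, hcmin, hmin⟩, ι, c₅, hι, hc₅, hctrl⟩ := h₃
  obtain ⟨c₁, c₂, c₃, κ, hc₁, hc₂, hc₃, hκ, haff⟩ := exists_affinity_le hF h₁ hf₀
  obtain ⟨c, hcov⟩ := eventually_coveringNumber_le h₂
  have hR := hF.Rmax_nonneg hf₀
  set K : ℝ := (Fintype.card D : ℝ) with hK
  have hK1 : 1 ≤ K := by rw [hK]; exact_mod_cast Fintype.card_pos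
  set V : ℝ := (ν Set.univ).toReal with hV
  have hV0 : 0 ≤ V := ENNReal.toReal_nonneg
  set W : ℝ := ∑ π, (w π : ℝ) with hW
  have hW0 : 0 ≤ W := Finset.sum_nonneg fun _ _ => NNReal.coe_nonneg _
  -- Chosen so that `ι δ^c₅ ≤ C ι / b² = cmin η`, the sup-distance needed for a relative
  -- perturbation of size `η`.
  set C : ℝ := cmin / (64 * K) / ι with hC
  have hC0 : 0 < C := by positivity
  set S : ℝ := Rmax * V * (cmin / (64 * K)) with hS
  set u := ucbConst ν R Rmax f₀ with hu
  set δ : ℝ → ℝ := estAccuracy C c₅ with hδ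
  set lam₁ : ℝ → ℝ := fun x => renyiOrder c₁ c₂ c₃ κ (δ x * (1 / 2)) 1 with hlam₁
  set lam₂ : ℝ → ℝ := fun x => renyiOrder c₁ c₂ c₃ κ
    (1 / (4 * K) * ((capFun x)⁻¹ * (capFun x)⁻¹)) (2 * capFun x) with hlam₂
  have hslow₁ : Slow lam₁ := slow_renyiOrder hc₁ hc₂ hc₃ hκ
    ((slow_estAccuracy hC0 hc₅).mul (Slow.const (by norm_num))) (Slow.const (by norm_num))
  have hslow₂ : Slow lam₂ := by
    refine slow_renyiOrder hc₁ hc₂ hc₃ hκ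
      ((Slow.const (by positivity)).mul (Slow.inv_capFun.mul Slow.inv_capFun)) ?_
    have := (Slow.const (c := 1 / 2) (by norm_num)).mul Slow.inv_capFun
    simpa [mul_comm] using this
  have hgap : ∀ᶠ n : ℕ in atTop, ∀ π, π ≠ best ν R f₀ →
      2 * (S * ((cap n)⁻¹) ^ 2) < gap ν R f₀ π := by
    refine eventually_all.2 fun π => ?_
    by_cases hπ : π = best ν R f₀
    · exact Eventually.of_forall fun _ h => absurd hπ h
    have hlim : Tendsto (fun n : ℕ => 2 * (S * ((cap n)⁻¹) ^ 2)) atTop (𝓝 0) := by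
      have := (((tendsto_capFun.comp tendsto_log_natCast).inv_tendsto_atTop.pow 2).const_mul
        S).const_mul 2
      simpa [Function.comp_def, cap_eq] using this
    filter_upwards [hlim.eventually_lt_const (gap_pos_of_ne_best hF hf₀ hπ)] with n hn _ using hn
  have hcapt : Tendsto cap atTop atTop := tendsto_capFun.comp tendsto_log_natCast
  -- The requirement `cap n ≥ 2 + 2 W` makes `(1 + 1/b) w` obey the cap and controls the feasibility
  -- loss `2 η W`.
  filter_upwards [hcov, hgap, hcapt.eventually_ge_atTop (2 + 2 * W),
    tendsto_log_natCast.eventually_ge_atTop 1, initCount_bounds,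
    eventually_sq_le_natCast (5 * K), eventually_ge_atTop 1,
    eventually_estimationError_le (D := D) (slow_estAccuracy hC0 hc₅) hslow₁
      (fun _ => renyiOrder_le) htol_lim V c hV0,
    eventually_rejectionError_le (D := D) hslow₂ V c hV0,
    tendsto_log_natCast.eventually (capFun_le_rpow one_pos),
    (tendsto_normalized_bound htol_lim K Rmax u S W
      (∑ π, (w π : ℝ) * gap ν R f₀ π)).eventually_le_const ha] with
    n hcov hgap hbW hL hm hsq hn hER hRJ hbL hbound
  have hb : 2 ≤ cap n := by linarith
  have hb0 : 0 < cap n := by linarith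
  have hbx : 0 < capFun (Real.log n) := hb0
  rw [Real.rpow_one, ← cap_eq] at hbL
  set b := cap n with hbdef
  set L := Real.log n with hLdef
  set η : ℝ := 1 / (64 * K * b ^ 2) with hη
  have hη0 : 0 < η := by positivity
  have hIB : identBound D n ≤ K * (3 * (b * L)) := identBound_le hb hL
  have hcη : cmin * η = cmin / (64 * K) * b⁻¹ ^ 2 := by rw [hη]; field_simp
  have hs : Rmax * V * (cmin * η) = S * b⁻¹ ^ 2 := by rw [hcη, hS]; ring
  have hθ : ((Real.toNNReal b⁻¹ : ℝ≥0) : ℝ) = b⁻¹ := Real.coe_toNNReal _ (by positivity)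
  have hεeq : 1 / (4 * K * b ^ 2) = 1 / (4 * K) * ((capFun L)⁻¹ * (capFun L)⁻¹) := by
    rw [hLdef, ← cap_eq, ← hbdef]; field_simp
  have key := ofReal_regret_le hF h₁ h₂.2 hf₀ hcmin hmin hι hc₅ hctrl hn (htol n) (hest n)
    (hwt n) (hucb n) hw (η := η) (δ := δ L) (M := √L) (X := Real.exp (c * √L))
    (lam₁ := lam₁ L) (lam₂ := lam₂ L) (θ := Real.toNNReal b⁻¹) hη0.le
    (le_of_eq (by rw [← hK, ← hbdef, hη]; field_simp)) hb
    (by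
      rw [hθ]
      have h1 : η + 2 * η * W ≤ b⁻¹ / 2 := by
        have : η * (1 + 2 * W) ≤ η * (32 * K * b) := by
          gcongr
          nlinarith
        calc η + 2 * η * W = η * (1 + 2 * W) := by ring
          _ ≤ η * (32 * K * b) := this
          _ = b⁻¹ / 2 := by rw [hη]; field_simp; norm_num
      have h2 : b⁻¹ ≤ 1 := inv_le_one_of_one_le₀ (by linarith)
      have h3 : 0 < b⁻¹ := by positivity
      calc (1 : ℝ) ≤ (1 + b⁻¹) * (1 - b⁻¹ / 2) := by nlinarith
        _ ≤ (1 + b⁻¹) * (1 - η - 2 * η * W) :=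
            mul_le_mul_of_nonneg_left (by linarith) (by positivity))
    (by
      intro π
      rw [hθ]
      have h1 : (w π : ℝ) ≤ W :=
        Finset.single_le_sum (f := fun π => (w π : ℝ)) (fun _ _ => NNReal.coe_nonneg _)
          (Finset.mem_univ π)
      have h2 : b⁻¹ ≤ 1 := inv_le_one_of_one_le₀ (by linarith)
      have h3 : (0 : ℝ) ≤ w π := NNReal.coe_nonneg _
      nlinarith)
    (by intro π hπ; rw [hs]; exact hgap π hπ)
    (estAccuracy_pos hC0 hbx) (min_le_left _ _)
    (by
      calc ι * δ L ^ c₅ ≤ ι * (C * ((capFun L)⁻¹ * (capFun L)⁻¹)) := by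
            gcongr
            exact estAccuracy_rpow_le hC0 hc₅ hbx
        _ = cmin * η := by
            rw [hcη, hC, hLdef, ← cap_eq, ← hbdef]
            field_simp)
    (by
      calc K * initCount n + identBound D n ≤ K * (2 * L ^ 2) + K * (3 * (L * L)) := by
            gcongr
            · refine hm.2.2.trans ?_
              nlinarith
            · exact hIB.trans (by gcongr)
        _ = 5 * K * L ^ 2 := by ring
        _ ≤ n := hsq)
    (renyiOrder_pos hc₂ hκ (mul_pos (estAccuracy_pos hC0 hbx) (by norm_num)) one_pos)
    renyiOrder_le
    (renyiOrder_pos hc₂ hκ (by positivity) (by positivity)) renyiOrder_le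
    (by
      intro g hg π
      rw [div_eq_mul_one_div (δ L) 2]
      exact haff _ (mul_pos (estAccuracy_pos hC0 hbx) (by norm_num)) _ one_pos g hg π)
    (by
      intro g hg π
      rw [hεeq]
      exact haff _ (by positivity) _ (by positivity) g hg π)
    hcov.1 hcov.2
  have hL0 : 0 < L := by linarith
  have hu0 : 0 ≤ u :=
    Finset.sum_nonneg fun π _ => div_nonneg (by positivity) (gap_nonneg _ _ _ _)
  have ha0 : 0 ≤ a :=
    le_trans (Finset.sum_nonneg fun π _ => mul_nonneg (NNReal.coe_nonneg _)
      (gap_nonneg _ _ _ _)) ha.le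
  rw [div_le_iff₀ hL0]
  -- Comparison of `ENNReal.ofReal` values leaves the alternative of a nonpositive regret, which is
  -- harmless as `a ≥ 0`.
  rcases (ENNReal.ofReal_le_ofReal_iff').1 key with hle | hle
  swap
  · exact hle.trans (by positivity)
  refine hle.trans (le_trans ?_ (mul_le_mul_of_nonneg_right hbound hL0.le))
  have hIB0 : 0 ≤ identBound D n := by unfold identBound; positivity
  calc _ ≤ K * (L * (Real.log L)⁻¹ + 1) * Rmax +
      (goodCost ν R Rmax f₀ n w (Real.toNNReal b⁻¹) (Rmax * V * (cmin * η)) (tol n) +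
        (u * L + 3 * K * Rmax) * L⁻¹) +
      (K * (3 * (b * L)) * Rmax + (u * L + 3 * K * Rmax) + Rmax) * L⁻¹ := by
        gcongr
        · exact hm.2.1
        · unfold estimationError
          positivity
    _ = _ := by
        rw [goodCost, hs, hθ, ← hbdef, ← hLdef, ← hW, ← hK]
        field_simp
        ring

/-- The asymptotic regret of Test-to-Commit is at most the complexity of the instance. -/
theorem limsup_regret_div_log_le {ν : Measure O} {R : O → ℝ} {Rmax : ℝ}
    {F : Set (Inst D O)} (hF : IsDecisionProblem ν R Rmax F)
    (h₁ : RenyiUniformConvergence ν F) (h₂ : LogCovering ν F) {f₀ : Inst D O} (hf₀ : f₀ ∈ F)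
    (h₃ : DensityControl ν F f₀) {tol : ℕ → ℝ} (htol : ∀ n, 0 ≤ tol n)
    (htol_lim : Tendsto tol atTop (𝓝 0)) {est : ℕ → List O → Inst D O}
    {wt : ℕ → List O → D → ℝ≥0} {ucb : ℕ → List (D × O) → D}
    (hest : ∀ n, IsMLE F n (tol n) (est n))
    (hwt : ∀ n, SolvesProgram ν R F n (tol n) (est n) (wt n))
    (hucb : ∀ n, IsUCB R Rmax n (ucb n)) :
    limsup (fun n : ℕ => ((regret ν R f₀ (t2c ν R F n (est n) (wt n) (ucb n)) n /
      Real.log n : ℝ) : EReal)) atTop ≤ ((complexity ν R F f₀ : ℝ≥0∞) : EReal) := by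
  refine le_of_forall_gt_imp_ge_of_dense fun a ha => ?_
  rcases eq_or_ne a ⊤ with rfl | hatop
  · exact le_top
  have ha0 : 0 < a := (EReal.coe_ennreal_nonneg _).trans_lt ha
  lift a to ℝ using ⟨hatop, (EReal.bot_lt_zero.trans ha0).ne'⟩
  have ha0' : 0 < a := by exact_mod_cast ha0
  have hlt : complexity ν R F f₀ < ENNReal.ofReal a := by
    rw [← EReal.coe_ennreal_lt_coe_ennreal_iff, EReal.coe_ennreal_ofReal, max_eq_left ha0'.le]
    exact ha
  -- A value below `a` is already attained at some finite cap `k`, hence by fixed weights that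
  -- remain admissible for all large `n`.
  obtain ⟨k, hk⟩ := ((tendsto_complexity ν R F f₀).eventually_lt_const hlt).exists
  simp only [complexityAt, iInf_lt_iff] at hk
  obtain ⟨w, hw, hcost⟩ := hk
  have hcost' : ∑ π, (w π : ℝ) * gap ν R f₀ π < a := by
    refine (ENNReal.ofReal_lt_ofReal_iff ha0').1 (lt_of_eq_of_lt ?_ hcost)
    exact (cost_eq_ofReal ν R f₀ w).symm
  refine limsup_le_of_le (by isBoundedDefault) ?_
  filter_upwards [eventually_regret_div_log_le hF h₁ h₂ hf₀ h₃ htol htol_lim hest hwt hucb hw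
    hcost'] with n hn
  exact_mod_cast hn

end

end T2C

end

theorem mainTheorem3 {D O : Type*} [Fintype D] [Nonempty D] [MeasurableSpace O]
    (ν : MeasureTheory.Measure O) (R : O → ℝ) (Rmax : ℝ) (F : Set (T2C.Inst D O))
    (hF : T2C.IsDecisionProblem ν R Rmax F)
    (h₁ : T2C.RenyiUniformConvergence ν F)
    (h₂ : T2C.LogCovering ν F)
    (fstar : T2C.Inst D O) (hfstar : fstar ∈ F)
    (h₃ : T2C.DensityControl ν F fstar)
    (tol : ℕ → ℝ) (htol : ∀ n, 0 ≤ tol n)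
    (htol_lim : Filter.Tendsto tol Filter.atTop (nhds 0))
    (est : ℕ → List O → T2C.Inst D O) (wt : ℕ → List O → D → NNReal)
    (ucb : ℕ → List (D × O) → D)
    (hest : ∀ n, T2C.IsMLE F n (tol n) (est n))
    (hwt : ∀ n, T2C.SolvesProgram ν R F n (tol n) (est n) (wt n))
    (hucb : ∀ n, T2C.IsUCB R Rmax n (ucb n)) :
    Filter.limsup (fun n : ℕ =>
        ((T2C.regret ν R fstar (T2C.t2c ν R F n (est n) (wt n) (ucb n)) n /
          Real.log n : ℝ) : EReal)) Filter.atTop ≤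
      ((T2C.complexity ν R F fstar : ENNReal) : EReal) := by
  exact T2C.limsup_regret_div_log_le hF h₁ h₂ hfstar h₃ htol htol_lim hest hwt hucb
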